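/- Let $n\ge 3$ and $N\ge n(n-1)/2$ be natural numbers, and let $G$ be a graph that is a disjoint union of infinitely many cliques, each of size $N$. Let $\rho\notin G$ be a new symbol; the colour of a label $(a,i)\in (G\cup\{\rho\})\times n$ is $i$. Let $\mathcal F$ be the class of all complete graphs $\Gamma$ with edges labelled by elements of $(G\cup\{\rho\})\times n$ such that for all distinct $x,y,z\in\Gamma$ with $\Gamma(y,x)=(a,i)$, $\Gamma(y,z)=(b,j)$, $\Gamma(x,z)=(c,l)$ one of the following holds: (1) $|\{i,j,l\}|>1$; (2) $a,b,c\in G$ and $\{a,b,c\}$ contains an edge of $G$; (3) exactly one of $a,b,c$ is $\rho$ and the other two form an edge of $G$; (4) at least two of $a,b,c$ are $\rho$. **Theorem.** There is a labelled graph $M\in\mathcal F$ such that * whenever $\Delta\subseteq\Delta'\in\mathcal F$ and $|\Delta'|\le n$, every embedding $\Delta\to M$ extends to an embedding $\Delta'\to M$; * $M$ is strongly $n$-homogeneous: every isomorphism between subgraphs of $M$ with fewer than $n$ nodes extends to an automorphism of $M$; and the following hold. View $M$ as a first-order structure with a binary relation symbol for each label, let $W\subseteq{}^nM$ be the set of the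 sequences $\bar a$ such that no edge $(a_i,a_j)$ is labelled by any $(\rho,l)$, and let $\mathfrak A$ be the relativized cylindric set algebra with unit $W$ and universe $\{\varphi^W:\varphi\in L^n\}$, where $L^n$ is the set of first-order formulas with variables $x_0,\dots,x_{n-1}$ and $\varphi^W$ is the set of assignments in $W$ that satisfy $\varphi$, only assignments in $W$ being permitted in the interpretation of the quantifiers. Then: 1. $\mathfrak A$ is atomic, and $\mathfrak A\in\mathsf{RCA}_n$, that is, $\mathfrak A$ is isomorphic to a subalgebra of a product of $n$-dimensional cylindric set algebras with square units. 2. There is an atomic representable relation algebra $\mathfrak R$ such that the set of all $n$-dimensional basic matrices over $\mathfrak R$ is an $n$-dimensional cylindric basis of $\mathfrak R$, and $\mathfrak A\cong\mathsf{Mat}_n\mathfrak R$, where $\mathsf{Mat}_n\mathfrak R$ is the subalgebra, generated by the singletons, of the complex algebra of the cylindric atom structure of all $n$-dimensional basic matrices over $\mathfrak R$. 3. The complex algebras of the atom structures of $\mathfrak A$ and of $\mathfrak R$ are the completions of $\mathfrak A$ and of $\mathfrak R$, and neither of them is representable. 4. Neither $\mathfrak A$ nor $\mathfrak R$ is completely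 representable, that is, neither has a representation preserving all existing suprema. -/

import Mathlib

universe u v

/-! ## Algebras of cylindric type -/

/-- An algebra of the similarity type of `n`-dimensional cylindric algebras: a Boolean algebra with
cylindrifications `cᵢ` and diagonal elements `dᵢⱼ`. -/
structure CylAlg (n : ℕ) : Type (u + 1) where
  carrier : Type u
  [ba : BooleanAlgebra carrier]
  cyl : Fin n → carrier → carrier
  diag : Fin n → Fin n → carrier

attribute [instance] CylAlg.ba

namespace CylAlg

variable {n : ℕ}

/-- Homomorphisms of algebras of cylindric type. -/
structure IsHom (A : CylAlg.{u} n) (B : CylAlg.{v} n) (f : A.carrier → B.carrier) : Prop where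
  map_sup : ∀ x y, f (x ⊔ y) = f x ⊔ f y
  map_compl : ∀ x, f xᶜ = (f x)ᶜ
  map_cyl : ∀ i x, f (A.cyl i x) = B.cyl i (f x)
  map_diag : ∀ i j, f (A.diag i j) = B.diag i j

/-- `A ≅ B`. -/
def Isomorphic (A : CylAlg.{u} n) (B : CylAlg.{v} n) : Prop :=
  ∃ f : A.carrier → B.carrier, IsHom A B f ∧ Function.Bijective f

/-- The full relativized set algebra with unit `W ⊆ ⁿU`. -/
def relSetAlg {U : Type u} (W : Set (Fin n → U)) : CylAlg.{u} n where
  carrier := Set W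
  cyl i X := {s | ∃ t ∈ X, ∀ j, j ≠ i → t.1 j = s.1 j}
  diag i j := {s | s.1 i = s.1 j}

/-- The full cylindric set algebra of dimension `n` on the square unit `ⁿU`. -/
def full (n : ℕ) (U : Type u) : CylAlg.{u} n := relSetAlg (Set.univ : Set (Fin n → U))

/-- The direct product of a family of algebras. -/
def pi {I : Type u} (A : I → CylAlg.{u} n) : CylAlg.{u} n where
  carrier := ∀ i, (A i).carrier
  cyl k x := fun i => (A i).cyl k (x i)
  diag k l := fun i => (A i).diag k l

/-- `A` is in `RCA_n`: it is isomorphic to a subalgebra of a direct product of cylindric set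
algebras of dimension `n` on non-empty bases. -/
def Representable (A : CylAlg.{u} n) : Prop :=
  ∃ (I : Type u) (U : I → Type u), (∀ i, Nonempty (U i)) ∧
    ∃ f : A.carrier → (pi fun i => full n (U i)).carrier,
      IsHom A (pi fun i => full n (U i)) f ∧ Function.Injective f

/-- `A` has a representation that preserves all existing suprema (hence all existing infima). -/
def CompletelyRepresentable (A : CylAlg.{u} n) : Prop :=
  ∃ (I : Type u) (U : I → Type u), (∀ i, Nonempty (U i)) ∧
    ∃ f : A.carrier → (pi fun i => full n (U i)).carrier,
      IsHom A (pi fun i => full n (U i)) f ∧ Function.Injective f ∧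
        ∀ (X : Set A.carrier) (a : A.carrier), IsLUB X a → IsLUB (f '' X) (f a)

/-- The complex algebra of the atom structure of `A`: the atom structure consists of the atoms of
`A`, with the relations `a ≤ cᵢ b` and the predicates `a ≤ dᵢⱼ`. -/
def complexAlg (A : CylAlg.{u} n) : CylAlg.{u} n where
  carrier := Set {a : A.carrier // IsAtom a}
  cyl i X := {a | ∃ b ∈ X, a.1 ≤ A.cyl i b.1}
  diag i j := {a | a.1 ≤ A.diag i j}

/-- `B` is the (Dedekind–MacNeille, or Monk) completion of `A`: a complete algebra with completely
additive operators that has `A` as a dense subalgebra. -/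
def IsCompletion (A B : CylAlg.{u} n) : Prop :=
  (∀ X : Set B.carrier, ∃ b, IsLUB X b) ∧
  (∀ (i : Fin n) (X : Set B.carrier) (b : B.carrier),
    IsLUB X b → IsLUB (B.cyl i '' X) (B.cyl i b)) ∧
  ∃ f : A.carrier → B.carrier, IsHom A B f ∧ Function.Injective f ∧
    ∀ b : B.carrier, b ≠ ⊥ → ∃ a : A.carrier, a ≠ ⊥ ∧ f a ≤ b

/-- A subset of `A` closed under the operations. -/
structure IsSubuniverse (A : CylAlg.{u} n) (S : Set A.carrier) : Prop where
  bot_mem : ⊥ ∈ S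
  sup_mem : ∀ x ∈ S, ∀ y ∈ S, x ⊔ y ∈ S
  compl_mem : ∀ x ∈ S, xᶜ ∈ S
  cyl_mem : ∀ i, ∀ x ∈ S, A.cyl i x ∈ S
  diag_mem : ∀ i j, A.diag i j ∈ S

/-- The Boolean subalgebra underlying a subuniverse. -/
def IsSubuniverse.toBoolean {A : CylAlg.{u} n} {S : Set A.carrier} (h : A.IsSubuniverse S) :
    BooleanSubalgebra A.carrier where
  carrier := S
  supClosed' := fun x hx y hy => h.sup_mem x hx y hy
  infClosed' := fun x hx y hy => by
    have := h.compl_mem _ (h.sup_mem _ (h.compl_mem _ hx) _ (h.compl_mem _ hy))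
    simpa [compl_sup] using this
  compl_mem' := fun {x} hx => h.compl_mem x hx
  bot_mem' := h.bot_mem

/-- The subalgebra of `A` on a subuniverse. -/
def sub (A : CylAlg.{u} n) (S : Set A.carrier) (h : A.IsSubuniverse S) : CylAlg.{u} n where
  carrier := h.toBoolean
  cyl i x := ⟨A.cyl i x.1, h.cyl_mem i x.1 x.2⟩
  diag i j := ⟨A.diag i j, h.diag_mem i j⟩

/-- The elements of `A` generated by the set `X`. -/
inductive Generated (A : CylAlg.{u} n) (X : Set A.carrier) : A.carrier → Prop
  | of (x : A.carrier) : x ∈ X → Generated A X x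
  | bot : Generated A X ⊥
  | sup (x y : A.carrier) : Generated A X x → Generated A X y → Generated A X (x ⊔ y)
  | compl (x : A.carrier) : Generated A X x → Generated A X xᶜ
  | cyl (i : Fin n) (x : A.carrier) : Generated A X x → Generated A X (A.cyl i x)
  | diag (i j : Fin n) : Generated A X (A.diag i j)

theorem isSubuniverse_generated (A : CylAlg.{u} n) (X : Set A.carrier) :
    A.IsSubuniverse {x | A.Generated X x} where
  bot_mem := Generated.bot
  sup_mem x hx y hy := Generated.sup x y hx hy
  compl_mem x hx := Generated.compl x hx
  cyl_mem i x hx := Generated.cyl i x hx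
  diag_mem i j := Generated.diag i j

/-- The subalgebra of `A` generated by the set `X`. -/
def generatedBy (A : CylAlg.{u} n) (X : Set A.carrier) : CylAlg.{u} n :=
  A.sub {x | A.Generated X x} (A.isSubuniverse_generated X)

end CylAlg

/-! ## Algebras of relation-algebra type -/

/-- An algebra of the similarity type of relation algebras: a Boolean algebra with composition,
converse and an identity element. -/
structure RelAlg : Type (u + 1) where
  carrier : Type u
  [ba : BooleanAlgebra carrier]
  comp : carrier → carrier → carrier
  conv : carrier → carrier
  ident : carrier

attribute [instance] RelAlg.ba

namespace RelAlg

/-- Homomorphisms of algebras of relation-algebra type. -/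
structure IsHom (A : RelAlg.{u}) (B : RelAlg.{v}) (f : A.carrier → B.carrier) : Prop where
  map_sup : ∀ x y, f (x ⊔ y) = f x ⊔ f y
  map_compl : ∀ x, f xᶜ = (f x)ᶜ
  map_comp : ∀ x y, f (A.comp x y) = B.comp (f x) (f y)
  map_conv : ∀ x, f (A.conv x) = B.conv (f x)
  map_ident : f A.ident = B.ident

/-- The full relation set algebra of all binary relations on `U`. -/
def full (U : Type u) : RelAlg.{u} where
  carrier := Set (U × U)
  comp r s := {p | ∃ z, (p.1, z) ∈ r ∧ (z, p.2) ∈ s}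
  conv r := {p | (p.2, p.1) ∈ r}
  ident := {p | p.1 = p.2}

/-- The direct product of a family of algebras. -/
def pi {I : Type u} (A : I → RelAlg.{u}) : RelAlg.{u} where
  carrier := ∀ i, (A i).carrier
  comp x y := fun i => (A i).comp (x i) (y i)
  conv x := fun i => (A i).conv (x i)
  ident := fun i => (A i).ident

/-- `R` is in `RRA`: it is isomorphic to a subalgebra of a direct product of full relation set
algebras on non-empty bases. (In particular `R` is then a relation algebra.) -/
def Representable (R : RelAlg.{u}) : Prop :=
  ∃ (I : Type u) (U : I → Type u), (∀ i, Nonempty (U i)) ∧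
    ∃ f : R.carrier → (pi fun i => full (U i)).carrier,
      IsHom R (pi fun i => full (U i)) f ∧ Function.Injective f

/-- `R` has a representation that preserves all existing suprema (hence all existing infima). -/
def CompletelyRepresentable (R : RelAlg.{u}) : Prop :=
  ∃ (I : Type u) (U : I → Type u), (∀ i, Nonempty (U i)) ∧
    ∃ f : R.carrier → (pi fun i => full (U i)).carrier,
      IsHom R (pi fun i => full (U i)) f ∧ Function.Injective f ∧
        ∀ (X : Set R.carrier) (a : R.carrier), IsLUB X a → IsLUB (f '' X) (f a)

/-- The complex algebra of the atom structure of `R`. -/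
def complexAlg (R : RelAlg.{u}) : RelAlg.{u} where
  carrier := Set {a : R.carrier // IsAtom a}
  comp X Y := {c | ∃ a ∈ X, ∃ b ∈ Y, c.1 ≤ R.comp a.1 b.1}
  conv X := {b | ∃ a ∈ X, b.1 ≤ R.conv a.1}
  ident := {a | a.1 ≤ R.ident}

/-- `B` is the (Dedekind–MacNeille, or Monk) completion of `A`: a complete algebra with completely
additive operators that has `A` as a dense subalgebra. -/
def IsCompletion (A B : RelAlg.{u}) : Prop :=
  (∀ X : Set B.carrier, ∃ b, IsLUB X b) ∧
  (∀ (X : Set B.carrier) (b c : B.carrier), IsLUB X b →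
    IsLUB ((fun x => B.comp x c) '' X) (B.comp b c) ∧
    IsLUB ((fun x => B.comp c x) '' X) (B.comp c b) ∧
    IsLUB (B.conv '' X) (B.conv b)) ∧
  ∃ f : A.carrier → B.carrier, IsHom A B f ∧ Function.Injective f ∧
    ∀ b : B.carrier, b ≠ ⊥ → ∃ a : A.carrier, a ≠ ⊥ ∧ f a ≤ b

/-- `m` is an `n`-dimensional basic matrix over `R`: an `n × n` matrix of atoms with
`mᵢᵢ ≤ 1'`, `mᵢⱼ = (mⱼᵢ)˘` and `mᵢⱼ ≤ mᵢₖ ; mₖⱼ`. -/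
structure IsBasicMatrix (R : RelAlg.{u}) {n : ℕ} (m : Fin n → Fin n → R.carrier) : Prop where
  atom : ∀ i j, IsAtom (m i j)
  refl : ∀ i, m i i ≤ R.ident
  conv : ∀ i j, m i j = R.conv (m j i)
  tri : ∀ i j k, m i j ≤ R.comp (m i k) (m k j)

/-- `B` is an `n`-dimensional cylindric basis of `R` (in the sense of Maddux). -/
structure IsCylindricBasis (R : RelAlg.{u}) {n : ℕ} (hn : 3 ≤ n)
    (B : Set (Fin n → Fin n → R.carrier)) : Prop where
  basic : ∀ m ∈ B, R.IsBasicMatrix m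
  triangle : ∀ a b c : R.carrier, IsAtom a → IsAtom b → IsAtom c → a ≤ R.comp b c →
    ∃ m ∈ B, m ⟨0, by omega⟩ ⟨1, by omega⟩ = a ∧ m ⟨0, by omega⟩ ⟨2, by omega⟩ = b ∧
      m ⟨2, by omega⟩ ⟨1, by omega⟩ = c
  amalgamation : ∀ m ∈ B, ∀ m' ∈ B, ∀ i j : Fin n, i ≠ j →
    (∀ k l, k ≠ i → k ≠ j → l ≠ i → l ≠ j → m k l = m' k l) →
    ∃ p ∈ B, (∀ k l, k ≠ i → l ≠ i → m k l = p k l) ∧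
      (∀ k l, k ≠ j → l ≠ j → p k l = m' k l)

/-- The complex algebra of the atom structure of all `n`-dimensional basic matrices over `R`: here
`m` and `m'` are `i`-related if they agree off `i`, and `m` is in the `(i, j)`-diagonal if
`mᵢⱼ ≤ 1'`. -/
def matComplex (R : RelAlg.{u}) (n : ℕ) : CylAlg.{u} n where
  carrier := Set {m : Fin n → Fin n → R.carrier // R.IsBasicMatrix m}
  cyl i X := {m | ∃ m' ∈ X, ∀ k l, k ≠ i → l ≠ i → m.1 k l = m'.1 k l}
  diag i j := {m | m.1 i j ≤ R.ident}

/-- `Mat_n R`, the term algebra over the basic matrices: the subalgebra of the complex algebra that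
is generated by the singletons of basic matrices. -/
def mat (R : RelAlg.{u}) (n : ℕ) : CylAlg.{u} n :=
  (R.matComplex n).generatedBy
    (Set.range fun m : {m : Fin n → Fin n → R.carrier // R.IsBasicMatrix m} =>
      ({m} : Set {m : Fin n → Fin n → R.carrier // R.IsBasicMatrix m}))

end RelAlg

/-! ## Labelled graphs -/

/-- `G` is a disjoint union of infinitely many cliques of size `N`. -/
def IsUnionOfCliques {V : Type u} (G : SimpleGraph V) (N : ℕ) : Prop :=
  Infinite G.ConnectedComponent ∧
    ∀ c : G.ConnectedComponent, G.IsClique c.supp ∧ c.supp.ncard = N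

/-- The labels `(G ∪ {ρ}) × n`. The new colour `ρ` is `none`, a node `a` of the graph is `some a`.
The colour of a label is its second component. -/
abbrev EdgeLabel (V : Type u) (n : ℕ) : Type u := Option V × Fin n

/-- A complete graph on `M` whose edges are labelled. Only the values of `label` at distinct points
are used. -/
structure LabelledGraph (V : Type u) (n : ℕ) (M : Type v) where
  label : M → M → EdgeLabel V n
  symm : ∀ x y, label x y = label y x

/-- The condition on the three labels of a triangle: they do not all have the same colour, or they
are all nodes and there is an edge among them, or exactly one is `ρ` and the other two form an edge,
or at least two are `ρ`. -/
def TriangleOK {V : Type u} {n : ℕ} (G : SimpleGraph V) (p q r : EdgeLabel V n) : Prop :=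
  ¬ (p.2 = q.2 ∧ q.2 = r.2) ∨
  (∃ a b c : V, p.1 = some a ∧ q.1 = some b ∧ r.1 = some c ∧
    (G.Adj a b ∨ G.Adj a c ∨ G.Adj b c)) ∨
  ((p.1 = none ∧ ∃ b c : V, q.1 = some b ∧ r.1 = some c ∧ G.Adj b c) ∨
    (q.1 = none ∧ ∃ a c : V, p.1 = some a ∧ r.1 = some c ∧ G.Adj a c) ∨
    (r.1 = none ∧ ∃ a b : V, p.1 = some a ∧ q.1 = some b ∧ G.Adj a b)) ∨
  ((p.1 = none ∧ q.1 = none) ∨ (p.1 = none ∧ r.1 = none) ∨ (q.1 = none ∧ r.1 = none))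

namespace LabelledGraph

variable {V : Type u} {n : ℕ} {M : Type v}

/-- Membership in the class `F` of admissible labelled graphs over `G`. -/
def Admissible (Γ : LabelledGraph V n M) (G : SimpleGraph V) : Prop :=
  ∀ x y z : M, x ≠ y → x ≠ z → y ≠ z →
    TriangleOK G (Γ.label y x) (Γ.label y z) (Γ.label x z)

/-- `θ`, restricted to `S`, is an embedding of labelled graphs. -/
def EmbeddingOn {D : Type*} (Δ : LabelledGraph V n D) (Γ : LabelledGraph V n M) (S : Set D)
    (θ : D → M) : Prop :=
  ∀ x ∈ S, ∀ y ∈ S, x ≠ y → θ x ≠ θ y ∧ Γ.label (θ x) (θ y) = Δ.label x y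

/-- Every embedding into `Γ` of a subgraph of an admissible labelled graph `Δ` with at most `n`
nodes extends to an embedding of `Δ`. -/
def ExtensionProperty (Γ : LabelledGraph V n M) (G : SimpleGraph V) : Prop :=
  ∀ k : ℕ, k ≤ n → ∀ Δ : LabelledGraph V n (Fin k), Δ.Admissible G →
    ∀ (S : Set (Fin k)) (θ : Fin k → M), EmbeddingOn Δ Γ S θ →
      ∃ θ' : Fin k → M, EmbeddingOn Δ Γ Set.univ θ' ∧ Set.EqOn θ' θ S

/-- `Γ` is strongly `n`-homogeneous: every isomorphism between subgraphs with fewer than `n` nodes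
extends to an automorphism of `Γ`. -/
def StronglyHomogeneous (Γ : LabelledGraph V n M) : Prop :=
  ∀ S : Finset M, S.card < n → ∀ θ : M → M, EmbeddingOn Γ Γ (S : Set M) θ →
    ∃ σ : M ≃ M, EmbeddingOn Γ Γ Set.univ σ ∧ Set.EqOn σ θ (S : Set M)

/-- The binary relation `R_l` on `M`, for a label `l`. -/
def Rel (Γ : LabelledGraph V n M) (l : EdgeLabel V n) (x y : M) : Prop :=
  x ≠ y ∧ Γ.label x y = l

/-- The set `W ⊆ ⁿM` of the sequences none of whose edges is labelled by some `(ρ, l)`. -/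
def W (Γ : LabelledGraph V n M) : Set (Fin n → M) :=
  {s | ∀ i j : Fin n, i < j → ∀ l : Fin n, ¬ Γ.Rel (none, l) (s i) (s j)}

end LabelledGraph

/-- First-order formulas in the variables `x₀, …, xₙ₋₁` over the signature with a binary relation
symbol `R_l` for every label `l`. -/
inductive Fml (V : Type u) (n : ℕ) : Type u
  | fls : Fml V n
  | eq (i j : Fin n) : Fml V n
  | rel (l : EdgeLabel V n) (i j : Fin n) : Fml V n
  | or (φ ψ : Fml V n) : Fml V n
  | not (φ : Fml V n) : Fml V n
  | ex (i : Fin n) (φ : Fml V n) : Fml V n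

namespace LabelledGraph

variable {V : Type u} {n : ℕ} {M : Type u}

/-- The set of the assignments in `W` that satisfy a formula, where only assignments in `W` are
permitted throughout. -/
def sem (Γ : LabelledGraph V n M) (W : Set (Fin n → M)) : Fml V n → Set W
  | .fls => ∅
  | .eq i j => {s | s.1 i = s.1 j}
  | .rel l i j => {s | Γ.Rel l (s.1 i) (s.1 j)}
  | .or φ ψ => sem Γ W φ ∪ sem Γ W ψ
  | .not φ => (sem Γ W φ)ᶜ
  | .ex i φ => {s | ∃ t ∈ sem Γ W φ, ∀ j, j ≠ i → t.1 j = s.1 j}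

theorem isSubuniverse_range_sem (Γ : LabelledGraph V n M) (W : Set (Fin n → M)) :
    (CylAlg.relSetAlg W).IsSubuniverse (Set.range (Γ.sem W)) where
  bot_mem := ⟨.fls, rfl⟩
  sup_mem := by
    rintro _ ⟨φ, rfl⟩ _ ⟨ψ, rfl⟩
    exact ⟨.or φ ψ, rfl⟩
  compl_mem := by
    rintro _ ⟨φ, rfl⟩
    exact ⟨.not φ, rfl⟩
  cyl_mem := by
    rintro i _ ⟨φ, rfl⟩
    exact ⟨.ex i φ, rfl⟩
  diag_mem i j := ⟨.eq i j, rfl⟩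

/-- The relativized set algebra with unit `W` and universe `{φ^W : φ ∈ Lⁿ}`. -/
def setAlg (Γ : LabelledGraph V n M) (W : Set (Fin n → M)) : CylAlg.{u} n :=
  (CylAlg.relSetAlg W).sub (Set.range (Γ.sem W)) (Γ.isSubuniverse_range_sem W)

end LabelledGraph

/-! ## Adjacency of labels -/

/-! If `ρ` is declared adjacent to itself and to nothing else, a triangle is admissible exactly when
it is not monochromatic or two of its labels carry adjacent nodes (`triangleOK_iff`). So `ρ` behaves
like one more clique, with a loop. Definability cannot tell it from a fresh clique of `G`, whereas
infinite joins can. The theorem rests on this contrast.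

The graph `M`. The disjoint union of all admissible graphs with at most `n` nodes, with `ρ` between
summands, is admissible. To make partial isomorphisms extend, take a copy of a graph for each
element of the free group on its small partial isomorphisms and glue neighbouring copies along them
(`Global`). The copies containing a point form a subtree of the Cayley tree. An edge between points
without a common copy is labelled `(ρ, c)`. A suitable `c` exists because the apexes of the
dangerous triangles all lie in the domain or range of one partial isomorphism, which has fewer than
`n` points, while there are `n` colours (`exists_notMem_badColours`). Old automorphisms survive the
gluing, so the limit of the iteration is strongly homogeneous. Homogeneity and universality give the
extension property.

The algebra `𝔄`. By homogeneity a formula cannot separate two tuples of `W` with the same edge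
labels, so the atoms are the types of tuples. For representability, send `φ^W` to the classical
meaning in `M` of `φ` with its `ρ`-atoms made false. This is well defined and injective by a
back-and-forth argument (`exists_sim`): tuples are compared up to a permutation of the cliques, `ρ`
included, that fixes the finitely many cliques named in the formulas. Adding a point requires nodes
in prescribed cliques that differ from each other and from the labels in use. This takes at most
`n(n-1)/2` nodes, hence the bound on `N`. A fresh clique can replace `ρ` because there are
infinitely many.

The algebra `ℜ` consists of the sets of atoms that are finite or cofinite in each colour. It is
represented on `M` by letting a `ρ`-edge of colour `i` belong to `X` when `X` is cofinite in colour
`i`: on such sets cofiniteness is an ultrafilter (`star_union`, `exists_of_star_compSet`,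
`star_compSet_of_exists`). Basic matrices are the types of tuples in `W`, which gives the cylindric
basis and `𝔄 ≅ Mat_n ℜ` (`isomorphic_mat`).

Failure of representability. Colour the nodes of `G` properly with `N` colours. With the `n` colours
of labels this splits the non-identity atoms into finitely many sets, none of which contains a
consistent triangle. These sets belong to the complex algebra. In a representation the base is
infinite, so Ramsey's theorem yields a triangle inside one of the sets, a contradiction
(`false_of_atom_relations`). In dimension `n` the same argument applies to the entries at `(0,1)`,
`(0,2)`, `(1,2)`. A complete representation of an atomic algebra would represent its complex
algebra, so it cannot exist either. -/

/-- Adjacency on `G ∪ {ρ}`, where `ρ` counts as adjacent to itself. -/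
def NodeAdj {V : Type u} (G : SimpleGraph V) : Option V → Option V → Prop
  | none, none => True
  | some a, some b => G.Adj a b
  | _, _ => False

theorem NodeAdj.symm {V : Type u} {G : SimpleGraph V} {p q : Option V} (h : NodeAdj G p q) :
    NodeAdj G q p := by
  cases p <;> cases q <;> simp_all [NodeAdj, G.adj_comm]

/-- The permitted monochromatic cases collapse into one: two `ρ`'s are adjacent, one `ρ` is adjacent
to no node, and otherwise an edge of `G` is required. -/
theorem triangleOK_iff {V : Type u} {n : ℕ} (G : SimpleGraph V) (p q r : EdgeLabel V n) :
    TriangleOK G p q r ↔ (p.2 = q.2 → q.2 = r.2 →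
      NodeAdj G p.1 q.1 ∨ NodeAdj G p.1 r.1 ∨ NodeAdj G q.1 r.1) := by
  obtain ⟨p, i⟩ := p
  obtain ⟨q, j⟩ := q
  obtain ⟨r, k⟩ := r
  cases p <;> cases q <;> cases r <;> simp [TriangleOK, NodeAdj] <;> tauto

theorem TriangleOK.rotate {V : Type u} {n : ℕ} {G : SimpleGraph V} {p q r : EdgeLabel V n}
    (h : TriangleOK G p q r) : TriangleOK G q r p := by
  rw [triangleOK_iff] at *
  intro h1 h2
  rcases h (h2.symm ▸ h1.symm ▸ rfl) h1 with h | h | h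
  · exact .inr (.inl h.symm)
  · exact .inr (.inr h.symm)
  · exact .inl h

theorem TriangleOK.swap {V : Type u} {n : ℕ} {G : SimpleGraph V} {p q r : EdgeLabel V n}
    (h : TriangleOK G p q r) : TriangleOK G q p r := by
  rw [triangleOK_iff] at *
  intro h1 h2
  rcases h h1.symm (h1.trans h2) with h | h | h
  · exact .inl h.symm
  · exact .inr (.inr h)
  · exact .inr (.inl h)

/-! ## Convex sets in free groups -/

namespace FreeGroup

variable {α : Type u}

theorem exists_isReduced (g : FreeGroup α) : ∃ L, IsReduced L ∧ mk L = g := by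
  classical
  exact ⟨g.toWord, isReduced_toWord, mk_toWord⟩

theorem mk_eq_of_step {L L' : List (α × Bool)} (h : Red.Step L L') : mk L = mk L' := Quot.sound h

theorem red_of_mk_eq {L L' : List (α × Bool)} (h' : IsReduced L') (h : mk L = mk L') :
    Red L L' := by
  obtain ⟨c, h1, h2⟩ := Red.exact.1 h
  rwa [h'.red_iff_eq.1 h2] at h1

/-- Convexity in the Cayley tree of the free group. -/
def IsConvex (C : Set (FreeGroup α)) : Prop :=
  ∀ g L₁ L₂, IsReduced (L₁ ++ L₂) → g ∈ C → g * mk (L₁ ++ L₂) ∈ C → g * mk L₁ ∈ C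

theorem IsConvex.inter {C D : Set (FreeGroup α)} (hC : IsConvex C) (hD : IsConvex D) :
    IsConvex (C ∩ D) := fun g L₁ L₂ h h1 h2 =>
  ⟨hC g L₁ L₂ h h1.1 h2.1, hD g L₁ L₂ h h1.2 h2.2⟩

/-- Disjoint convex sets are separated by an edge that belongs to all convex sets which meet both
of them. -/
theorem IsConvex.exists_bridge {A B : Set (FreeGroup α)} (hA : IsConvex A) (hB : IsConvex B)
    (hA' : A.Nonempty) (hB' : B.Nonempty) (hAB : Disjoint A B) :
    ∃ g ∈ A, ∃ s : α × Bool, g * mk [s] ∉ A ∧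
      ∀ C, IsConvex C → (C ∩ A).Nonempty → (C ∩ B).Nonempty → g ∈ C ∧ g * mk [s] ∈ C := by
  -- The bridge is the first edge of a shortest path from `A` to `B`. By minimality the path is
  -- reduced and leaves `A` at once.
  have hex : ∃ k : ℕ, ∃ g ∈ A, ∃ L : List (α × Bool), g * mk L ∈ B ∧ L.length = k := by
    obtain ⟨g, hg⟩ := hA'
    obtain ⟨h, hh⟩ := hB'
    obtain ⟨L, -, hL⟩ := exists_isReduced (g⁻¹ * h)
    exact ⟨_, g, hg, L, by simpa [hL] using hh, rfl⟩
  classical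
  obtain ⟨g, hg, L, hL, hk⟩ := Nat.find_spec hex
  have hmin : ∀ g' ∈ A, ∀ L', g' * mk L' ∈ B → L.length ≤ L'.length := fun g' hg' L' hL' =>
    hk ▸ Nat.find_min' hex ⟨g', hg', L', hL', rfl⟩
  have hred : IsReduced L := IsReduced.of_forall_not_step fun L' hs => by
    have h1 := hmin g hg L' (by rwa [← mk_eq_of_step hs])
    have h2 := hs.length
    omega
  cases L with
  | nil => exact (Set.disjoint_left.1 hAB hg (by simpa [← one_eq_mk] using hL)).elim
  | cons s w =>
    have hs : g * mk [s] ∉ A := fun h => by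
      have := hmin _ h w (by
        rw [mul_assoc, mul_mk]
        simpa using hL)
      simp at this
    refine ⟨g, hg, s, hs, fun C hC hCA hCB => ?_⟩
    obtain ⟨g', hg'C, hg'A⟩ := hCA
    obtain ⟨h', hh'C, hh'B⟩ := hCB
    obtain ⟨a, har, ha⟩ := exists_isReduced (g'⁻¹ * g)
    obtain ⟨b, hbr, hb⟩ := exists_isReduced ((g * mk (s :: w))⁻¹ * h')
    have hga : g' * mk a = g := by simp [ha]
    -- A path that reaches `g` from inside `A` cannot backtrack into the bridge: cancellation would
    -- put `g * mk [s]` on a geodesic between points of `A`.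
    have haw : IsReduced (a ++ s :: w) := by
      refine List.isChain_append.2 ⟨har, hred, ?_⟩
      intro x hx y hy hxy
      obtain rfl : s = y := by simpa using hy
      by_contra hne
      obtain ⟨a', rfl⟩ : ∃ a', a = a' ++ [x] := by
        rcases List.eq_nil_or_concat a with rfl | ⟨a', z, rfl⟩
        · simp at hx
        · simp at hx
          exact ⟨a', by simp [hx]⟩
      apply hs
      have : g * mk [s] = g' * mk a' := by
        rw [← hga, mul_assoc, mul_mk, List.append_assoc]
        congr 1
        obtain ⟨x1, x2⟩ := x
        obtain ⟨s1, s2⟩ := s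
        obtain rfl : x1 = s1 := hxy
        obtain rfl : s2 = !x2 := by
          cases x2 <;> cases s2 <;> simp_all
        simpa using (mk_eq_of_step (Red.Step.not (L₁ := a') (L₂ := []) (x := x1) (b := x2)))
      rw [this]
      exact hA g' a' [x] har hg'A (by rwa [hga])
    -- Cancellation at the far end would put the last but one vertex of the path into `B`, against
    -- minimality.
    have hwb : IsReduced (s :: w ++ b) := by
      refine List.isChain_append.2 ⟨hred, hbr, ?_⟩
      intro x hx y hy hxy
      by_contra hne
      obtain ⟨w', hw'⟩ : ∃ w', s :: w = w' ++ [x] := by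
        rcases List.eq_nil_or_concat (s :: w) with h | ⟨a', z, h⟩
        · simp at h
        · rw [h] at hx
          simp at hx
          exact ⟨a', by simp [h, hx]⟩
      obtain ⟨b', rfl⟩ : ∃ b', b = y :: b' := by
        cases b with
        | nil => simp at hy
        | cons z b' => exact ⟨b', by simp at hy; simp [hy]⟩
      have h1 : g * mk (s :: w) * mk [y] ∈ B := hB _ [y] b' hbr hL (by
        show g * mk (s :: w) * mk (y :: b') ∈ B
        rw [hb, mul_inv_cancel_left]
        exact hh'B)
      have h2 : g * mk (s :: w) * mk [y] = g * mk w' := by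
        rw [mul_assoc, mul_mk, hw', List.append_assoc]
        congr 1
        obtain ⟨x1, x2⟩ := x
        obtain ⟨s1, s2⟩ := y
        obtain rfl : x1 = s1 := hxy
        obtain rfl : s2 = !x2 := by
          cases x2 <;> cases s2 <;> simp_all
        simpa using (mk_eq_of_step (Red.Step.not (L₁ := w') (L₂ := []) (x := x1) (b := x2)))
      have h3 := hmin g hg w' (h2 ▸ h1)
      rw [hw'] at h3
      simp at h3
    -- The two reduced words overlap in the nonempty word `s :: w`, so the concatenation is the
    -- geodesic from `g'` to `h'`, and convexity of `C` applies along it.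
    have hall : IsReduced (a ++ s :: w ++ b) := haw.append_overlap hwb (by simp)
    have hend : g' * mk (a ++ s :: w ++ b) = h' := by
      rw [← mul_mk, ← mul_mk, hb, ha]
      group
    constructor
    · rw [← hga]
      exact hC g' a (s :: w ++ b) (by simpa using hall) hg'C (by
        rw [← List.append_assoc, hend]
        exact hh'C)
    · have : g * mk [s] = g' * mk (a ++ [s]) := by rw [← mul_mk, ← mul_assoc, hga]
      rw [this]
      have h4 : a ++ [s] ++ (w ++ b) = a ++ s :: w ++ b := by simp
      exact hC g' (a ++ [s]) (w ++ b) (h4 ▸ hall) hg'C (by rw [h4, hend]; exact hh'C)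

end FreeGroup

/-! ## Extending all partial isomorphisms to automorphisms -/

namespace LabelledGraph

variable {V : Type u} {n : ℕ} {X : Type v}

/-- An automorphism of a labelled graph. -/
def IsAut (Γ : LabelledGraph V n X) (σ : X ≃ X) : Prop := EmbeddingOn Γ Γ Set.univ σ

theorem IsAut.label_eq {Γ : LabelledGraph V n X} {σ : X ≃ X} (h : Γ.IsAut σ) {x y : X}
    (hxy : x ≠ y) : Γ.label (σ x) (σ y) = Γ.label x y :=
  (h x trivial y trivial hxy).2

theorem IsAut.symm' {Γ : LabelledGraph V n X} {σ : X ≃ X} (h : Γ.IsAut σ) : Γ.IsAut σ.symm :=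
  fun x _ y _ hxy => by
    have h1 : σ.symm x ≠ σ.symm y := fun h => hxy (σ.symm.injective h)
    exact ⟨h1, by simpa using (h.label_eq h1).symm⟩

/-- An isomorphism between subgraphs with fewer than `n` nodes. -/
@[ext]
structure PartialIso (Γ : LabelledGraph V n X) where
  dom : Finset X
  card_lt : dom.card < n
  toFun : X → X
  emb : EmbeddingOn Γ Γ (dom : Set X) toFun

variable {Γ : LabelledGraph V n X}

namespace PartialIso

/-- Conjugation of a partial isomorphism by an automorphism. -/
def conj (σ : X ≃ X) (hσ : Γ.IsAut σ) (θ : Γ.PartialIso) : Γ.PartialIso where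
  dom := θ.dom.map σ.toEmbedding
  card_lt := by simpa using θ.card_lt
  toFun := σ ∘ θ.toFun ∘ σ.symm
  emb := by
    intro x hx y hy hxy
    rw [Finset.mem_coe, Finset.mem_map] at hx hy
    obtain ⟨x, hx, rfl⟩ := hx
    obtain ⟨y, hy, rfl⟩ := hy
    have h : x ≠ y := fun h => hxy (h ▸ rfl)
    have := θ.emb x hx y hy h
    simp only [Equiv.coe_toEmbedding, Function.comp_apply, Equiv.symm_apply_apply]
    refine ⟨fun h => this.1 (σ.injective h), ?_⟩
    rw [hσ.label_eq this.1, hσ.label_eq h, this.2]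

theorem conj_symm_conj (σ : X ≃ X) (hσ : Γ.IsAut σ) (hσ' : Γ.IsAut σ.symm) (θ : Γ.PartialIso) :
    conj σ.symm hσ' (conj σ hσ θ) = θ := by
  ext x
  · simp [conj]
  · simp [conj]

theorem conj_conj_symm (σ : X ≃ X) (hσ : Γ.IsAut σ) (hσ' : Γ.IsAut σ.symm) (θ : Γ.PartialIso) :
    conj σ hσ (conj σ.symm hσ' θ) = θ := by
  ext x
  · simp [conj]
  · simp [conj]

/-- The graph of a partial isomorphism or of its inverse. -/
def letterRel : Γ.PartialIso × Bool → X → X → Prop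
  | (θ, true), x, y => y ∈ θ.dom ∧ θ.toFun y = x
  | (θ, false), x, y => x ∈ θ.dom ∧ θ.toFun x = y

theorem letterRel_not (θ : Γ.PartialIso) (b : Bool) (x y : X) :
    letterRel (θ, !b) x y ↔ letterRel (θ, b) y x := by
  cases b <;> rfl

theorem letterRel_iso {s : Γ.PartialIso × Bool} {x y x' y' : X} (h : letterRel s x y)
    (h' : letterRel s x' y') : (x = x' ↔ y = y') ∧ (y ≠ y' → Γ.label x x' = Γ.label y y') := by
  obtain ⟨θ, b⟩ := s
  have key : ∀ x ∈ θ.dom, ∀ y ∈ θ.dom, (θ.toFun x = θ.toFun y ↔ x = y) := fun x hx y hy =>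
    ⟨fun h => by_contra fun hne => (θ.emb x hx y hy hne).1 h, fun h => h ▸ rfl⟩
  cases b
  · obtain ⟨h1, rfl⟩ := h
    obtain ⟨h2, rfl⟩ := h'
    refine ⟨(key _ h1 _ h2).symm, fun hne => (θ.emb _ h1 _ h2 fun h => hne (h ▸ rfl)).2.symm⟩
  · obtain ⟨h1, rfl⟩ := h
    obtain ⟨h2, rfl⟩ := h'
    exact ⟨key _ h1 _ h2, fun hne => (θ.emb _ h1 _ h2 hne).2⟩

theorem letterRel_conj (σ : X ≃ X) (hσ : Γ.IsAut σ) {s : Γ.PartialIso × Bool} {x y : X}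
    (h : letterRel s x y) : letterRel (conj σ hσ s.1, s.2) (σ x) (σ y) := by
  obtain ⟨θ, b⟩ := s
  cases b
  · obtain ⟨h1, rfl⟩ := h
    exact ⟨by simpa [conj] using h1, by simp [conj]⟩
  · obtain ⟨h1, rfl⟩ := h
    exact ⟨by simpa [conj] using h1, by simp [conj]⟩

/-! ### Partial action of the free group -/

/-- The composition of the partial isomorphisms in a word. -/
def wordRel : List (Γ.PartialIso × Bool) → X → X → Prop
  | [], x, y => x = y
  | s :: L, x, y => ∃ z, letterRel s x z ∧ wordRel L z y

theorem wordRel_append {L L' : List (Γ.PartialIso × Bool)} {x y : X} :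
    wordRel (L ++ L') x y ↔ ∃ z, wordRel L x z ∧ wordRel L' z y := by
  induction L generalizing x with
  | nil => simp [wordRel]
  | cons s L ih =>
    simp only [List.cons_append, wordRel, ih]
    tauto

theorem wordRel_invRev {L : List (Γ.PartialIso × Bool)} {x y : X} (h : wordRel L x y) :
    wordRel (FreeGroup.invRev L) y x := by
  induction L generalizing x with
  | nil => exact Eq.symm h
  | cons s L ih =>
    obtain ⟨z, h1, h2⟩ := h
    rw [FreeGroup.invRev_cons, wordRel_append]
    exact ⟨z, ih h2, x, (letterRel_not _ _ _ _).2 h1, rfl⟩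

/-- Cancelling a letter against its inverse can only enlarge the composite partial map, since
letters are injective. The reduced word therefore has the largest relation. -/
theorem wordRel_red {L L' : List (Γ.PartialIso × Bool)} (hL : FreeGroup.Red L L') {x y : X}
    (h : wordRel L x y) : wordRel L' x y := by
  induction hL with
  | refl => exact h
  | tail _ hs ih =>
    obtain @⟨L₁, L₂, θ, b⟩ := hs
    rw [wordRel_append] at ih ⊢
    obtain ⟨z, h1, z', h2, z'', h3, h4⟩ := ih
    rw [letterRel_not] at h3
    rw [(letterRel_iso h2 h3).1.2 rfl] at h1
    exact ⟨_, h1, h4⟩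

theorem wordRel_iso {L : List (Γ.PartialIso × Bool)} {x y x' y' : X} (h : wordRel L x y)
    (h' : wordRel L x' y') : (x = x' ↔ y = y') ∧ (y ≠ y' → Γ.label x x' = Γ.label y y') := by
  induction L generalizing x x' with
  | nil =>
    obtain rfl : x = y := h
    obtain rfl : x' = y' := h'
    exact ⟨Iff.rfl, fun _ => rfl⟩
  | cons s L ih =>
    obtain ⟨z, h1, h2⟩ := h
    obtain ⟨z', h1', h2'⟩ := h'
    have a := letterRel_iso h1 h1'
    have b := ih h2 h2'
    exact ⟨a.1.trans b.1, fun hne => (a.2 fun h => hne (b.1.1 h)).trans (b.2 hne)⟩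

/-- The partial action of the free group. -/
def Act (g : FreeGroup Γ.PartialIso) (x y : X) : Prop := ∃ L, FreeGroup.mk L = g ∧ wordRel L x y

/-- `Act` asks for some word, which makes products immediate. Since reduction enlarges the relation,
it can always be tested on the reduced word. -/
theorem Act.wordRel {g : FreeGroup Γ.PartialIso} {x y : X} (h : Act g x y)
    {L : List (Γ.PartialIso × Bool)} (hL : FreeGroup.IsReduced L) (hg : FreeGroup.mk L = g) :
    wordRel L x y := by
  obtain ⟨L', h1, h2⟩ := h
  exact wordRel_red (FreeGroup.red_of_mk_eq hL (h1.trans hg.symm)) h2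

theorem Act.iso {g : FreeGroup Γ.PartialIso} {x y x' y' : X} (h : Act g x y)
    (h' : Act g x' y') : (x = x' ↔ y = y') ∧ (y ≠ y' → Γ.label x x' = Γ.label y y') := by
  obtain ⟨L, h1, h2⟩ := FreeGroup.exists_isReduced g
  exact wordRel_iso (h.wordRel h1 h2) (h'.wordRel h1 h2)

theorem act_one {x y : X} : Act (1 : FreeGroup Γ.PartialIso) x y ↔ x = y :=
  ⟨fun h => h.wordRel (L := []) FreeGroup.IsReduced.nil rfl, fun h => ⟨[], rfl, h⟩⟩

theorem Act.mul {g h : FreeGroup Γ.PartialIso} {x y z : X} (h1 : Act g x y) (h2 : Act h y z) :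
    Act (g * h) x z := by
  obtain ⟨L, rfl, h1⟩ := h1
  obtain ⟨L', rfl, h2⟩ := h2
  exact ⟨L ++ L', rfl, wordRel_append.2 ⟨y, h1, h2⟩⟩

theorem Act.inv {g : FreeGroup Γ.PartialIso} {x y : X} (h : Act g x y) : Act g⁻¹ y x := by
  obtain ⟨L, rfl, h⟩ := h
  exact ⟨_, FreeGroup.inv_mk.symm, wordRel_invRev h⟩

theorem Act.map_conj (σ : X ≃ X) (hσ : Γ.IsAut σ) {g : FreeGroup Γ.PartialIso} {x y : X}
    (h : Act g x y) : Act (FreeGroup.map (conj σ hσ) g) (σ x) (σ y) := by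
  obtain ⟨L, rfl, h⟩ := h
  refine ⟨_, FreeGroup.map.mk.symm, ?_⟩
  induction L generalizing x with
  | nil => exact congrArg σ h
  | cons s L ih =>
    obtain ⟨z, h1, h2⟩ := h
    exact ⟨σ z, letterRel_conj σ hσ h1, ih h2⟩

end PartialIso

/-! ### Gluing copies along the Cayley tree -/

open PartialIso

/-- The globalization of the partial action of the free group on the partial isomorphisms. -/
def globalSetoid (Γ : LabelledGraph V n X) : Setoid (FreeGroup Γ.PartialIso × X) where
  r p q := Act (p.1⁻¹ * q.1) p.2 q.2
  iseqv :=
    { refl := fun p => by simp [act_one]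
      symm := fun {p q} h => by simpa using h.inv
      trans := fun {p q r} h h' => by simpa [mul_assoc] using h.mul h' }

/-- Copies of the graph, one for each element of the free group, glued along the partial
isomorphisms. -/
def Global (Γ : LabelledGraph V n X) : Type v := Quotient Γ.globalSetoid

/-- The point `x` of the copy of the graph with number `g`. -/
def pt (g : FreeGroup Γ.PartialIso) (x : X) : Γ.Global := Quotient.mk Γ.globalSetoid (g, x)

theorem exists_pt (p : Γ.Global) : ∃ g x, p = pt g x := by
  induction p using Quotient.inductionOn with
  | h p => exact ⟨p.1, p.2, rfl⟩

theorem pt_eq_pt {g h : FreeGroup Γ.PartialIso} {x y : X} :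
    pt g x = pt h y ↔ Act (g⁻¹ * h) x y := Quotient.eq (r := Γ.globalSetoid)

theorem pt_inj {g : FreeGroup Γ.PartialIso} {x y : X} : pt g x = pt g y ↔ x = y := by
  rw [pt_eq_pt, inv_mul_cancel, act_one]

/-- The copies that contain the point `p`. -/
def copies (p : Γ.Global) : Set (FreeGroup Γ.PartialIso) := {g | ∃ x, p = pt g x}

/-- A point shared by two copies is carried along the reduced word between them, and its position
after each initial segment is a representative in the intermediate copy. -/
theorem isConvex_copies (p : Γ.Global) : FreeGroup.IsConvex (copies p) := by
  rintro g L₁ L₂ hr ⟨x, hx⟩ ⟨y, hy⟩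
  have h1 : Act (FreeGroup.mk (L₁ ++ L₂)) x y := by
    have := pt_eq_pt.1 (hx.symm.trans hy)
    simpa [FreeGroup.mul_mk] using this
  obtain ⟨z, h2, -⟩ := wordRel_append.1 (h1.wordRel hr rfl)
  exact ⟨z, hx.trans (pt_eq_pt.2 (by simpa using ⟨L₁, rfl, h2⟩))⟩

/-- `p` and `q` belong to a common copy, in which their edge has the label `l`. -/
def CopyLabel (p q : Γ.Global) (l : EdgeLabel V n) : Prop :=
  ∃ g x y, p = pt g x ∧ q = pt g y ∧ Γ.label x y = l

theorem CopyLabel.symm {p q : Γ.Global} {l : EdgeLabel V n} (h : CopyLabel p q l) :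
    CopyLabel q p l := by
  obtain ⟨g, x, y, hx, hy, h⟩ := h
  exact ⟨g, y, x, hy, hx, by rw [Γ.symm, h]⟩

/-- Composites of partial isomorphisms preserve labels, so two copies that contain both points agree
on the edge. -/
theorem CopyLabel.unique {p q : Γ.Global} {l l' : EdgeLabel V n} (hpq : p ≠ q)
    (h : CopyLabel p q l) (h' : CopyLabel p q l') : l = l' := by
  obtain ⟨g, x, y, hx, hy, rfl⟩ := h
  obtain ⟨g', x', y', hx', hy', rfl⟩ := h'
  have h1 := pt_eq_pt.1 (hx.symm.trans hx')
  have h2 := pt_eq_pt.1 (hy.symm.trans hy')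
  exact (h1.iso h2).2 fun h => hpq (by rw [hx', hy', h])

theorem exists_copyLabel_iff {p q : Γ.Global} :
    (∃ l, CopyLabel p q l) ↔ (copies p ∩ copies q).Nonempty :=
  ⟨fun ⟨_, g, x, y, hx, hy, _⟩ => ⟨g, ⟨x, hx⟩, ⟨y, hy⟩⟩,
    fun ⟨g, ⟨x, hx⟩, ⟨y, hy⟩⟩ => ⟨_, g, x, y, hx, hy, rfl⟩⟩

/-- The colours which occur on both legs of some triangle with the base `p`, `q`. -/
def badColours (p q : Γ.Global) : Set (Fin n) :=
  {c | ∃ r, p ≠ r ∧ q ≠ r ∧ (∃ l, CopyLabel p r l ∧ l.2 = c) ∧ ∃ l, CopyLabel q r l ∧ l.2 = c}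

theorem badColours_comm (p q : Γ.Global) : badColours p q = badColours q p := by
  ext c
  exact exists_congr fun r => by tauto

theorem copies_nonempty (p : Γ.Global) : (copies p).Nonempty := by
  obtain ⟨g, x, h⟩ := exists_pt p
  exact ⟨g, x, h⟩

/-- The subtrees of `p` and `q` are disjoint, and any `r` sharing copies with both lies in the two
copies at the ends of the bridge. It is thus in the overlap given by one partial isomorphism, which
has fewer than `n` points. If all `n` colours were bad, their witnesses would be `n` such points. -/
theorem exists_notMem_badColours {p q : Γ.Global} (h : ¬ ∃ l, CopyLabel p q l) :
    ∃ c, c ∉ badColours p q := by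
  by_contra! hall
  rw [exists_copyLabel_iff, Set.not_nonempty_iff_eq_empty, ← Set.disjoint_iff_inter_eq_empty] at h
  obtain ⟨g, -, ⟨θ, b⟩, -, hC⟩ := (isConvex_copies p).exists_bridge (isConvex_copies q)
    (copies_nonempty p) (copies_nonempty q) h
  choose r hrp hrq h1 h2 using hall
  have h3 : ∀ c, ∃ x, r c = pt g x ∧ ∃ y, r c = pt (g * FreeGroup.mk [(θ, b)]) y := fun c => by
    have := hC (copies (r c)) (isConvex_copies _)
      (by
        obtain ⟨l, hl, -⟩ := h1 c
        exact exists_copyLabel_iff.1 ⟨l, hl.symm⟩)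
      (by
        obtain ⟨l, hl, -⟩ := h2 c
        exact exists_copyLabel_iff.1 ⟨l, hl.symm⟩)
    exact ⟨_, this.1.choose_spec, this.2⟩
  choose x hx y hy using h3
  -- The colour is read off from the edge between `p` and `r c`, which has only one label.
  have hinj : Function.Injective r := fun c c' hcc => by
    obtain ⟨l, hl, rfl⟩ := h1 c
    obtain ⟨l', hl', rfl⟩ := h1 c'
    rw [← hcc] at hl'
    rw [hl.unique (hrp _) hl']
  have hact : ∀ c, letterRel (θ, b) (x c) (y c) := fun c => by
    have h4 := pt_eq_pt.1 ((hx c).symm.trans (hy c))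
    rw [inv_mul_cancel_left] at h4
    obtain ⟨z, h5, rfl⟩ := h4.wordRel FreeGroup.IsReduced.singleton rfl
    exact h5
  have hcard : ∀ f : Fin n → X, Function.Injective f → (∀ c, f c ∈ θ.dom) → False :=
      fun f hf hm => by
    have := Finset.card_le_card_of_injOn f (s := Finset.univ) (fun c _ => hm c) hf.injOn
    have := θ.card_lt
    simp at *
    omega
  cases b
  · exact hcard x (fun c c' h => hinj (by rw [hx c, hx c', h])) fun c => (hact c).1
  · exact hcard y (fun c c' h => hinj (by rw [hy c, hy c', h])) fun c => (hact c).1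

open Classical in
/-- A label with the property `P`, or else a label `(ρ, c)` with `c ∉ B`. -/
noncomputable def labelOf [NeZero n] (P : EdgeLabel V n → Prop) (B : Set (Fin n)) :
    EdgeLabel V n :=
  if h : ∃ l, P l then h.choose else (none, Classical.epsilon fun c => c ∉ B)

/-- Edges inside a copy keep their labels, the other ones are labelled by `ρ` with a good
colour. -/
noncomputable def global (Γ : LabelledGraph V n X) [NeZero n] : LabelledGraph V n Γ.Global where
  label p q := labelOf (CopyLabel p q) (badColours p q)
  symm p q := by
    have h1 : CopyLabel p q = CopyLabel q p := funext fun l => propext ⟨.symm, .symm⟩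
    rw [h1, badColours_comm p q]

theorem global_label_of_copyLabel [NeZero n] {p q : Γ.Global} (hpq : p ≠ q) {l : EdgeLabel V n}
    (h : CopyLabel p q l) : Γ.global.label p q = l := by
  have h' : ∃ l, CopyLabel p q l := ⟨l, h⟩
  simp only [global, labelOf, dif_pos h']
  exact h'.choose_spec.unique hpq h

theorem global_label_of_not [NeZero n] {p q : Γ.Global} (h : ¬ ∃ l, CopyLabel p q l) :
    (Γ.global.label p q).1 = none ∧ (Γ.global.label p q).2 ∉ badColours p q := by
  simp only [global, labelOf, dif_neg h, true_and]
  exact Classical.epsilon_spec (exists_notMem_badColours h)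

/-- Helly property of subtrees: if `copies p ∩ copies q` missed `copies r`, the bridge leaving it
would belong to `copies p` and to `copies q`, hence would not leave it. -/
theorem exists_common_copy {p q r : Γ.Global} (hpq : (copies p ∩ copies q).Nonempty)
    (hpr : (copies p ∩ copies r).Nonempty) (hqr : (copies q ∩ copies r).Nonempty) :
    (copies p ∩ copies q ∩ copies r).Nonempty := by
  by_contra h
  rw [Set.not_nonempty_iff_eq_empty, ← Set.disjoint_iff_inter_eq_empty] at h
  obtain ⟨g, -, s, hs, hC⟩ := ((isConvex_copies p).inter (isConvex_copies q)).exists_bridge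
    (isConvex_copies r) hpq (copies_nonempty r) h
  refine hs ⟨(hC _ (isConvex_copies p) ?_ hpr).2, (hC _ (isConvex_copies q) ?_ hqr).2⟩
  · rwa [← Set.inter_assoc, Set.inter_self]
  · rwa [Set.inter_left_comm, Set.inter_self]

/-- By the Helly property a triangle with all edges inside copies lies in one copy. If an edge is
new, either a second edge is new and the two `ρ`'s are adjacent, or the colour of the new edge was
chosen to avoid a common colour of the other two. -/
theorem Admissible.global [NeZero n] {G : SimpleGraph V} (hΓ : Γ.Admissible G) :
    Γ.global.Admissible G := by
  have key : ∀ p q r : Γ.Global, p ≠ r → q ≠ r → (¬ ∃ l, CopyLabel p q l) →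
      TriangleOK G (Γ.global.label p q) (Γ.global.label p r) (Γ.global.label q r) := by
    intro p q r hpr hqr h
    obtain ⟨h1, h2⟩ := global_label_of_not h
    rw [triangleOK_iff]
    intro h3 h4
    by_cases hp : ∃ l, CopyLabel p r l
    · by_cases hq : ∃ l, CopyLabel q r l
      · refine (h2 ⟨r, hpr, hqr, ?_, ?_⟩).elim
        · obtain ⟨l, hl⟩ := hp
          rw [global_label_of_copyLabel hpr hl] at h3
          exact ⟨l, hl, h3.symm⟩
        · obtain ⟨l, hl⟩ := hq
          rw [global_label_of_copyLabel hqr hl] at h4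
          exact ⟨l, hl, (h3.trans h4).symm⟩
      · rw [h1, (global_label_of_not hq).1]
        exact .inr (.inl trivial)
    · rw [h1, (global_label_of_not hp).1]
      exact .inl trivial
  intro x y z hxy hxz hyz
  by_cases h1 : ∃ l, CopyLabel y x l
  · by_cases h2 : ∃ l, CopyLabel y z l
    · by_cases h3 : ∃ l, CopyLabel x z l
      · obtain ⟨g, ⟨⟨y', hy⟩, ⟨x', hx⟩⟩, ⟨z', hz⟩⟩ := exists_common_copy
          (exists_copyLabel_iff.1 h1) (exists_copyLabel_iff.1 h2) (exists_copyLabel_iff.1 h3)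
        rw [global_label_of_copyLabel hxy.symm ⟨g, y', x', hy, hx, rfl⟩,
          global_label_of_copyLabel hyz ⟨g, y', z', hy, hz, rfl⟩,
          global_label_of_copyLabel hxz ⟨g, x', z', hx, hz, rfl⟩]
        subst hx hy hz
        rw [Ne, pt_inj] at hxy hxz hyz
        exact hΓ x' y' z' hxy hxz hyz
      · have := key x z y hxy hyz.symm h3
        rw [Γ.global.symm x y, Γ.global.symm z y] at this
        exact this.rotate
    · have := key y z x hxy.symm hxz.symm h2
      rw [Γ.global.symm z x] at this
      exact this.swap
  · exact key y x z hyz hxz h1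

/-- The colour picked for a new edge depends only on the set `badColours`, hence only on
`CopyLabel`. The choice is canonical and respects every symmetry of the gluing. -/
theorem isAut_global [NeZero n] (F : Γ.Global ≃ Γ.Global)
    (hF : ∀ p q l, p ≠ q → CopyLabel p q l → CopyLabel (F p) (F q) l)
    (hF' : ∀ p q l, p ≠ q → CopyLabel p q l → CopyLabel (F.symm p) (F.symm q) l) :
    Γ.global.IsAut F := by
  have h1 : ∀ p q, p ≠ q → CopyLabel (F p) (F q) = CopyLabel p q := fun p q hpq => by
    ext l
    exact ⟨fun h => by simpa using hF' _ _ _ (fun h => hpq (F.injective h)) h, hF p q l hpq⟩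
  have h2 : ∀ p q, badColours (F p) (F q) = badColours p q := fun p q => by
    ext c
    constructor
    · rintro ⟨r, h3, h4, h5⟩
      obtain ⟨r, rfl⟩ := F.surjective r
      have h3' : p ≠ r := fun h => h3 (h ▸ rfl)
      have h4' : q ≠ r := fun h => h4 (h ▸ rfl)
      rw [h1 _ _ h3', h1 _ _ h4'] at h5
      exact ⟨r, h3', h4', h5⟩
    · rintro ⟨r, h3, h4, h5⟩
      rw [← h1 _ _ h3, ← h1 _ _ h4] at h5
      exact ⟨F r, fun h => h3 (F.injective h), fun h => h4 (F.injective h), h5⟩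
  intro p _ q _ hpq
  refine ⟨fun h => hpq (F.injective h), ?_⟩
  simp only [global]
  rw [h1 p q hpq, h2]

/-! ### Automorphisms of the globalization -/

/-- Left multiplication by an element of the free group. -/
def translate (Γ : LabelledGraph V n X) (t : FreeGroup Γ.PartialIso) : Γ.Global ≃ Γ.Global where
  toFun := Quotient.map (fun p => (t * p.1, p.2)) fun p q (h : Act _ _ _) => by
    show Act _ _ _
    simpa [mul_assoc] using h
  invFun := Quotient.map (fun p => (t⁻¹ * p.1, p.2)) fun p q (h : Act _ _ _) => by
    show Act _ _ _
    simpa [mul_assoc] using h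
  left_inv p := by
    obtain ⟨g, x, rfl⟩ := exists_pt p
    exact congrArg (fun h => pt h x) (inv_mul_cancel_left t g)
  right_inv p := by
    obtain ⟨g, x, rfl⟩ := exists_pt p
    exact congrArg (fun h => pt h x) (mul_inv_cancel_left t g)

theorem translate_pt (t g : FreeGroup Γ.PartialIso) (x : X) :
    Γ.translate t (pt g x) = pt (t * g) x := rfl

theorem translate_symm_pt (t g : FreeGroup Γ.PartialIso) (x : X) :
    (Γ.translate t).symm (pt g x) = pt (t⁻¹ * g) x := rfl

theorem isAut_translate [NeZero n] (t : FreeGroup Γ.PartialIso) :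
    Γ.global.IsAut (Γ.translate t) := by
  refine isAut_global _ ?_ ?_
  · rintro p q l - ⟨g, x, y, rfl, rfl, h⟩
    exact ⟨t * g, x, y, translate_pt _ _ _, translate_pt _ _ _, h⟩
  · rintro p q l - ⟨g, x, y, rfl, rfl, h⟩
    exact ⟨t⁻¹ * g, x, y, translate_symm_pt _ _ _, translate_symm_pt _ _ _, h⟩

/-- The action of an automorphism on the glued copies. -/
def extendAut (σ : X ≃ X) (hσ : Γ.IsAut σ) : Γ.Global ≃ Γ.Global where
  toFun := Quotient.map (fun p => (FreeGroup.map (conj σ hσ) p.1, σ p.2))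
    fun p q (h : Act _ _ _) => by
      show Act _ _ _
      simpa using h.map_conj σ hσ
  invFun := Quotient.map (fun p => (FreeGroup.map (conj σ.symm hσ.symm') p.1, σ.symm p.2))
    fun p q (h : Act _ _ _) => by
      show Act _ _ _
      simpa using h.map_conj σ.symm hσ.symm'
  left_inv p := by
    obtain ⟨g, x, rfl⟩ := exists_pt p
    have : conj σ.symm hσ.symm' ∘ conj σ hσ = id := funext fun θ => conj_symm_conj _ _ _ _
    have h : FreeGroup.map (conj σ.symm hσ.symm') (FreeGroup.map (conj σ hσ) g) = g := by
      rw [FreeGroup.map.comp, this, FreeGroup.map.id]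
    exact (congrArg₂ pt h (σ.symm_apply_apply x) :)
  right_inv p := by
    obtain ⟨g, x, rfl⟩ := exists_pt p
    have : conj σ hσ ∘ conj σ.symm hσ.symm' = id := funext fun θ => conj_conj_symm _ _ _ _
    have h : FreeGroup.map (conj σ hσ) (FreeGroup.map (conj σ.symm hσ.symm') g) = g := by
      rw [FreeGroup.map.comp, this, FreeGroup.map.id]
    exact (congrArg₂ pt h (σ.apply_symm_apply x) :)

theorem extendAut_pt (σ : X ≃ X) (hσ : Γ.IsAut σ) (g : FreeGroup Γ.PartialIso) (x : X) :
    extendAut σ hσ (pt g x) = pt (FreeGroup.map (conj σ hσ) g) (σ x) := rfl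

theorem extendAut_symm_pt (σ : X ≃ X) (hσ : Γ.IsAut σ) (g : FreeGroup Γ.PartialIso) (x : X) :
    (extendAut σ hσ).symm (pt g x) =
      pt (FreeGroup.map (conj σ.symm hσ.symm') g) (σ.symm x) := rfl

theorem isAut_extendAut [NeZero n] (σ : X ≃ X) (hσ : Γ.IsAut σ) :
    Γ.global.IsAut (extendAut σ hσ) := by
  refine isAut_global _ ?_ ?_
  · rintro p q l hpq ⟨g, x, y, rfl, rfl, h⟩
    refine ⟨_, _, _, extendAut_pt _ _ _ _, extendAut_pt _ _ _ _, ?_⟩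
    rw [hσ.label_eq fun h => hpq (congrArg (pt g) h), h]
  · rintro p q l hpq ⟨g, x, y, rfl, rfl, h⟩
    refine ⟨_, _, _, extendAut_symm_pt _ _ _ _, extendAut_symm_pt _ _ _ _, ?_⟩
    rw [hσ.symm'.label_eq fun h => hpq (congrArg (pt g) h), h]

theorem embeddingOn_pt_one [NeZero n] : EmbeddingOn Γ Γ.global Set.univ (pt (Γ := Γ) 1) := by
  intro x _ y _ hxy
  have h : (pt 1 x : Γ.Global) ≠ pt 1 y := fun h => hxy (pt_inj.1 h)
  exact ⟨h, global_label_of_copyLabel h ⟨1, x, y, rfl, rfl, rfl⟩⟩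

/-- The copy with number `θ` is glued to the copy `1` so that its point `x` is the point `θ x` of
the latter. Translation by the generator thus extends `θ`. -/
theorem translate_of_pt_one (θ : Γ.PartialIso) {x : X} (hx : x ∈ θ.dom) :
    Γ.translate (FreeGroup.of θ) (pt 1 x) = pt 1 (θ.toFun x) := by
  rw [translate_pt, eq_comm, pt_eq_pt]
  exact ⟨[(θ, true)], by simp [FreeGroup.of], x, ⟨hx, rfl⟩, rfl⟩

theorem extendAut_pt_one (σ : X ≃ X) (hσ : Γ.IsAut σ) (x : X) :
    extendAut σ hσ (pt 1 x) = pt 1 (σ x) := by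
  rw [extendAut_pt, map_one]

end LabelledGraph

/-! ## The homogeneous graph -/

theorem exists_nat_limit (E : ℕ → Type u) (f : ∀ k, E k → E (k + 1))
    (hf : ∀ k, Function.Injective (f k)) :
    ∃ (M : Type u) (j : ∀ k, E k → M), (∀ k, Function.Injective (j k)) ∧
      (∀ k x, j (k + 1) (f k x) = j k x) ∧ ∀ p, ∃ k x, j k x = p := by
  let g : ∀ k l : ℕ, k ≤ l → E k ↪ E l := fun k l h =>
    ⟨Nat.leRecOn h fun {k} => f k, Nat.leRecOn_injective h _ hf⟩
  have : DirectedSystem E fun k l h => g k l h :=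
    { map_self := fun k x => Nat.leRecOn_self x
      map_map := fun k l m h h' x => (Nat.leRecOn_trans h h' x).symm }
  refine ⟨DirectLimit E g, fun k x => ⟦⟨k, x⟩⟧,
    DirectLimit.mk_injective g fun k l h => (g k l h).injective, fun k x => ?_, fun p => ?_⟩
  · have h1 : f k x = g k (k + 1) (Nat.le_succ k) x :=
      (Nat.leRecOn_succ' (next := fun {k} => f k) x).symm
    show (⟦⟨k + 1, f k x⟩⟧ : DirectLimit E g) = ⟦⟨k, x⟩⟧
    rw [h1]
    exact DirectLimit.mk_apply _ _ _ _
  · obtain ⟨k, x, h⟩ := DirectLimit.exists_eq_mk g p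
    exact ⟨k, x, h.symm⟩

namespace LabelledGraph

variable {V : Type u} {n : ℕ}

/-- A small partial isomorphism of the limit lives at a finite stage. `hlift` turns it into an
automorphism of the next stage, and `hext` prolongs that through all later stages. -/
theorem exists_limit [NeZero n] {G : SimpleGraph V} (E : ℕ → Type u)
    (Γ : ∀ k, LabelledGraph V n (E k)) (f : ∀ k, E k → E (k + 1))
    (hadm : ∀ k, (Γ k).Admissible G)
    (hf : ∀ k, EmbeddingOn (Γ k) (Γ (k + 1)) Set.univ (f k))
    (hext : ∀ k (σ : E k ≃ E k), (Γ k).IsAut σ →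
      ∃ σ' : E (k + 1) ≃ E (k + 1), (Γ (k + 1)).IsAut σ' ∧ ∀ x, σ' (f k x) = f k (σ x))
    (hlift : ∀ k (θ : (Γ k).PartialIso),
      ∃ σ : E (k + 1) ≃ E (k + 1), (Γ (k + 1)).IsAut σ ∧
        ∀ x ∈ θ.dom, σ (f k x) = f k (θ.toFun x)) :
    ∃ (M : Type u) (Δ : LabelledGraph V n M), Δ.Admissible G ∧ Δ.StronglyHomogeneous ∧
      ∃ e : E 0 → M, EmbeddingOn (Γ 0) Δ Set.univ e := by
  have hinj : ∀ k, Function.Injective (f k) := fun k x y h =>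
    by_contra fun hne => (hf k x trivial y trivial hne).1 h
  obtain ⟨M, j, hj, hjf, hsurj⟩ := exists_nat_limit E f hinj
  have hmono : ∀ k d, Set.range (j k) ⊆ Set.range (j (k + d)) := by
    intro k d
    induction d with
    | zero => exact subset_rfl
    | succ d ih =>
      rintro p hp
      obtain ⟨x, rfl⟩ := ih hp
      exact ⟨f _ x, hjf _ x⟩
  have hmono' : ∀ {k l}, k ≤ l → Set.range (j k) ⊆ Set.range (j l) := fun {k l} h => by
    obtain ⟨d, rfl⟩ := Nat.exists_eq_add_of_le h
    exact hmono k d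
  have hfin : ∀ T : Finset M, ∃ k, (T : Set M) ⊆ Set.range (j k) := by
    classical
    intro T
    induction T using Finset.induction_on with
    | empty => exact ⟨0, by simp⟩
    | insert p T _ ih =>
      obtain ⟨k, hk⟩ := ih
      obtain ⟨l, x, rfl⟩ := hsurj p
      refine ⟨max k l, ?_⟩
      rw [Finset.coe_insert, Set.insert_subset_iff]
      exact ⟨hmono' (le_max_right k l) ⟨x, rfl⟩, hk.trans (hmono' (le_max_left k l))⟩
  have hlabel : ∀ k d (x y : E k) (x' y' : E (k + d)), x ≠ y → j (k + d) x' = j k x →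
      j (k + d) y' = j k y → (Γ (k + d)).label x' y' = (Γ k).label x y := by
    intro k d x y
    induction d with
    | zero =>
      intro x' y' _ hx hy
      rw [hj k hx, hj k hy]
      rfl
    | succ d ih =>
      intro x' y' hxy hx hy
      obtain ⟨x'', hx''⟩ := hmono k d ⟨x, rfl⟩
      obtain ⟨y'', hy''⟩ := hmono k d ⟨y, rfl⟩
      rw [← ih x'' y'' hxy hx'' hy'']
      have h1 : x' = f _ x'' := hj _ (hx.trans (hx''.symm.trans (hjf _ _).symm))
      have h2 : y' = f _ y'' := hj _ (hy.trans (hy''.symm.trans (hjf _ _).symm))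
      rw [h1, h2]
      refine (hf _ _ trivial _ trivial fun h => hxy (hj k ?_)).2
      rw [← hx'', ← hy'', h]
  -- Labels in the limit are read off at any stage containing both points; `hlabel` makes the stages
  -- agree.
  let P : M → M → EdgeLabel V n → Prop := fun p q l =>
    ∃ k x y, j k x = p ∧ j k y = q ∧ (Γ k).label x y = l
  let Δ : LabelledGraph V n M :=
    { label := fun p q => Classical.epsilon (P p q)
      symm := fun p q => by
        congr 1
        funext l
        refine propext ⟨?_, ?_⟩
        · rintro ⟨k, x, y, h1, h2, h3⟩
          exact ⟨k, y, x, h2, h1, (Γ k).symm x y ▸ h3⟩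
        · rintro ⟨k, x, y, h1, h2, h3⟩
          exact ⟨k, y, x, h2, h1, (Γ k).symm x y ▸ h3⟩ }
  have hΔ : ∀ k (x y : E k), x ≠ y → Δ.label (j k x) (j k y) = (Γ k).label x y := by
    intro k x y hxy
    obtain ⟨l, x', y', h1, h2, h3⟩ : P (j k x) (j k y) (Δ.label (j k x) (j k y)) :=
      Classical.epsilon_spec (p := P (j k x) (j k y)) ⟨_, k, x, y, rfl, rfl, rfl⟩
    rw [← h3]
    rcases le_total k l with h | h
    · obtain ⟨d, rfl⟩ := Nat.exists_eq_add_of_le h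
      exact hlabel k d x y x' y' hxy h1 h2
    · obtain ⟨d, rfl⟩ := Nat.exists_eq_add_of_le h
      refine (hlabel l d x' y' x y (fun h => hxy (hj _ ?_)) h1.symm h2.symm).symm
      rw [← h1, ← h2, h]
  have haut : ∀ k (σ : E k ≃ E k), (Γ k).IsAut σ →
      ∃ F : M ≃ M, Δ.IsAut F ∧ ∀ x, F (j k x) = j k (σ x) := by
    intro k σ hσ
    -- Successive prolongations of `σ`. The automorphism of the limit is their union, whose graph is
    -- `Q` below.
    let τ : ∀ d, {σ : E (k + d) ≃ E (k + d) // (Γ (k + d)).IsAut σ} := fun d =>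
      Nat.rec ⟨σ, hσ⟩ (fun d s => ⟨(hext _ s.1 s.2).choose, (hext _ s.1 s.2).choose_spec.1⟩) d
    have hτ : ∀ d x, (τ (d + 1)).1 (f _ x) = f _ ((τ d).1 x) := fun d x =>
      (hext _ (τ d).1 (τ d).2).choose_spec.2 x
    have hτ' : ∀ d e x, ∃ x', j (k + (d + e)) x' = j (k + d) x ∧
        j (k + (d + e)) ((τ (d + e)).1 x') = j (k + d) ((τ d).1 x) := by
      intro d e x
      induction e with
      | zero => exact ⟨x, rfl, rfl⟩
      | succ e ih =>
        obtain ⟨x', h1, h2⟩ := ih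
        refine ⟨f _ x', (hjf _ _).trans h1, ?_⟩
        exact (congrArg _ (hτ (d + e) x')).trans ((hjf _ _).trans h2)
    let Q : M → M → Prop := fun p q => ∃ d x, j (k + d) x = p ∧ j (k + d) ((τ d).1 x) = q
    have hQ : ∀ p q p' q', Q p q → Q p' q' → ∃ d x x', j (k + d) x = p ∧
        j (k + d) ((τ d).1 x) = q ∧ j (k + d) x' = p' ∧ j (k + d) ((τ d).1 x') = q' := by
      rintro _ _ _ _ ⟨d, x, rfl, rfl⟩ ⟨d', x', rfl, rfl⟩
      rcases le_total d d' with h | h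
      · obtain ⟨e, rfl⟩ := Nat.exists_eq_add_of_le h
        obtain ⟨y, h1, h2⟩ := hτ' d e x
        exact ⟨_, y, x', h1, h2, rfl, rfl⟩
      · obtain ⟨e, rfl⟩ := Nat.exists_eq_add_of_le h
        obtain ⟨y, h1, h2⟩ := hτ' d' e x'
        exact ⟨_, x, y, rfl, rfl, h1, h2⟩
    have hlev : ∀ p, ∃ d x, j (k + d) x = p := fun p => by
      obtain ⟨l, x, rfl⟩ := hsurj p
      obtain ⟨y, hy⟩ := hmono' (Nat.le_add_left l k) ⟨x, rfl⟩
      exact ⟨l, y, hy⟩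
    have htot : ∀ p, ∃ q, Q p q := fun p => by
      obtain ⟨d, x, rfl⟩ := hlev p
      exact ⟨_, d, x, rfl, rfl⟩
    choose F hF using htot
    have hfun : ∀ p q q', Q p q → Q p q' → q = q' := fun p q q' h h' => by
      obtain ⟨d, x, x', h1, rfl, h3, rfl⟩ := hQ _ _ _ _ h h'
      rw [hj _ (h1.trans h3.symm)]
    have hbij : Function.Bijective F := by
      constructor
      · intro p p' h
        obtain ⟨d, x, x', rfl, h2, rfl, h4⟩ := hQ _ _ _ _ (hF p) (hF p')
        rw [(τ d).1.injective (hj _ (h2.trans (h.trans h4.symm)))]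
      · intro q
        obtain ⟨d, x, rfl⟩ := hlev q
        exact ⟨j (k + d) ((τ d).1.symm x), hfun _ _ _ (hF _) ⟨d, _, rfl, by simp⟩⟩
    refine ⟨Equiv.ofBijective F hbij, ?_, fun x => hfun _ _ _ (hF _) ⟨0, x, rfl, rfl⟩⟩
    intro p _ q _ hpq
    refine ⟨fun h => hpq (hbij.1 h), ?_⟩
    show Δ.label (F p) (F q) = _
    obtain ⟨d, x, x', h1, h2, h3, h4⟩ := hQ _ _ _ _ (hF p) (hF q)
    have hne : x ≠ x' := fun h => hpq (by rw [← h1, ← h3, h])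
    rw [← h2, ← h4, hΔ _ _ _ fun h => hne ((τ d).1.injective h), (τ d).2.label_eq hne, ← h1, ← h3,
      hΔ _ _ _ hne]
  refine ⟨M, Δ, ?_, ?_, j 0, ?_⟩
  · classical
    intro p q r hpq hpr hqr
    obtain ⟨k, hk⟩ := hfin {p, q, r}
    obtain ⟨x, rfl⟩ := hk (show p ∈ _ by simp)
    obtain ⟨y, rfl⟩ := hk (show q ∈ _ by simp)
    obtain ⟨z, rfl⟩ := hk (show r ∈ _ by simp)
    have h1 : x ≠ y := fun h => hpq (h ▸ rfl)
    have h2 : x ≠ z := fun h => hpr (h ▸ rfl)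
    have h3 : y ≠ z := fun h => hqr (h ▸ rfl)
    rw [hΔ _ _ _ h1.symm, hΔ _ _ _ h2, hΔ _ _ _ h3]
    exact hadm k x y z h1 h2 h3
  · classical
    intro S hS θ hθ
    -- The stage must contain the range as well as the domain.
    obtain ⟨k, hk⟩ := hfin (S ∪ S.image θ)
    have hk1 : ∀ p ∈ S, ∃ x, j k x = p := fun p hp => hk (by simp [hp])
    have hk2 : ∀ p ∈ S, ∃ x, j k x = θ p := fun p hp =>
      hk (by simpa using Or.inr ⟨p, hp, rfl⟩)
    have : ∃ θ' : E k → E k, ∀ x, j k x ∈ S → j k (θ' x) = θ (j k x) :=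
      ⟨fun x => if h : j k x ∈ S then (hk2 _ h).choose else x, fun x h => by
        beta_reduce
        rw [dif_pos h]
        exact (hk2 _ h).choose_spec⟩
    obtain ⟨θ', hθ'⟩ := this
    have hmem : ∀ x, x ∈ S.preimage (j k) (hj k).injOn ↔ j k x ∈ S := fun x => Finset.mem_preimage
    let ψ : (Γ k).PartialIso :=
      { dom := S.preimage (j k) (hj k).injOn
        card_lt := (Finset.card_le_card_of_injOn (j k) (fun x hx => (hmem x).1 hx)
          (hj k).injOn).trans_lt hS
        toFun := θ'
        emb := fun x hx y hy hxy => by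
          have hx := (hmem x).1 hx
          have hy := (hmem y).1 hy
          have h1 := hθ _ hx _ hy fun h => hxy (hj k h)
          rw [← hθ' x hx, ← hθ' y hy, hΔ _ _ _ hxy] at h1
          have h2 : θ' x ≠ θ' y := fun h => h1.1 (h ▸ rfl)
          rw [hΔ _ _ _ h2] at h1
          exact ⟨h2, h1.2⟩ }
    obtain ⟨σ, hσ, hσ'⟩ := hlift k ψ
    obtain ⟨F, hF, hF'⟩ := haut _ σ hσ
    refine ⟨F, hF, fun p hp => ?_⟩
    obtain ⟨x, rfl⟩ := hk1 p hp
    rw [← hjf, hF', hσ' x ((hmem x).2 hp), hjf, hjf]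
    exact hθ' x hp
  · intro x _ y _ hxy
    exact ⟨fun h => hxy (hj 0 h), hΔ 0 x y hxy⟩

/-- The iteration of the globalization. -/
noncomputable def tower [NeZero n] {X : Type u} (Γ : LabelledGraph V n X) :
    ℕ → Σ Y : Type u, LabelledGraph V n Y
  | 0 => ⟨X, Γ⟩
  | k + 1 => ⟨(tower Γ k).2.Global, (tower Γ k).2.global⟩

theorem exists_stronglyHomogeneous [NeZero n] {G : SimpleGraph V} {X : Type u}
    (Γ : LabelledGraph V n X) (hΓ : Γ.Admissible G) :
    ∃ (M : Type u) (Δ : LabelledGraph V n M), Δ.Admissible G ∧ Δ.StronglyHomogeneous ∧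
      ∃ e : X → M, EmbeddingOn Γ Δ Set.univ e := by
  refine exists_limit (fun k => (tower Γ k).1) (fun k => (tower Γ k).2)
    (fun k => pt (Γ := (tower Γ k).2) 1) ?_ (fun k => embeddingOn_pt_one) ?_ ?_
  · intro k
    induction k with
    | zero => exact hΓ
    | succ k ih => exact ih.global
  · intro k σ hσ
    exact ⟨extendAut σ hσ, isAut_extendAut σ hσ, extendAut_pt_one σ hσ⟩
  · intro k θ
    exact ⟨_, isAut_translate (FreeGroup.of θ), fun x hx => translate_of_pt_one θ hx⟩

/-! ### Disjoint unions and the universal homogeneous graph -/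

open Classical in
/-- The disjoint union of labelled graphs, with the label `(ρ, 0)` between different summands. -/
noncomputable def sigma [NeZero n] {I : Type u} {Y : I → Type v}
    (Γ : ∀ i, LabelledGraph V n (Y i)) : LabelledGraph V n (Σ i, Y i) where
  label p q := if h : p.1 = q.1 then (Γ q.1).label (h ▸ p.2) q.2 else (none, 0)
  symm p q := by
    obtain ⟨i, x⟩ := p
    obtain ⟨k, y⟩ := q
    by_cases h : i = k
    · subst h
      simpa using (Γ i).symm x y
    · simp [h, Ne.symm h]

theorem sigma_label_mk [NeZero n] {I : Type u} {Y : I → Type v}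
    (Γ : ∀ i, LabelledGraph V n (Y i)) (i : I) (x y : Y i) :
    (sigma Γ).label ⟨i, x⟩ ⟨i, y⟩ = (Γ i).label x y := by
  simp [sigma]

theorem sigma_label_of_ne [NeZero n] {I : Type u} {Y : I → Type v}
    (Γ : ∀ i, LabelledGraph V n (Y i)) {i k : I} (h : i ≠ k) (x : Y i) (y : Y k) :
    (sigma Γ).label ⟨i, x⟩ ⟨k, y⟩ = (none, 0) := by
  simp [sigma, h]

/-- A triangle that meets at least two summands has at least two edges labelled by `ρ`. -/
theorem Admissible.sigma [NeZero n] {G : SimpleGraph V} {I : Type u} {Y : I → Type v}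
    {Γ : ∀ i, LabelledGraph V n (Y i)} (h : ∀ i, (Γ i).Admissible G) :
    (sigma Γ).Admissible G := by
  rintro ⟨i, x⟩ ⟨k, y⟩ ⟨l, z⟩ hxy hxz hyz
  rw [triangleOK_iff]
  by_cases h1 : i = k
  · subst h1
    by_cases h2 : i = l
    · subst h2
      rw [sigma_label_mk, sigma_label_mk, sigma_label_mk, ← triangleOK_iff]
      exact h i x y z (fun h => hxy (h ▸ rfl)) (fun h => hxz (h ▸ rfl)) fun h => hyz (h ▸ rfl)
    · rw [sigma_label_of_ne _ h2, sigma_label_of_ne _ h2]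
      exact fun _ _ => .inr (.inr trivial)
  · by_cases h2 : k = l
    · subst h2
      rw [sigma_label_of_ne _ h1, sigma_label_of_ne _ (Ne.symm h1)]
      exact fun _ _ => .inr (.inl trivial)
    · rw [sigma_label_of_ne _ h2, sigma_label_of_ne _ (Ne.symm h1)]
      exact fun _ _ => .inl trivial

/-- The homogeneous universal labelled graph. -/
theorem exists_homogeneous [NeZero n] (G : SimpleGraph V) :
    ∃ (M : Type u) (Γ : LabelledGraph V n M),
      Nonempty M ∧ Γ.Admissible G ∧ Γ.ExtensionProperty G ∧ Γ.StronglyHomogeneous := by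
  -- One summand for each admissible graph on `Fin k` with `k ≤ n`, so that all of them embed.
  let I : Type u := Σ k : Fin (n + 1), {Δ : LabelledGraph V n (Fin k) // Δ.Admissible G}
  obtain ⟨M, Γ, h1, h2, e, he⟩ := exists_stronglyHomogeneous
    (sigma fun i : I => i.2.1) (Admissible.sigma fun i => i.2.2)
  have hM : Nonempty M := ⟨e ⟨⟨⟨1, Nat.lt_succ_of_le (NeZero.pos n)⟩,
    ⟨⟨fun _ _ => (none, 0), fun _ _ => rfl⟩, fun _ _ _ h => (h (Subsingleton.elim _ _)).elim⟩⟩,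
    (0 : Fin 1)⟩⟩
  refine ⟨M, Γ, hM, h1, ?_, h2⟩
  classical
  intro k hk Δ hΔ S θ hθ
  let i : I := ⟨⟨k, Nat.lt_succ_of_le hk⟩, Δ, hΔ⟩
  let ε : Fin k → M := fun x => e ⟨i, x⟩
  have hε : EmbeddingOn Δ Γ Set.univ ε := by
    intro x _ y _ hxy
    have := he ⟨i, x⟩ trivial ⟨i, y⟩ trivial fun h => hxy (by simpa using h)
    rw [sigma_label_mk] at this
    exact this
  have hεi : Function.Injective ε := fun x y h =>
    by_contra fun hne => (hε x trivial y trivial hne).1 h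
  by_cases hS : S = Set.univ
  · subst hS
    exact ⟨θ, hθ, fun _ _ => rfl⟩
  -- Since `S` is proper, it has fewer than `n` nodes. An automorphism therefore carries the
  -- embedded copy of `S` onto its given image under `θ` and brings the rest of `Δ` along.
  let T : Finset M := S.toFinset.image ε
  have hT : T.card < n := by
    refine Finset.card_image_le.trans_lt (lt_of_lt_of_le ?_ hk)
    have : S.toFinset ⊂ Finset.univ := by
      rw [Finset.ssubset_univ_iff]
      simpa using hS
    simpa using Finset.card_lt_card this
  have hpull : ∃ ψ : M → M, ∀ x, ψ (ε x) = θ x :=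
    ⟨fun p => if h : ∃ x, ε x = p then θ h.choose else p, fun x => by
      have h : ∃ y, ε y = ε x := ⟨x, rfl⟩
      beta_reduce
      rw [dif_pos h, hεi h.choose_spec]⟩
  obtain ⟨ψ, hψ⟩ := hpull
  obtain ⟨σ, hσ, hσ'⟩ := h2 T hT ψ (by
    intro p hp q hq hpq
    simp only [T, Finset.coe_image, Set.coe_toFinset] at hp hq
    obtain ⟨x, hx, rfl⟩ := hp
    obtain ⟨y, hy, rfl⟩ := hq
    have hxy : x ≠ y := fun h => hpq (h ▸ rfl)
    rw [hψ, hψ, (hε x trivial y trivial hxy).2]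
    exact hθ x hx y hy hxy)
  refine ⟨σ ∘ ε, ?_, fun x hx => ?_⟩
  · intro x _ y _ hxy
    have h3 := hε x trivial y trivial hxy
    have h4 := hσ _ trivial _ trivial h3.1
    exact ⟨h4.1, h4.2.trans h3.2⟩
  · rw [Function.comp_apply, hσ' (by simpa [T] using ⟨x, hx, rfl⟩), hψ]

end LabelledGraph

/-! ## Edges as atoms and consistent matrices -/

/-- Consistency of a triangle whose edges may be degenerate (`none`). -/
def Consistent {V : Type u} {n : ℕ} (G : SimpleGraph V) :
    Option (EdgeLabel V n) → Option (EdgeLabel V n) → Option (EdgeLabel V n) → Prop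
  | none, q, r => q = r
  | some p, none, r => some p = r
  | some p, some q, none => p = q
  | some p, some q, some r => TriangleOK G p q r

section Consistent

variable {V : Type u} {n : ℕ} {G : SimpleGraph V} {p q r : Option (EdgeLabel V n)}

theorem Consistent.swap (h : Consistent G p q r) : Consistent G q p r := by
  cases p <;> cases q <;> cases r <;> simp_all [Consistent]
  exact h.swap

theorem Consistent.rotate (h : Consistent G p q r) : Consistent G q r p := by
  cases p <;> cases q <;> cases r <;> simp_all [Consistent]
  exact h.rotate

theorem Consistent.swap' (h : Consistent G p q r) : Consistent G p r q :=
  h.rotate.swap.rotate.rotate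

theorem consistent_none_left : Consistent G none q r ↔ q = r := Iff.rfl

theorem consistent_none_mid : Consistent G p none r ↔ p = r := by
  cases p <;> simp [Consistent]

theorem consistent_none_right : Consistent G p q none ↔ p = q := by
  cases p <;> cases q <;> simp [Consistent]

/-- Consistent symmetric matrices of possibly degenerate labels. -/
structure IsNetwork (G : SimpleGraph V) {ι : Type v} (τ : ι → ι → Option (EdgeLabel V n)) :
    Prop where
  refl : ∀ i, τ i i = none
  symm : ∀ i j, τ i j = τ j i
  tri : ∀ i j k, Consistent G (τ i j) (τ i k) (τ k j)

theorem IsNetwork.comp {ι : Type v} {τ : ι → ι → Option (EdgeLabel V n)} (h : IsNetwork G τ)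
    (f : ι → ι) : IsNetwork G fun i j => τ (f i) (f j) :=
  ⟨fun _ => h.refl _, fun _ _ => h.symm _ _, fun _ _ _ => h.tri _ _ _⟩

end Consistent

namespace LabelledGraph

variable {V : Type u} {n : ℕ} {M : Type v}

open Classical in
/-- The label of an edge; `none` for a degenerate edge. -/
noncomputable def edge (Γ : LabelledGraph V n M) (x y : M) : Option (EdgeLabel V n) :=
  if x = y then none else some (Γ.label x y)

variable {Γ : LabelledGraph V n M} {G : SimpleGraph V}

theorem edge_self (x : M) : Γ.edge x x = none := by simp [edge]

theorem edge_eq_none {x y : M} : Γ.edge x y = none ↔ x = y := by simp [edge]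

theorem edge_of_ne {x y : M} (h : x ≠ y) : Γ.edge x y = some (Γ.label x y) := by simp [edge, h]

theorem edge_eq_some {x y : M} {l : EdgeLabel V n} : Γ.edge x y = some l ↔ Γ.Rel l x y := by
  simp [edge, Rel]

theorem edge_comm (x y : M) : Γ.edge x y = Γ.edge y x := by
  by_cases h : x = y
  · rw [h]
  · simp [edge, h, Ne.symm h, Γ.symm x y]

theorem Admissible.consistent (h : Γ.Admissible G) (x y z : M) :
    Consistent G (Γ.edge x y) (Γ.edge x z) (Γ.edge z y) := by
  by_cases h1 : x = y
  · subst h1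
    rw [edge_self, consistent_none_left, edge_comm]
  by_cases h2 : x = z
  · subst h2
    rw [edge_self, consistent_none_mid]
  by_cases h3 : z = y
  · subst h3
    rw [edge_self, consistent_none_right]
  rw [edge_of_ne h1, edge_of_ne h2, edge_of_ne h3, Γ.symm x y, Γ.symm z y]
  exact (h x y z h1 h2 (Ne.symm h3)).swap.rotate

theorem Admissible.isNetwork (h : Γ.Admissible G) {ι : Type*} (s : ι → M) :
    IsNetwork G fun k l => Γ.edge (s k) (s l) :=
  ⟨fun _ => edge_self _, fun _ _ => edge_comm _ _, fun _ _ _ => h.consistent _ _ _⟩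

theorem IsAut.edge_eq {σ : M ≃ M} (h : Γ.IsAut σ) (x y : M) :
    Γ.edge (σ x) (σ y) = Γ.edge x y := by
  by_cases hxy : x = y
  · simp [hxy, edge_self]
  · rw [edge_of_ne hxy, edge_of_ne fun h => hxy (σ.injective h), h.label_eq hxy]

/-- One-point extensions: the extension property is applied to `S` with one additional node
`Fin.last`, whose edges are prescribed by `b`. -/
theorem ExtensionProperty.exists_label [Nonempty M] (hΓ : Γ.Admissible G)
    (hext : Γ.ExtensionProperty G) (S : Finset M) (hS : S.card < n) (b : M → EdgeLabel V n)
    (hb : ∀ y ∈ S, ∀ z ∈ S, y ≠ z → TriangleOK G (b y) (Γ.label y z) (b z)) :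
    ∃ x ∉ S, ∀ y ∈ S, Γ.label x y = b y := by
  classical
  let e := S.equivFin
  rcases S.eq_empty_or_nonempty with rfl | ⟨y₀, hy₀⟩
  · exact ⟨Classical.arbitrary M, by simp, by simp⟩
  let w : Fin (S.card + 1) → M := Fin.lastCases y₀ fun a => (e.symm a).1
  have hw : ∀ a : Fin S.card, w a.castSucc = (e.symm a).1 := fun a => by simp [w]
  have hwS : ∀ a, w a ∈ S := fun a => by
    induction a using Fin.lastCases with
    | last => simpa [w] using hy₀
    | cast a => simp [w]
  have hwinj : ∀ a c, a ≠ Fin.last _ → c ≠ Fin.last _ → a ≠ c → w a ≠ w c := by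
    intro a c ha hc hac h
    obtain ⟨a, rfl⟩ := Fin.exists_castSucc_eq.2 ha
    obtain ⟨c, rfl⟩ := Fin.exists_castSucc_eq.2 hc
    rw [hw, hw] at h
    exact hac (congrArg _ (e.symm.injective (Subtype.ext h)))
  let Δ : LabelledGraph V n (Fin (S.card + 1)) :=
    { label := fun a c => if a = Fin.last _ then b (w c) else
        if c = Fin.last _ then b (w a) else Γ.label (w a) (w c)
      symm := fun a c => by
        by_cases h1 : a = Fin.last _ <;> by_cases h2 : c = Fin.last _ <;> simp [h1, h2]
        exact Γ.symm _ _ }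
  have hΔ : Δ.Admissible G := by
    intro a c d hac had hcd
    show TriangleOK G (ite _ _ _) (ite _ _ _) (ite _ _ _)
    by_cases h1 : a = Fin.last _
    · have h2 : c ≠ Fin.last _ := fun h => hac (h1.trans h.symm)
      have h3 : d ≠ Fin.last _ := fun h => had (h1.trans h.symm)
      simp only [h1, h2, h3, if_true, if_false]
      exact hb _ (hwS _) _ (hwS _) (hwinj _ _ h2 h3 hcd)
    by_cases h2 : c = Fin.last _
    · have h3 : d ≠ Fin.last _ := fun h => hcd (h2.trans h.symm)
      simp only [h1, h2, h3, if_true, if_false]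
      exact (hb _ (hwS _) _ (hwS _) (hwinj _ _ h1 h3 had)).swap.rotate
    by_cases h3 : d = Fin.last _
    · simp only [h1, h2, h3, if_true, if_false]
      have := (hb _ (hwS _) _ (hwS _) (hwinj _ _ h1 h2 hac))
      rw [Γ.symm]
      exact this.rotate
    · simp only [h1, h2, h3, if_false]
      exact hΓ _ _ _ (hwinj _ _ h1 h2 hac) (hwinj _ _ h1 h3 had) (hwinj _ _ h2 h3 hcd)
  obtain ⟨θ, h1, h2⟩ := hext _ hS Δ hΔ {a | a ≠ Fin.last _} w fun a ha c hc hac =>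
    ⟨hwinj a c ha hc hac, by
      have h1 : a ≠ Fin.last _ := ha
      have h2 : c ≠ Fin.last _ := hc
      simp [Δ, h1, h2]⟩
  have key : ∀ y ∈ S, θ (Fin.last _) ≠ y ∧ Γ.label (θ (Fin.last _)) y = b y := fun y hy => by
    have h3 : (e ⟨y, hy⟩).castSucc ≠ Fin.last _ := (Fin.castSucc_lt_last _).ne
    have h4 := h1 _ trivial _ trivial h3.symm
    have h5 : w (e ⟨y, hy⟩).castSucc = y := by simp [hw]
    rw [h2 h3, h5] at h4
    refine ⟨h4.1, h4.2.trans ?_⟩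
    simp [Δ, h5]
  exact ⟨θ (Fin.last _), fun h => (key _ h).1 rfl, fun y hy => (key y hy).2⟩

/-- If some prescribed edge is degenerate, the new point is forced to be an old one, and consistency
says that it has the right edges. Otherwise this is a genuine one-point extension. -/
theorem ExtensionProperty.exists_edge [Nonempty M] (hΓ : Γ.Admissible G)
    (hext : Γ.ExtensionProperty G) (S : Finset M) (hS : S.card < n)
    (b : M → Option (EdgeLabel V n))
    (hb : ∀ y ∈ S, ∀ z ∈ S, Consistent G (b y) (Γ.edge y z) (b z)) :
    ∃ x, ∀ y ∈ S, Γ.edge x y = b y := by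
  by_cases h : ∃ y ∈ S, b y = none
  · obtain ⟨y, hy, h⟩ := h
    refine ⟨y, fun z hz => ?_⟩
    have := hb y hy z hz
    rwa [h, consistent_none_left] at this
  · push Not at h
    have h' : ∀ y, ∃ l, y ∈ S → b y = some l := fun y => by
      by_cases hy : y ∈ S
      · exact (Option.ne_none_iff_exists'.1 (h y hy)).imp fun l hl _ => hl
      · exact ⟨(none, ⟨0, Nat.zero_lt_of_lt hS⟩), fun h => (hy h).elim⟩
    choose c hc using h'
    obtain ⟨x, hxS, hx⟩ := hext.exists_label hΓ S hS c fun y hy z hz hyz => by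
      have := hb y hy z hz
      rwa [hc y hy, hc z hz, edge_of_ne hyz] at this
    refine ⟨x, fun y hy => ?_⟩
    have h1 : x ≠ y := fun h => hxS (h ▸ hy)
    rw [edge_of_ne h1, hx y hy, hc y hy]

theorem ExtensionProperty.exists_triangle [Nonempty M] (hΓ : Γ.Admissible G)
    (hext : Γ.ExtensionProperty G) (hn : 3 ≤ n) {x y : M} {q r : Option (EdgeLabel V n)}
    (h : Consistent G (Γ.edge x y) q r) : ∃ z, Γ.edge x z = q ∧ Γ.edge z y = r := by
  classical
  by_cases hxy : x = y
  · subst hxy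
    rw [edge_self, consistent_none_left] at h
    subst h
    obtain ⟨z, hz⟩ := hext.exists_edge hΓ {x} (by simp; omega) (fun _ => q) (by
      simp [edge_self, consistent_none_mid])
    exact ⟨z, by rw [edge_comm]; exact hz x (by simp), hz x (by simp)⟩
  · obtain ⟨z, hz⟩ := hext.exists_edge hΓ {x, y}
      (Nat.lt_of_le_of_lt Finset.card_le_two (by omega)) (fun z => if z = x then q else r) (by
        have h1 := h.swap
        have h2 := h.swap.swap'.swap
        have h2 := h.rotate.rotate
        simp only [Finset.mem_insert, Finset.mem_singleton]
        rintro a (rfl | rfl) b (rfl | rfl)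
        · simp [edge_self, consistent_none_mid]
        · simpa [Ne.symm hxy] using h1
        · simpa [Ne.symm hxy, edge_comm a b] using h2
        · simp [edge_self, consistent_none_mid])
    refine ⟨z, ?_, ?_⟩
    · rw [edge_comm]
      simpa using hz x (by simp)
    · simpa [Ne.symm hxy] using hz y (by simp)

theorem ExtensionProperty.exists_extend [Nonempty M] (hΓ : Γ.Admissible G)
    (hext : Γ.ExtensionProperty G) {τ : Fin n → Fin n → Option (EdgeLabel V n)}
    (hτ : IsNetwork G τ) (I : Finset (Fin n)) {i : Fin n} (hi : i ∉ I) (s : Fin n → M)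
    (hs : ∀ k ∈ I, ∀ l ∈ I, Γ.edge (s k) (s l) = τ k l) :
    ∃ x, ∀ k ∈ I, Γ.edge x (s k) = τ i k := by
  classical
  -- The requirement is indexed by coordinates but is needed on points. If `s l = s k`, the entry `τ
  -- l k` is degenerate and consistency forces `τ i l = τ i k`.
  have hb : ∃ b : M → Option (EdgeLabel V n), ∀ k ∈ I, b (s k) = τ i k := by
    refine ⟨fun y => if h : ∃ k ∈ I, s k = y then τ i h.choose else none, fun k hk => ?_⟩
    have h : ∃ l ∈ I, s l = s k := ⟨k, hk, rfl⟩
    beta_reduce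
    rw [dif_pos h]
    have h1 := hs _ h.choose_spec.1 _ hk
    rw [h.choose_spec.2, edge_self] at h1
    have h2 := hτ.tri h.choose k i
    rw [← h1, consistent_none_left] at h2
    rw [hτ.symm, h2]
  obtain ⟨b, hb⟩ := hb
  have hI : I.card < n := by
    have h1 : I ⊂ Finset.univ := Finset.ssubset_univ_iff.2 fun h => hi (h ▸ Finset.mem_univ i)
    simpa using Finset.card_lt_card h1
  obtain ⟨x, hx⟩ := hext.exists_edge hΓ (I.image s) (Finset.card_image_le.trans_lt hI) b (by
    intro y hy z hz
    obtain ⟨k, hk, rfl⟩ := Finset.mem_image.1 hy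
    obtain ⟨l, hl, rfl⟩ := Finset.mem_image.1 hz
    rw [hb k hk, hb l hl, hs k hk l hl]
    exact (hτ.tri i l k).rotate.swap.rotate.swap.rotate)
  exact ⟨x, fun k hk => (hx _ (Finset.mem_image_of_mem _ hk)).trans (hb k hk)⟩

theorem ExtensionProperty.exists_update [Nonempty M] (hΓ : Γ.Admissible G)
    (hext : Γ.ExtensionProperty G) {τ : Fin n → Fin n → Option (EdgeLabel V n)}
    (hτ : IsNetwork G τ) (i : Fin n) (s : Fin n → M)
    (hs : ∀ k l, k ≠ i → l ≠ i → Γ.edge (s k) (s l) = τ k l) :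
    ∃ t : Fin n → M, (∀ k, k ≠ i → t k = s k) ∧ ∀ k l, Γ.edge (t k) (t l) = τ k l := by
  classical
  obtain ⟨x, hx⟩ := hext.exists_extend hΓ hτ (Finset.univ.erase i) (i := i) (by simp) s (by
    simpa using fun k hk l hl => hs k l hk hl)
  refine ⟨Function.update s i x, fun k hk => Function.update_of_ne hk _ _, fun k l => ?_⟩
  by_cases hk : k = i <;> by_cases hl : l = i
  · rw [hk, hl, edge_self, hτ.refl]
  · subst hk
    rw [Function.update_self, Function.update_of_ne hl]
    exact hx l (by simp [hl])
  · subst hl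
    rw [Function.update_self, Function.update_of_ne hk, edge_comm, hτ.symm]
    exact hx k (by simp [hk])
  · rw [Function.update_of_ne hk, Function.update_of_ne hl]
    exact hs k l hk hl

theorem ExtensionProperty.exists_realization [Nonempty M] (hΓ : Γ.Admissible G)
    (hext : Γ.ExtensionProperty G) {τ : Fin n → Fin n → Option (EdgeLabel V n)}
    (hτ : IsNetwork G τ) : ∃ t : Fin n → M, ∀ k l, Γ.edge (t k) (t l) = τ k l := by
  classical
  suffices h : ∀ I : Finset (Fin n), ∃ t : Fin n → M, ∀ k ∈ I, ∀ l ∈ I,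
      Γ.edge (t k) (t l) = τ k l by
    simpa using h Finset.univ
  intro I
  induction I using Finset.induction_on with
  | empty => exact ⟨fun _ => Classical.arbitrary M, by simp⟩
  | insert i I hi ih =>
    obtain ⟨s, hs⟩ := ih
    obtain ⟨x, hx⟩ := hext.exists_extend hΓ hτ I hi s hs
    have h1 : ∀ k ∈ I, Function.update s i x k = s k := fun k hk =>
      Function.update_of_ne (ne_of_mem_of_not_mem hk hi) _ _
    refine ⟨Function.update s i x, fun k hk l hl => ?_⟩
    rcases Finset.mem_insert.1 hk with rfl | hk' <;>
      rcases Finset.mem_insert.1 hl with rfl | hl'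
    · rw [edge_self, hτ.refl]
    · rw [Function.update_self, h1 l hl', hx l hl']
    · rw [Function.update_self, h1 k hk', edge_comm, hτ.symm, hx k hk']
    · rw [h1 k hk', h1 l hl', hs k hk' l hl']

/-- Omitting the coordinate `i` leaves at most `n - 1` points, which is just within reach of
homogeneity. The induced map on points is well defined because degenerate edges record the
equalities. -/
theorem StronglyHomogeneous.exists_aut (h : Γ.StronglyHomogeneous) (i : Fin n)
    (s t : Fin n → M)
    (hst : ∀ k l, k ≠ i → l ≠ i → Γ.edge (s k) (s l) = Γ.edge (t k) (t l)) :
    ∃ σ : M ≃ M, Γ.IsAut σ ∧ ∀ k, k ≠ i → σ (s k) = t k := by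
  classical
  have hθ : ∃ θ : M → M, ∀ k, k ≠ i → θ (s k) = t k := by
    refine ⟨fun y => if h : ∃ k, k ≠ i ∧ s k = y then t h.choose else y, fun k hk => ?_⟩
    have h : ∃ l, l ≠ i ∧ s l = s k := ⟨k, hk, rfl⟩
    beta_reduce
    rw [dif_pos h, ← edge_eq_none (Γ := Γ), ← hst _ _ h.choose_spec.1 hk, h.choose_spec.2,
      edge_self]
  obtain ⟨θ, hθ⟩ := hθ
  obtain ⟨σ, h1, h2⟩ := h ((Finset.univ.erase i).image s)
    (Finset.card_image_le.trans_lt (by simpa using i.pos)) θ (by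
      intro x hx y hy hxy
      simp only [Finset.coe_image, Finset.coe_erase, Finset.coe_univ] at hx hy
      obtain ⟨k, hk, rfl⟩ := hx
      obtain ⟨l, hl, rfl⟩ := hy
      have hk : k ≠ i := hk.2
      have hl : l ≠ i := hl.2
      have h3 := hst k l hk hl
      rw [edge_of_ne hxy, eq_comm, edge_eq_some] at h3
      rw [hθ k hk, hθ l hl]
      exact h3)
  refine ⟨σ, h1, fun k hk => ?_⟩
  rw [h2 (by simpa using ⟨k, hk, rfl⟩), hθ k hk]

end LabelledGraph

/-! ## Complex algebras, completions and complete representations -/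

theorem exists_isAtom_le_of_ne_bot {α : Type u} [BooleanAlgebra α] [IsAtomic α] {x : α}
    (h : x ≠ ⊥) : ∃ a, IsAtom a ∧ a ≤ x :=
  (eq_bot_or_exists_atom_le x).resolve_left h

theorem IsAtom.le_sup_iff' {α : Type u} [BooleanAlgebra α] {a x y : α} (ha : IsAtom a) :
    a ≤ x ⊔ y ↔ a ≤ x ∨ a ≤ y := by
  refine ⟨fun h => ?_, fun h => h.elim le_sup_of_le_left le_sup_of_le_right⟩
  by_contra! hc
  have h1 := ha.not_le_iff_disjoint.1 hc.1
  have h2 := ha.not_le_iff_disjoint.1 hc.2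
  exact ha.1 ((h1.sup_right h2).eq_bot_of_le h)

theorem IsAtom.le_compl_iff' {α : Type u} [BooleanAlgebra α] {a x : α} (ha : IsAtom a) :
    a ≤ xᶜ ↔ ¬ a ≤ x := by
  rw [ha.not_le_iff_disjoint, le_compl_iff_disjoint_right]

theorem isLUB_atoms_top' (α : Type u) [BooleanAlgebra α] [IsAtomic α] :
    IsLUB {a : α | IsAtom a} ⊤ := by
  refine ⟨fun _ _ => le_top, fun b hb => ?_⟩
  by_contra h
  have h1 : bᶜ ≠ ⊥ := fun h1 => h (by rw [compl_eq_bot.1 h1])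
  obtain ⟨a, ha, hab⟩ := exists_isAtom_le_of_ne_bot h1
  exact ha.1 (le_bot_iff.1 ((le_inf (hb ha) hab).trans inf_compl_eq_bot.le))

namespace CylAlg

variable {n : ℕ}

section IsHom

variable {A : CylAlg.{u} n} {B : CylAlg.{v} n} {f : A.carrier → B.carrier}

theorem IsHom.map_top (h : IsHom A B f) : f ⊤ = ⊤ := by
  rw [← sup_compl_eq_top (x := (⊥ : A.carrier)), h.map_sup, h.map_compl, sup_compl_eq_top]

theorem IsHom.map_bot (h : IsHom A B f) : f ⊥ = ⊥ := by
  rw [← compl_top, h.map_compl, h.map_top, compl_top]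

theorem IsHom.map_inf (h : IsHom A B f) (x y : A.carrier) : f (x ⊓ y) = f x ⊓ f y := by
  rw [← compl_compl (x ⊓ y), compl_inf, h.map_compl, h.map_sup, h.map_compl, h.map_compl,
    compl_sup, compl_compl, compl_compl]

theorem IsHom.mono (h : IsHom A B f) {x y : A.carrier} (hxy : x ≤ y) : f x ≤ f y := by
  rw [← sup_eq_right, ← h.map_sup, sup_eq_right.2 hxy]

theorem IsHom.comp {C : CylAlg.{u} n} {g : C.carrier → A.carrier} (h : IsHom A B f)
    (hg : IsHom C A g) : IsHom C B (f ∘ g) where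
  map_sup x y := by simp [hg.map_sup, h.map_sup]
  map_compl x := by simp [hg.map_compl, h.map_compl]
  map_cyl i x := by simp [hg.map_cyl, h.map_cyl]
  map_diag i j := by simp [hg.map_diag, h.map_diag]

theorem Isomorphic.symm (h : Isomorphic A B) : Isomorphic B A := by
  obtain ⟨f, hf, hb⟩ := h
  let e := Equiv.ofBijective f hb
  have he : ∀ y, f (e.symm y) = y := fun y => e.apply_symm_apply y
  refine ⟨e.symm, ⟨fun x y => ?_, fun x => ?_, fun i x => ?_, fun i j => ?_⟩, e.symm.bijective⟩
  · apply hb.1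
    rw [hf.map_sup, he, he, he]
  · apply hb.1
    rw [hf.map_compl, he, he]
  · apply hb.1
    rw [hf.map_cyl, he, he]
  · apply hb.1
    rw [hf.map_diag, he]

end IsHom

/-- The embedding sends `x` to the set of atoms below it. Atomicity makes it injective and dense.
`hadd`, additivity witnessed by atoms, is what makes it respect the cylindrifications. -/
theorem isCompletion_complexAlg (A : CylAlg.{u} n) [IsAtomic A.carrier]
    (hmono : ∀ i (x y : A.carrier), x ≤ y → A.cyl i x ≤ A.cyl i y)
    (hadd : ∀ i (x a : A.carrier), IsAtom a → a ≤ A.cyl i x →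
      ∃ b, IsAtom b ∧ b ≤ x ∧ a ≤ A.cyl i b) : A.IsCompletion A.complexAlg := by
  let At := {a : A.carrier // IsAtom a}
  refine ⟨fun X => ⟨_, isLUB_sSup (α := Set At) X⟩, ?_, ?_⟩
  · intro i X b hb
    obtain rfl : b = (sSup (α := Set At) X : Set At) :=
      IsLUB.unique (α := Set At) hb (isLUB_sSup (α := Set At) X)
    constructor
    · rintro _ ⟨Y, hY, rfl⟩ a ⟨c, hc, hac⟩
      exact ⟨c, Set.mem_sUnion.2 ⟨Y, hY, hc⟩, hac⟩
    · rintro Y hY a ⟨c, hc, hac⟩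
      obtain ⟨Z, hZ, hcZ⟩ := Set.mem_sUnion.1 hc
      exact hY ⟨Z, hZ, rfl⟩ (show (A.complexAlg.cyl i Z : Set At) a from ⟨c, hcZ, hac⟩)
  · let f : A.carrier → Set At := fun x => {a | a.1 ≤ x}
    refine ⟨f, ⟨?_, ?_, ?_, fun _ _ => rfl⟩, ?_, ?_⟩
    · intro x y
      refine Set.ext (α := At) fun a => ?_
      exact IsAtom.le_sup_iff' a.2
    · intro x
      refine Set.ext (α := At) fun a => ?_
      exact IsAtom.le_compl_iff' a.2
    · intro i x
      refine Set.ext (α := At) fun a => ?_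
      constructor
      · intro ha
        obtain ⟨b, hb, hbx, hab⟩ := hadd i x a.1 a.2 ha
        exact ⟨⟨b, hb⟩, hbx, hab⟩
      · rintro ⟨b, hbx, hab⟩
        exact hab.trans (hmono i _ _ hbx)
    · intro x y hxy
      have key : ∀ x y, f x = f y → x ≤ y := fun x y hxy => by
        by_contra hle
        have h1 : x ⊓ yᶜ ≠ ⊥ := fun h => hle (by rwa [← sdiff_eq, sdiff_eq_bot_iff] at h)
        obtain ⟨a, ha, hax⟩ := exists_isAtom_le_of_ne_bot h1
        have h2 : (⟨a, ha⟩ : At) ∈ f y := hxy ▸ (show a ≤ x from hax.trans inf_le_left)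
        exact ha.1 (le_bot_iff.1 ((le_inf h2 (hax.trans inf_le_right)).trans inf_compl_eq_bot.le))
      exact le_antisymm (key x y hxy) (key y x hxy.symm)
    · intro Y hY
      obtain ⟨a, ha⟩ : (Y : Set At).Nonempty := Set.nonempty_iff_ne_empty.2 hY
      refine ⟨a.1, a.2.1, fun b hb => ?_⟩
      obtain rfl : b = a := Subtype.ext ((a.2.le_iff_eq b.2.1).1 hb)
      exact ha

/-- Since `⊤` is the supremum of the atoms, a complete representation puts every point into the
image of exactly one atom. Taking unions of these images represents arbitrary sets of atoms. -/
theorem CompletelyRepresentable.complexAlg {A : CylAlg.{u} n} [IsAtomic A.carrier]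
    (h : A.CompletelyRepresentable) : A.complexAlg.Representable := by
  obtain ⟨I, U, hU, f, hf, hinj, hsup⟩ := h
  let At := {a : A.carrier // IsAtom a}
  let T : I → Type u := fun α => (Set.univ : Set (Fin n → U α))
  let f' : A.carrier → ∀ α, Set (T α) := f
  have hcov : ∀ α (s : T α), ∃ a : At, s ∈ f' a.1 α := by
    intro α s
    have h1 := hsup _ _ (isLUB_atoms_top' A.carrier)
    -- The union of the images of the atoms is an upper bound, so it contains the image of `⊤`.
    let c : ∀ α, Set (T α) := fun α => {s | ∃ a : At, s ∈ f' a.1 α}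
    have h2 : f ⊤ ≤ c := h1.2 (by
      rintro _ ⟨a, ha, rfl⟩
      exact fun β t ht => ⟨⟨a, ha⟩, ht⟩)
    rw [hf.map_top] at h2
    exact h2 α (Set.mem_univ s)
  have hdisj : ∀ α (s : T α) (a b : At), s ∈ f' a.1 α → s ∈ f' b.1 α → a = b := by
    intro α s a b ha hb
    by_contra hne
    have h1 : a.1 ⊓ b.1 = ⊥ := (a.2.disjoint_of_ne b.2 fun h => hne (Subtype.ext h)).eq_bot
    have h2 := hf.map_inf a.1 b.1
    rw [h1, hf.map_bot] at h2
    have h3 : s ∈ (f' a.1 ⊓ f' b.1) α := ⟨ha, hb⟩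
    rw [show f' a.1 ⊓ f' b.1 = ⊥ from h2.symm] at h3
    exact h3
  have hcompl : ∀ x α (s : T α), s ∈ f' xᶜ α ↔ s ∉ f' x α := fun x α s => by
    rw [show f' xᶜ = _ from hf.map_compl x]
    rfl
  have hcyl : ∀ i x α (s : T α), s ∈ f' (A.cyl i x) α ↔
      ∃ t ∈ f' x α, ∀ j, j ≠ i → t.1 j = s.1 j := fun i x α s => by
    rw [show f' (A.cyl i x) = _ from hf.map_cyl i x]
    rfl
  have hdiag : ∀ i j α (s : T α), s ∈ f' (A.diag i j) α ↔ s.1 i = s.1 j := fun i j α s => by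
    rw [show f' (A.diag i j) = _ from hf.map_diag i j]
    rfl
  have hle : ∀ α (s : T α) (a : At) (x : A.carrier), s ∈ f' a.1 α → s ∈ f' x α → a.1 ≤ x := by
    intro α s a x ha hx
    by_contra hle
    exact (hcompl x α s).1 (hf.mono ((IsAtom.le_compl_iff' a.2).2 hle) α ha) hx
  let H : Set At → ∀ α, Set (T α) := fun X α => {s | ∃ a ∈ X, s ∈ f' a.1 α}
  refine ⟨I, U, hU, H, ⟨?_, ?_, ?_, ?_⟩, ?_⟩
  · intro (X : Set At) (Y : Set At)
    refine funext fun α => Set.ext (α := T α) fun s => ?_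
    show (∃ a, (a ∈ X ∨ a ∈ Y) ∧ _) ↔ (∃ a, a ∈ X ∧ _) ∨ ∃ a, a ∈ Y ∧ _
    simp only [or_and_right, exists_or]
  · intro (X : Set At)
    refine funext fun α => Set.ext (α := T α) fun s => ?_
    show (∃ a, a ∉ X ∧ s ∈ f' a.1 α) ↔ ¬ ∃ a, a ∈ X ∧ s ∈ f' a.1 α
    obtain ⟨a, ha⟩ := hcov α s
    constructor
    · rintro ⟨b, hb, hsb⟩ ⟨c, hc, hsc⟩
      exact hb (hdisj α s b c hsb hsc ▸ hc)
    · exact fun h => ⟨a, fun haX => h ⟨a, haX, ha⟩, ha⟩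
  · intro i (X : Set At)
    refine funext fun α => Set.ext (α := T α) fun s => ?_
    constructor
    · rintro ⟨a, ⟨b, hb, hab⟩, hs⟩
      obtain ⟨t, ht, hts⟩ := (hcyl i b.1 α s).1 (hf.mono hab α hs)
      exact ⟨t, ⟨b, hb, ht⟩, hts⟩
    · rintro ⟨t, ⟨b, hb, ht⟩, hts⟩
      obtain ⟨a, ha⟩ := hcov α s
      exact ⟨a, ⟨b, hb, hle α s a _ ha ((hcyl i b.1 α s).2 ⟨t, ht, hts⟩)⟩, ha⟩
  · intro i j
    refine funext fun α => Set.ext (α := T α) fun s => ?_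
    constructor
    · rintro ⟨a, hab, hs⟩
      exact (hdiag i j α s).1 (hf.mono hab α hs)
    · intro hs
      obtain ⟨a, ha⟩ := hcov α s
      exact ⟨a, hle α s a _ ha ((hdiag i j α s).2 hs), ha⟩
  · have key : ∀ X Y : Set At, H X = H Y → X ⊆ Y := by
      intro X Y hXY a ha
      have h1 : f' a.1 ≠ ⊥ := fun h => a.2.1 (hinj (h.trans hf.map_bot.symm))
      obtain ⟨α, s, hs⟩ : ∃ α s, s ∈ f' a.1 α := by
        by_contra! h
        exact h1 (funext fun α => Set.eq_empty_of_forall_notMem (h α))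
      have h2 : s ∈ H Y α := hXY ▸ (show s ∈ H X α from ⟨a, ha, hs⟩)
      obtain ⟨b, hb, hsb⟩ := h2
      rwa [hdisj α s a b hs hsb]
    exact fun X Y h => Set.Subset.antisymm (key X Y h) (key Y X h.symm)

end CylAlg

/-! ### The analogues for relation algebras -/

namespace RelAlg

section IsHom

variable {A : RelAlg.{u}} {B : RelAlg.{v}} {f : A.carrier → B.carrier}

theorem IsHom.map_top (h : IsHom A B f) : f ⊤ = ⊤ := by
  rw [← sup_compl_eq_top (x := (⊥ : A.carrier)), h.map_sup, h.map_compl, sup_compl_eq_top]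

theorem IsHom.map_bot (h : IsHom A B f) : f ⊥ = ⊥ := by
  rw [← compl_top, h.map_compl, h.map_top, compl_top]

theorem IsHom.map_inf (h : IsHom A B f) (x y : A.carrier) : f (x ⊓ y) = f x ⊓ f y := by
  rw [← compl_compl (x ⊓ y), compl_inf, h.map_compl, h.map_sup, h.map_compl, h.map_compl,
    compl_sup, compl_compl, compl_compl]

theorem IsHom.mono (h : IsHom A B f) {x y : A.carrier} (hxy : x ≤ y) : f x ≤ f y := by
  rw [← sup_eq_right, ← h.map_sup, sup_eq_right.2 hxy]

theorem IsHom.trans {C : RelAlg.{u}} {g : C.carrier → A.carrier} (h : IsHom A B f)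
    (hg : IsHom C A g) : IsHom C B (f ∘ g) where
  map_sup x y := by simp [hg.map_sup, h.map_sup]
  map_compl x := by simp [hg.map_compl, h.map_compl]
  map_comp x y := by simp [hg.map_comp, h.map_comp]
  map_conv x := by simp [hg.map_conv, h.map_conv]
  map_ident := by simp [hg.map_ident, h.map_ident]

end IsHom

theorem isCompletion_complexAlg (A : RelAlg.{u}) [IsAtomic A.carrier]
    (hmono : ∀ x x' y y' : A.carrier, x ≤ x' → y ≤ y' → A.comp x y ≤ A.comp x' y')
    (hadd : ∀ x y a : A.carrier, IsAtom a → a ≤ A.comp x y →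
      ∃ b c, IsAtom b ∧ IsAtom c ∧ b ≤ x ∧ c ≤ y ∧ a ≤ A.comp b c)
    (hmono' : ∀ x y : A.carrier, x ≤ y → A.conv x ≤ A.conv y)
    (hadd' : ∀ x a : A.carrier, IsAtom a → a ≤ A.conv x →
      ∃ b, IsAtom b ∧ b ≤ x ∧ a ≤ A.conv b) : A.IsCompletion A.complexAlg := by
  let At := {a : A.carrier // IsAtom a}
  refine ⟨fun X => ⟨_, isLUB_sSup (α := Set At) X⟩, ?_, ?_⟩
  · intro X b c hb
    obtain rfl : b = (sSup (α := Set At) X : Set At) :=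
      IsLUB.unique (α := Set At) hb (isLUB_sSup (α := Set At) X)
    refine ⟨⟨?_, ?_⟩, ⟨?_, ?_⟩, ⟨?_, ?_⟩⟩
    · rintro _ ⟨Y, hY, rfl⟩ a ⟨p, hp, q, hq, h⟩
      exact ⟨p, Set.mem_sUnion.2 ⟨Y, hY, hp⟩, q, hq, h⟩
    · rintro Y hY a ⟨p, hp, q, hq, h⟩
      obtain ⟨Z, hZ, hpZ⟩ := Set.mem_sUnion.1 hp
      exact hY ⟨Z, hZ, rfl⟩ (show (A.complexAlg.comp Z c : Set At) a from ⟨p, hpZ, q, hq, h⟩)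
    · rintro _ ⟨Y, hY, rfl⟩ a ⟨p, hp, q, hq, h⟩
      exact ⟨p, hp, q, Set.mem_sUnion.2 ⟨Y, hY, hq⟩, h⟩
    · rintro Y hY a ⟨p, hp, q, hq, h⟩
      obtain ⟨Z, hZ, hqZ⟩ := Set.mem_sUnion.1 hq
      exact hY ⟨Z, hZ, rfl⟩ (show (A.complexAlg.comp c Z : Set At) a from ⟨p, hp, q, hqZ, h⟩)
    · rintro _ ⟨Y, hY, rfl⟩ a ⟨p, hp, h⟩
      exact ⟨p, Set.mem_sUnion.2 ⟨Y, hY, hp⟩, h⟩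
    · rintro Y hY a ⟨p, hp, h⟩
      obtain ⟨Z, hZ, hpZ⟩ := Set.mem_sUnion.1 hp
      exact hY ⟨Z, hZ, rfl⟩ (show (A.complexAlg.conv Z : Set At) a from ⟨p, hpZ, h⟩)
  · let f : A.carrier → Set At := fun x => {a | a.1 ≤ x}
    refine ⟨f, ⟨?_, ?_, ?_, ?_, rfl⟩, ?_, ?_⟩
    · intro x y
      refine Set.ext (α := At) fun a => ?_
      exact IsAtom.le_sup_iff' a.2
    · intro x
      refine Set.ext (α := At) fun a => ?_
      exact IsAtom.le_compl_iff' a.2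
    · intro x y
      refine Set.ext (α := At) fun a => ?_
      constructor
      · intro ha
        obtain ⟨b, c, hb, hc, hbx, hcy, h⟩ := hadd x y a.1 a.2 ha
        exact ⟨⟨b, hb⟩, hbx, ⟨c, hc⟩, hcy, h⟩
      · rintro ⟨b, hbx, c, hcy, h⟩
        exact h.trans (hmono _ _ _ _ hbx hcy)
    · intro x
      refine Set.ext (α := At) fun a => ?_
      constructor
      · intro ha
        obtain ⟨b, hb, hbx, h⟩ := hadd' x a.1 a.2 ha
        exact ⟨⟨b, hb⟩, hbx, h⟩
      · rintro ⟨b, hbx, h⟩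
        exact h.trans (hmono' _ _ hbx)
    · intro x y hxy
      have key : ∀ x y, f x = f y → x ≤ y := fun x y hxy => by
        by_contra hle
        have h1 : x ⊓ yᶜ ≠ ⊥ := fun h => hle (by rwa [← sdiff_eq, sdiff_eq_bot_iff] at h)
        obtain ⟨a, ha, hax⟩ := exists_isAtom_le_of_ne_bot h1
        have h2 : (⟨a, ha⟩ : At) ∈ f y := hxy ▸ (show a ≤ x from hax.trans inf_le_left)
        exact ha.1 (le_bot_iff.1 ((le_inf h2 (hax.trans inf_le_right)).trans inf_compl_eq_bot.le))
      exact le_antisymm (key x y hxy) (key y x hxy.symm)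
    · intro Y hY
      obtain ⟨a, ha⟩ : (Y : Set At).Nonempty := Set.nonempty_iff_ne_empty.2 hY
      refine ⟨a.1, a.2.1, fun b hb => ?_⟩
      obtain rfl : b = a := Subtype.ext ((a.2.le_iff_eq b.2.1).1 hb)
      exact ha

/-- As for cylindric algebras, each pair of points of a complete representation lies in the image of
exactly one atom. -/
theorem CompletelyRepresentable.complexAlg {A : RelAlg.{u}} [IsAtomic A.carrier]
    (h : A.CompletelyRepresentable) : A.complexAlg.Representable := by
  obtain ⟨I, U, hU, f, hf, hinj, hsup⟩ := h
  let At := {a : A.carrier // IsAtom a}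
  let T : I → Type u := fun α => U α × U α
  let f' : A.carrier → ∀ α, Set (T α) := f
  have hcov : ∀ α (s : T α), ∃ a : At, s ∈ f' a.1 α := by
    intro α s
    have h1 := hsup _ _ (isLUB_atoms_top' A.carrier)
    let c : ∀ α, Set (T α) := fun α => {s | ∃ a : At, s ∈ f' a.1 α}
    have h2 : f ⊤ ≤ c := h1.2 (by
      rintro _ ⟨a, ha, rfl⟩
      exact fun β t ht => ⟨⟨a, ha⟩, ht⟩)
    rw [hf.map_top] at h2
    exact h2 α (Set.mem_univ s)
  have hdisj : ∀ α (s : T α) (a b : At), s ∈ f' a.1 α → s ∈ f' b.1 α → a = b := by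
    intro α s a b ha hb
    by_contra hne
    have h1 : a.1 ⊓ b.1 = ⊥ := (a.2.disjoint_of_ne b.2 fun h => hne (Subtype.ext h)).eq_bot
    have h2 := hf.map_inf a.1 b.1
    rw [h1, hf.map_bot] at h2
    have h3 : s ∈ (f' a.1 ⊓ f' b.1) α := ⟨ha, hb⟩
    rw [show f' a.1 ⊓ f' b.1 = ⊥ from h2.symm] at h3
    exact h3
  have hcompl : ∀ x α (s : T α), s ∈ f' xᶜ α ↔ s ∉ f' x α := fun x α s => by
    rw [show f' xᶜ = _ from hf.map_compl x]
    rfl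
  have hcomp : ∀ x y α (s : T α), s ∈ f' (A.comp x y) α ↔
      ∃ z, (s.1, z) ∈ f' x α ∧ (z, s.2) ∈ f' y α := fun x y α s => by
    rw [show f' (A.comp x y) = _ from hf.map_comp x y]
    rfl
  have hconv : ∀ x α (s : T α), s ∈ f' (A.conv x) α ↔ (s.2, s.1) ∈ f' x α := fun x α s => by
    rw [show f' (A.conv x) = _ from hf.map_conv x]
    rfl
  have hident : ∀ α (s : T α), s ∈ f' A.ident α ↔ s.1 = s.2 := fun α s => by
    rw [show f' A.ident = _ from hf.map_ident]
    rfl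
  have hle : ∀ α (s : T α) (a : At) (x : A.carrier), s ∈ f' a.1 α → s ∈ f' x α → a.1 ≤ x := by
    intro α s a x ha hx
    by_contra hle
    exact (hcompl x α s).1 (hf.mono ((IsAtom.le_compl_iff' a.2).2 hle) α ha) hx
  let H : Set At → ∀ α, Set (T α) := fun X α => {s | ∃ a ∈ X, s ∈ f' a.1 α}
  refine ⟨I, U, hU, H, ⟨?_, ?_, ?_, ?_, ?_⟩, ?_⟩
  · intro (X : Set At) (Y : Set At)
    refine funext fun α => Set.ext (α := T α) fun s => ?_
    show (∃ a, (a ∈ X ∨ a ∈ Y) ∧ _) ↔ (∃ a, a ∈ X ∧ _) ∨ ∃ a, a ∈ Y ∧ _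
    simp only [or_and_right, exists_or]
  · intro (X : Set At)
    refine funext fun α => Set.ext (α := T α) fun s => ?_
    show (∃ a, a ∉ X ∧ s ∈ f' a.1 α) ↔ ¬ ∃ a, a ∈ X ∧ s ∈ f' a.1 α
    obtain ⟨a, ha⟩ := hcov α s
    constructor
    · rintro ⟨b, hb, hsb⟩ ⟨c, hc, hsc⟩
      exact hb (hdisj α s b c hsb hsc ▸ hc)
    · exact fun h => ⟨a, fun haX => h ⟨a, haX, ha⟩, ha⟩
  · intro (X : Set At) (Y : Set At)
    refine funext fun α => Set.ext (α := T α) fun s => ?_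
    constructor
    · rintro ⟨a, ⟨b, hb, c, hc, hab⟩, hs⟩
      obtain ⟨z, hz, hz'⟩ := (hcomp b.1 c.1 α s).1 (hf.mono hab α hs)
      exact ⟨z, ⟨b, hb, hz⟩, ⟨c, hc, hz'⟩⟩
    · rintro ⟨z, ⟨b, hb, hz⟩, ⟨c, hc, hz'⟩⟩
      obtain ⟨a, ha⟩ := hcov α s
      exact ⟨a, ⟨b, hb, c, hc, hle α s a _ ha ((hcomp b.1 c.1 α s).2 ⟨z, hz, hz'⟩)⟩, ha⟩
  · intro (X : Set At)
    refine funext fun α => Set.ext (α := T α) fun s => ?_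
    constructor
    · rintro ⟨a, ⟨b, hb, hab⟩, hs⟩
      exact ⟨b, hb, (hconv b.1 α s).1 (hf.mono hab α hs)⟩
    · rintro ⟨b, hb, hz⟩
      obtain ⟨a, ha⟩ := hcov α s
      exact ⟨a, ⟨b, hb, hle α s a _ ha ((hconv b.1 α s).2 hz)⟩, ha⟩
  · refine funext fun α => Set.ext (α := T α) fun s => ?_
    constructor
    · rintro ⟨a, hab, hs⟩
      exact (hident α s).1 (hf.mono hab α hs)
    · intro hs
      obtain ⟨a, ha⟩ := hcov α s
      exact ⟨a, hle α s a _ ha ((hident α s).2 hs), ha⟩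
  · have key : ∀ X Y : Set At, H X = H Y → X ⊆ Y := by
      intro X Y hXY a ha
      have h1 : f' a.1 ≠ ⊥ := fun h => a.2.1 (hinj (h.trans hf.map_bot.symm))
      obtain ⟨α, s, hs⟩ : ∃ α s, s ∈ f' a.1 α := by
        by_contra! h
        exact h1 (funext fun α => Set.eq_empty_of_forall_notMem (h α))
      have h2 : s ∈ H Y α := hXY ▸ (show s ∈ H X α from ⟨a, ha, hs⟩)
      obtain ⟨b, hb, hsb⟩ := h2
      rwa [hdisj α s a b hs hsb]
    exact fun X Y h => Set.Subset.antisymm (key X Y h) (key Y X h.symm)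

end RelAlg

/-! ## The relativized set algebra of definable relations -/

namespace LabelledGraph

variable {V : Type u} {n : ℕ} {M : Type u} {Γ : LabelledGraph V n M} {G : SimpleGraph V}

theorem mem_W_iff {s : Fin n → M} :
    s ∈ Γ.W ↔ ∀ k l c, Γ.edge (s k) (s l) ≠ some (none, c) := by
  constructor
  · intro h k l c he
    rcases lt_trichotomy k l with hkl | rfl | hkl
    · exact h k l hkl c (edge_eq_some.1 he)
    · simp [edge_self] at he
    · rw [edge_comm] at he
      exact h l k hkl c (edge_eq_some.1 he)
  · intro h k l _ c he
    exact h k l c (edge_eq_some.2 he)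

theorem mem_W_comp {s : Fin n → M} (hs : s ∈ Γ.W) (f : Fin n → Fin n) : s ∘ f ∈ Γ.W :=
  mem_W_iff.2 fun _ _ c => mem_W_iff.1 hs _ _ c

theorem mem_W_congr {s t : Fin n → M}
    (h : ∀ k l, Γ.edge (s k) (s l) = Γ.edge (t k) (t l)) : s ∈ Γ.W ↔ t ∈ Γ.W := by
  simp only [mem_W_iff, h]

/-- At a quantifier, an automorphism matching the coordinates other than `i` transports the witness.
It preserves all edges, so the new tuple stays in `W`. -/
theorem sem_of_edge (hhom : Γ.StronglyHomogeneous) (φ : Fml V n) {s t : Γ.W}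
    (h : ∀ k l, Γ.edge (s.1 k) (s.1 l) = Γ.edge (t.1 k) (t.1 l)) (hs : s ∈ Γ.sem Γ.W φ) :
    t ∈ Γ.sem Γ.W φ := by
  induction φ generalizing s t with
  | fls => exact hs
  | eq i j =>
    exact edge_eq_none.1 ((h i j).symm.trans (edge_eq_none.2 hs))
  | rel l i j =>
    exact edge_eq_some.1 ((h i j).symm.trans (edge_eq_some.2 hs))
  | or φ ψ ih1 ih2 => exact hs.imp (ih1 h) (ih2 h)
  | not φ ih => exact fun ht => hs (ih (fun k l => (h k l).symm) ht)
  | ex i φ ih =>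
    obtain ⟨s', hs', hss'⟩ := hs
    obtain ⟨σ, hσ, hσt⟩ := hhom.exists_aut i s.1 t.1 fun k l _ _ => h k l
    have h1 : ∀ k l, Γ.edge (s'.1 k) (s'.1 l) = Γ.edge (σ (s'.1 k)) (σ (s'.1 l)) := fun k l =>
      (hσ.edge_eq _ _).symm
    refine ⟨⟨fun k => σ (s'.1 k), (mem_W_congr h1).1 s'.2⟩, ih h1 hs', fun k hk => ?_⟩
    rw [← hσt k hk, ← hss' k hk]

variable {D : Set (Fin n → M)}

/-- The set of points of an element of the algebra of definable relations. -/
def pts (a : (Γ.setAlg D).carrier) : Set D := a.1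

theorem pts_injective : Function.Injective (pts : (Γ.setAlg D).carrier → Set D) :=
  fun _ _ h => Subtype.ext h

theorem pts_bot : pts (⊥ : (Γ.setAlg D).carrier) = ∅ := rfl

theorem pts_ne_empty {a : (Γ.setAlg D).carrier} : a ≠ ⊥ ↔ (pts a).Nonempty := by
  rw [Set.nonempty_iff_ne_empty, ← pts_bot (Γ := Γ) (D := D), pts_injective.ne_iff]

theorem exists_sem_edge (k l : Fin n) (e : Option (EdgeLabel V n)) :
    {t : D | Γ.edge (t.1 k) (t.1 l) = e} ∈ Set.range (Γ.sem D) := by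
  cases e with
  | none => exact ⟨.eq k l, Set.ext fun t => edge_eq_none.symm⟩
  | some p => exact ⟨.rel p k l, Set.ext fun t => edge_eq_some.symm⟩

/-- There are only finitely many pairs of coordinates, so a type is defined by one finite
conjunction. -/
theorem exists_sem_type (τ : Fin n → Fin n → Option (EdgeLabel V n)) :
    {t : D | ∀ k l, Γ.edge (t.1 k) (t.1 l) = τ k l} ∈ Set.range (Γ.sem D) := by
  classical
  suffices h : ∀ I : Finset (Fin n × Fin n),
      {t : D | ∀ p ∈ I, Γ.edge (t.1 p.1) (t.1 p.2) = τ p.1 p.2} ∈ Set.range (Γ.sem D) by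
    simpa using h Finset.univ
  intro I
  induction I using Finset.induction_on with
  | empty => exact ⟨.not .fls, Set.ext fun t => by simp [sem]⟩
  | insert p I _ ih =>
    obtain ⟨φ, hφ⟩ := ih
    obtain ⟨ψ, hψ⟩ := exists_sem_edge (Γ := Γ) (D := D) p.1 p.2 (τ p.1 p.2)
    refine ⟨.not (.or (.not ψ) (.not φ)), Set.ext fun t => ?_⟩
    simp [sem, hφ, hψ]

/-- The definable set of the tuples of the same type as `s`. -/
noncomputable def typeClass (Γ : LabelledGraph V n M) (s : D) : (Γ.setAlg D).carrier :=
  ⟨{t : D | ∀ k l, Γ.edge (t.1 k) (t.1 l) = Γ.edge (s.1 k) (s.1 l)}, exists_sem_type _⟩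

theorem self_mem_typeClass (s : D) : s ∈ pts (Γ.typeClass s) := fun _ _ => rfl

/-- No formula splits a type. Hence the type classes are the atoms, and each nonzero element
contains one. -/
theorem typeClass_le (hhom : Γ.StronglyHomogeneous) {s : Γ.W} {a : (Γ.setAlg Γ.W).carrier} :
    Γ.typeClass s ≤ a ↔ s ∈ pts a := by
  refine ⟨fun h => h (self_mem_typeClass s), fun h t ht => ?_⟩
  obtain ⟨_, φ, rfl⟩ := a
  exact sem_of_edge hhom φ (fun k l => (ht k l).symm) h

theorem isAtom_typeClass (hhom : Γ.StronglyHomogeneous) (s : Γ.W) : IsAtom (Γ.typeClass s) := by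
  refine ⟨pts_ne_empty.2 ⟨s, self_mem_typeClass s⟩, fun b hb => ?_⟩
  by_contra hne
  obtain ⟨t, ht⟩ := pts_ne_empty.1 hne
  refine hb.not_ge ((typeClass_le hhom).2 ?_)
  exact (typeClass_le hhom).2 ht fun k l => (hb.le ht k l).symm

theorem isAtomic_setAlg (hhom : Γ.StronglyHomogeneous) : IsAtomic (Γ.setAlg Γ.W).carrier := by
  refine ⟨fun b => ?_⟩
  by_cases h : b = ⊥
  · exact .inl h
  · obtain ⟨s, hs⟩ := pts_ne_empty.1 h
    exact .inr ⟨_, isAtom_typeClass hhom s, (typeClass_le hhom).2 hs⟩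

theorem eq_typeClass_of_isAtom (hhom : Γ.StronglyHomogeneous) {a : (Γ.setAlg Γ.W).carrier}
    (ha : IsAtom a) {s : Γ.W} (hs : s ∈ pts a) : a = Γ.typeClass s :=
  ((ha.le_iff_eq (isAtom_typeClass hhom s).1).1 ((typeClass_le hhom).2 hs)).symm

theorem le_of_mem_pts (hhom : Γ.StronglyHomogeneous) {a b : (Γ.setAlg Γ.W).carrier}
    (ha : IsAtom a) {s : Γ.W} (hs : s ∈ pts a) (hb : s ∈ pts b) : a ≤ b := by
  rw [eq_typeClass_of_isAtom hhom ha hs]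
  exact (typeClass_le hhom).2 hb

theorem isCompletion_setAlg (hhom : Γ.StronglyHomogeneous) :
    (Γ.setAlg Γ.W).IsCompletion (Γ.setAlg Γ.W).complexAlg := by
  have := isAtomic_setAlg hhom
  refine CylAlg.isCompletion_complexAlg _ ?_ ?_
  · rintro i x y hxy s ⟨t, ht, hts⟩
    exact ⟨t, hxy ht, hts⟩
  · intro i x a ha hax
    obtain ⟨s, hs⟩ := pts_ne_empty.1 ha.1
    obtain ⟨t, ht, hts⟩ := hax hs
    exact ⟨_, isAtom_typeClass hhom t, (typeClass_le hhom).2 ht,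
      le_of_mem_pts hhom ha hs ⟨t, self_mem_typeClass t, hts⟩⟩

end LabelledGraph

/-! ## Back and forth between the relativized and the classical semantics -/

section Cliques

variable {V : Type u} {G : SimpleGraph V} {N : ℕ}

/-- The clique of a node, where `ρ` forms a clique of its own. -/
def cliqueOf (G : SimpleGraph V) : Option V → Option G.ConnectedComponent :=
  Option.map G.connectedComponentMk

theorem NodeAdj.cliqueOf_eq {p q : Option V} (h : NodeAdj G p q) :
    cliqueOf G p = cliqueOf G q := by
  cases p <;> cases q
  · rfl
  · exact h.elim
  · exact h.elim
  · exact congrArg some (SimpleGraph.ConnectedComponent.sound (SimpleGraph.Adj.reachable h))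

theorem IsUnionOfCliques.adj (hG : IsUnionOfCliques G N) {a b : V} (hab : a ≠ b)
    (h : G.connectedComponentMk a = G.connectedComponentMk b) : G.Adj a b :=
  (hG.2 (G.connectedComponentMk b)).1 h rfl hab

theorem IsUnionOfCliques.nodeAdj (hG : IsUnionOfCliques G N) {p q : Option V}
    (h : cliqueOf G p = cliqueOf G q) (hpq : p = none ∨ p ≠ q) : NodeAdj G p q := by
  cases p <;> cases q
  · trivial
  · simp [cliqueOf] at h
  · simp [cliqueOf] at h
  · exact hG.adj (by simpa using hpq) (by simpa [cliqueOf] using h)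

theorem IsUnionOfCliques.exists_mem_supp (hG : IsUnionOfCliques G N)
    (c : G.ConnectedComponent) (U : Finset (Option V)) (hU : U.card < N) :
    ∃ a, G.connectedComponentMk a = c ∧ some a ∉ U := by
  classical
  have hc := (hG.2 c).2
  have hfin : c.supp.Finite := Set.finite_of_ncard_pos (by omega)
  have h1 : (hfin.toFinset.image some).card = N := by
    rw [Finset.card_image_of_injective _ (Option.some_injective V), ← hc,
      Set.ncard_eq_toFinset_card _ hfin]
  obtain ⟨x, hx, hxU⟩ := Finset.exists_mem_notMem_of_card_lt_card (hU.trans_eq h1.symm)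
  obtain ⟨a, ha, rfl⟩ := Finset.mem_image.1 hx
  exact ⟨a, by simpa using ha, hxU⟩

/-- Greedy choice: each new node must avoid `U` and the nodes already chosen, fewer than `N` in all,
while its clique has `N` nodes. -/
theorem IsUnionOfCliques.exists_injOn (hG : IsUnionOfCliques G N) {M : Type v} [Nonempty V]
    (J : Finset M) (Q : M → G.ConnectedComponent) (U : Finset (Option V))
    (h : U.card + J.card ≤ N) :
    ∃ w : M → V, Set.InjOn w J ∧ ∀ y ∈ J, G.connectedComponentMk (w y) = Q y ∧ some (w y) ∉ U := by
  classical
  induction J using Finset.induction_on with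
  | empty => exact ⟨fun _ => Classical.arbitrary V, by simp, by simp⟩
  | insert y J hy ih =>
    rw [Finset.card_insert_of_notMem hy] at h
    obtain ⟨w, h1, h2⟩ := ih (by omega)
    obtain ⟨a, ha, haU⟩ := hG.exists_mem_supp (Q y) (U ∪ J.image fun z => some (w z)) (by
      have h3 := Finset.card_union_le U (J.image fun z => some (w z))
      have h4 := Finset.card_image_le (s := J) (f := fun z => some (w z))
      omega)
    have hne : ∀ z ∈ J, Function.update w y a z = w z := fun z hz =>
      Function.update_of_ne (ne_of_mem_of_not_mem hz hy) _ _
    simp only [Finset.mem_union, Finset.mem_image, Option.some.injEq, not_or, not_exists,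
      not_and] at haU
    refine ⟨Function.update w y a, ?_, ?_⟩
    · intro z hz z' hz' hzz
      rcases Finset.mem_insert.1 hz with rfl | hzJ <;>
        rcases Finset.mem_insert.1 hz' with rfl | hzJ'
      · rfl
      · rw [Function.update_self, hne z' hzJ'] at hzz
        exact (haU.2 z' hzJ' hzz.symm).elim
      · rw [Function.update_self, hne z hzJ] at hzz
        exact (haU.2 z hzJ hzz).elim
      · rw [hne z hzJ, hne z' hzJ'] at hzz
        exact h1 hzJ hzJ' hzz
    · intro z hz
      rcases Finset.mem_insert.1 hz with rfl | hz
      · rw [Function.update_self]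
        exact ⟨ha, haU.1⟩
      · rw [hne z hz]
        exact h2 z hz

end Cliques

/-- Two edges are similar: they have the same colour, corresponding cliques, and the same nodes as
far as the cliques in `E` are concerned. -/
def EdgeSim {V : Type u} {n : ℕ} (G : SimpleGraph V) (E : Set G.ConnectedComponent)
    (π : Equiv.Perm (Option G.ConnectedComponent)) :
    Option (EdgeLabel V n) → Option (EdgeLabel V n) → Prop
  | none, none => True
  | some p, some q => p.2 = q.2 ∧ π (cliqueOf G p.1) = cliqueOf G q.1 ∧
      ∀ a, G.connectedComponentMk a ∈ E → p.1 = some a → q.1 = some a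
  | _, _ => False

section EdgeSim

variable {V : Type u} {n : ℕ} {G : SimpleGraph V} {E : Set G.ConnectedComponent}
  {π : Equiv.Perm (Option G.ConnectedComponent)} {e e' : Option (EdgeLabel V n)}

/-- The clause on nodes in `E` is a one-way implication, but `π` fixes the cliques in `E`. If the
second node lies in such a clique, so does the first, and the implication identifies them. -/
theorem EdgeSim.symm (hπ : ∀ c ∈ E, π (some c) = some c) (h : EdgeSim G E π e e') :
    EdgeSim G E π.symm e' e := by
  cases e <;> cases e'
  · trivial
  · exact h.elim
  · exact h.elim
  rename_i p q
  obtain ⟨h1, h2, h3⟩ := h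
  refine ⟨h1.symm, by rw [← h2, Equiv.symm_apply_apply], fun a ha hq => ?_⟩
  have h4 : π (cliqueOf G p.1) = π (some (G.connectedComponentMk a)) := by
    rw [h2, hq, hπ _ ha]
    rfl
  have h5 := π.injective h4
  obtain ⟨b, hb⟩ : ∃ b, p.1 = some b := by
    cases hp : p.1 with
    | none => simp [hp, cliqueOf] at h5
    | some b => exact ⟨b, rfl⟩
  have h6 : G.connectedComponentMk b = G.connectedComponentMk a := by
    simpa [hb, cliqueOf] using h5
  have h7 := h3 b (h6 ▸ ha) hb
  rw [hb, ← h7, hq]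

theorem EdgeSim.eq_none_iff (h : EdgeSim G E π e e') : e = none ↔ e' = none := by
  cases e <;> cases e' <;> simp_all [EdgeSim]

theorem EdgeSim.eq_some (h : EdgeSim G E π e e') {a : V} (ha : G.connectedComponentMk a ∈ E)
    {c : Fin n} (he : e = some (some a, c)) : e' = some (some a, c) := by
  subst he
  cases e'
  · exact h.elim
  · rename_i q
    obtain ⟨h1, -, h3⟩ := h
    rw [← h3 a ha rfl, show c = q.2 from h1]

end EdgeSim

namespace LabelledGraph

variable {V : Type u} {n N : ℕ} {M : Type u} {Γ : LabelledGraph V n M} {G : SimpleGraph V}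

/-- No edge of a tuple in `W` carries `ρ`, so a clique that `π` sends to `ρ` can be sent to a clique
`F` not yet in play. This uses that there are infinitely many cliques. -/
theorem EdgeSim.avoid_none (hG : IsUnionOfCliques G N) {E : Set G.ConnectedComponent}
    (hE : E.Finite) {π : Equiv.Perm (Option G.ConnectedComponent)}
    (hπ : ∀ c ∈ E, π (some c) = some c) (K : Set (Option G.ConnectedComponent)) (hK : K.Finite)
    {i : Fin n} {s t : Fin n → M} (ht : t ∈ Γ.W)
    (hst : ∀ k l, k ≠ i → l ≠ i → EdgeSim G E π (Γ.edge (s k) (s l)) (Γ.edge (t k) (t l))) :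
    ∃ π' : Equiv.Perm (Option G.ConnectedComponent), (∀ c ∈ E, π' (some c) = some c) ∧
      (∀ k l, k ≠ i → l ≠ i → EdgeSim G E π' (Γ.edge (s k) (s l)) (Γ.edge (t k) (t l))) ∧
      ∀ c ∈ K, π' c ≠ none := by
  classical
  have := hG.1
  -- `F` must avoid the fixed cliques, the images of `K`, and the cliques occurring on edges of `t`.
  -- The transposition of `ρ` and `F` then disturbs none of them except `ρ`.
  let B : Set G.ConnectedComponent := E ∪ some ⁻¹' (π '' K) ∪
    some ⁻¹' (Set.range fun p : Fin n × Fin n => cliqueOf G (Γ.label (t p.1) (t p.2)).1)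
  have hB : B.Finite := by
    refine (hE.union ?_).union ?_
    · exact (hK.image _).preimage (Option.some_injective _).injOn
    · exact (Set.finite_range _).preimage (Option.some_injective _).injOn
  obtain ⟨F, hF⟩ := hB.exists_notMem
  simp only [B, Set.mem_union, not_or] at hF
  obtain ⟨⟨hF1, hF2⟩, hF3⟩ := hF
  refine ⟨π.trans (Equiv.swap none (some F)), fun c hc => ?_, fun k l hk hl => ?_,
    fun c hc h => ?_⟩
  · rw [Equiv.trans_apply, hπ c hc, Equiv.swap_apply_of_ne_of_ne (by simp)]
    exact fun h => hF1 (Option.some_injective _ h ▸ hc)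
  · have h1 := hst k l hk hl
    by_cases htt : t k = t l
    · have h2 := h1.eq_none_iff.2 (edge_eq_none.2 htt)
      rw [h2, edge_eq_none.2 htt]
      trivial
    have h2 := mem_W_iff.1 ht k l
    rw [edge_of_ne htt] at h1 h2 ⊢
    cases he : Γ.edge (s k) (s l) with
    | none =>
      rw [he] at h1
      exact h1.elim
    | some p =>
      rw [he] at h1
      refine ⟨h1.1, ?_, h1.2.2⟩
      rw [Equiv.trans_apply, h1.2.1, Equiv.swap_apply_of_ne_of_ne]
      · intro h3
        rw [cliqueOf, Option.map_eq_none_iff] at h3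
        exact h2 (Γ.label (t k) (t l)).2 (congrArg some (Prod.ext h3 rfl))
      · exact fun h3 => hF3 ⟨(k, l), h3⟩
  · refine hF2 ⟨c, hc, ?_⟩
    rw [Equiv.trans_apply] at h
    exact (Equiv.swap none (some F)).injective (h.trans (Equiv.swap_apply_right _ _).symm)

/-- Labels are symmetric, so unordered pairs suffice for the count; ordered ones would double the
bound. -/
theorem card_image_label_le (Γ : LabelledGraph V n M) [DecidableEq M] [DecidableEq V]
    (S : Finset M) : (S.offDiag.image fun p => (Γ.label p.1 p.2).1).card ≤ S.card.choose 2 := by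
  let f : Sym2 M → Option V := Sym2.lift ⟨fun x y => (Γ.label x y).1, fun x y =>
    congrArg Prod.fst (Γ.symm x y)⟩
  have h1 : (S.offDiag.image fun p => (Γ.label p.1 p.2).1) =
      (S.offDiag.image Sym2.mk.uncurry).image f := by
    rw [Finset.image_image]
    rfl
  rw [h1, ← Sym2.card_image_offDiag]
  exact Finset.card_image_le

/-- The extension step of the back-and-forth argument. -/
theorem exists_sim [Nonempty M] (hΓ : Γ.Admissible G) (hext : Γ.ExtensionProperty G)
    (hG : IsUnionOfCliques G N) (hN : n * (n - 1) / 2 ≤ N) {E : Set G.ConnectedComponent}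
    (hE : E.Finite) {π : Equiv.Perm (Option G.ConnectedComponent)}
    (hπ : ∀ c ∈ E, π (some c) = some c) {D : Set (Fin n → M)} (hD : D = Γ.W ∨ D = Set.univ)
    (i : Fin n) {s t : Fin n → M} (ht : t ∈ D)
    (hst : ∀ k l, k ≠ i → l ≠ i → EdgeSim G E π (Γ.edge (s k) (s l)) (Γ.edge (t k) (t l))) :
    ∃ t' ∈ D, ∃ π' : Equiv.Perm (Option G.ConnectedComponent), (∀ c ∈ E, π' (some c) = some c) ∧
      (∀ k, k ≠ i → t' k = t k) ∧
      ∀ k l, EdgeSim G E π' (Γ.edge (s k) (s l)) (Γ.edge (t' k) (t' l)) := by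
  classical
  -- If the new point repeats an old one, its partner repeats the corresponding point.
  by_cases hA : ∃ k, k ≠ i ∧ s i = s k
  · obtain ⟨k₀, hk₀, hsk⟩ := hA
    let f : Fin n → Fin n := Function.update id i k₀
    have hf : ∀ k, f k ≠ i := fun k => by
      by_cases hk : k = i
      · simp [f, hk, hk₀]
      · simp [f, hk]
    have hsf : ∀ k, s (f k) = s k := fun k => by
      by_cases hk : k = i
      · simp [f, hk, hsk]
      · simp [f, hk]
    refine ⟨t ∘ f, ?_, π, hπ, fun k hk => by simp [f, hk], fun k l => ?_⟩
    · rcases hD with rfl | rfl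
      · exact mem_W_comp ht f
      · trivial
    · rw [← hsf k, ← hsf l]
      exact hst _ _ (hf k) (hf l)
  push Not at hA
  let β : Fin n → EdgeLabel V n := fun k => Γ.label (s i) (s k)
  -- For a tuple in `W`, the permutation is first changed so that no new edge is asked to carry `ρ`.
  obtain ⟨π, hπ, hst, hD'⟩ : ∃ π : Equiv.Perm (Option G.ConnectedComponent),
      (∀ c ∈ E, π (some c) = some c) ∧
      (∀ k l, k ≠ i → l ≠ i → EdgeSim G E π (Γ.edge (s k) (s l)) (Γ.edge (t k) (t l))) ∧
      (D = Γ.W → ∀ k, π (cliqueOf G (β k).1) ≠ none) := by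
    rcases hD with rfl | rfl
    · obtain ⟨π', h1, h2, h3⟩ := EdgeSim.avoid_none hG hE hπ
        (Set.range fun k => cliqueOf G (β k).1) (Set.finite_range _) ht hst
      exact ⟨π', h1, h2, fun _ k => h3 _ ⟨k, rfl⟩⟩
    -- The full space might coincide with `W`; in that case the clause on `ρ` is still owed.
    · by_cases hW : (Set.univ : Set (Fin n → M)) = Γ.W
      · obtain ⟨π', h1, h2, h3⟩ := EdgeSim.avoid_none hG hE hπ
          (Set.range fun k => cliqueOf G (β k).1) (Set.finite_range _) (hW ▸ ht) hst
        exact ⟨π', h1, h2, fun _ k => h3 _ ⟨k, rfl⟩⟩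
      · exact ⟨π, hπ, hst, fun h => (hW h).elim⟩
  let S : Finset M := (Finset.univ.erase i).image t
  have hSmem : ∀ k, k ≠ i → t k ∈ S := fun k hk => Finset.mem_image_of_mem _ (by simp [hk])
  have hScard : S.card ≤ n - 1 := Finset.card_image_le.trans (by simp)
  have hSn : S.card < n := by
    have := i.pos
    omega
  let U : Finset (Option V) := S.offDiag.image fun p => (Γ.label p.1 p.2).1
  -- At most `|S| choose 2` nodes label edges inside `S`, and up to `|S|` fresh ones are wanted.
  -- Together this is `(|S| + 1) choose 2 ≤ n choose 2 = n(n-1)/2`, where the bound on `N` is used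
  -- in full.
  have hU : U.card + S.card ≤ N := by
    have h1 := Γ.card_image_label_le S
    have h2 : S.card.choose 2 + S.card ≤ n.choose 2 := by
      have h3 : (S.card + 1).choose 2 ≤ n.choose 2 := Nat.choose_le_choose 2 hSn
      rw [Nat.choose_succ_succ' S.card 1, Nat.choose_one_right, Nat.add_comm] at h3
      simp only [Nat.reduceAdd] at h3
      omega
    rw [Nat.choose_two_right n] at h2
    exact (Nat.add_le_add_right h1 _).trans (h2.trans hN)
  have hker : ∀ k l, k ≠ i → l ≠ i → t k = t l → s k = s l := fun k l hk hl h =>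
    edge_eq_none.1 ((hst k l hk hl).eq_none_iff.2 (edge_eq_none.2 h))
  obtain ⟨r, hr⟩ : ∃ r : M → Fin n, ∀ k, k ≠ i → r (t k) ≠ i ∧ t (r (t k)) = t k := by
    refine ⟨fun y => if h : ∃ k, k ≠ i ∧ t k = y then h.choose else i, fun k hk => ?_⟩
    have h : ∃ l, l ≠ i ∧ t l = t k := ⟨k, hk, rfl⟩
    beta_reduce
    rw [dif_pos h]
    exact h.choose_spec
  have hβr : ∀ k, k ≠ i → β (r (t k)) = β k := fun k hk => by
    show Γ.label _ _ = Γ.label _ _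
    rw [hker _ _ (hr k hk).1 hk (hr k hk).2]
  have := hG.1
  have c₀ : G.ConnectedComponent := Classical.arbitrary _
  have : Nonempty V := ⟨c₀.exists_rep.choose⟩
  -- Fresh nodes in the cliques prescribed by `π`, distinct from each other and from the labels in
  -- use. The default `c₀` stands in where the prescribed clique is that of `ρ`; there `w` is
  -- ignored.
  obtain ⟨w, hw1, hw2⟩ := hG.exists_injOn S
    (fun y => (π (cliqueOf G (β (r y)).1)).getD c₀) U hU
  -- The node of the new edge to `t k`: the same node if its clique is fixed, `ρ` if so prescribed,
  -- and otherwise the fresh node. The alternative `k = i` is never used for an edge.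
  have hnode : ∀ k, ∃ v : Option V, cliqueOf G v = π (cliqueOf G (β k).1) ∧
      (∀ a, G.connectedComponentMk a ∈ E → (β k).1 = some a → v = some a) ∧
      ((∃ a, G.connectedComponentMk a ∈ E ∧ (β k).1 = some a) ∨ v = none ∨ v = some (w (t k))
        ∨ k = i) := by
    intro k
    by_cases h1 : ∃ a, G.connectedComponentMk a ∈ E ∧ (β k).1 = some a
    · obtain ⟨a, ha, hka⟩ := h1
      refine ⟨some a, ?_, fun b _ hb => hka.symm.trans hb, .inl ⟨a, ha, hka⟩⟩
      rw [hka]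
      exact (hπ _ ha).symm
    · have h3 : ∀ v : Option V, ∀ a, G.connectedComponentMk a ∈ E → (β k).1 = some a →
          v = some a := fun v a ha hka => (h1 ⟨a, ha, hka⟩).elim
      cases h2 : π (cliqueOf G (β k).1) with
      | none => exact ⟨none, rfl, h3 _, .inr (.inl rfl)⟩
      | some c =>
        by_cases hk : k = i
        · obtain ⟨a, rfl⟩ := c.exists_rep
          exact ⟨some a, rfl, h3 _, .inr (.inr (.inr hk))⟩
        · refine ⟨some (w (t k)), ?_, h3 _, .inr (.inr (.inl rfl))⟩
          have h4 := (hw2 _ (hSmem k hk)).1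
          rw [hβr k hk, h2] at h4
          exact congrArg some h4
  choose v hv1 hv2 hv3 using hnode
  let b : M → EdgeLabel V n := fun y => (v (r y), (β (r y)).2)
  have htri : ∀ k l, k ≠ i → l ≠ i → t k ≠ t l →
      TriangleOK G (v k, (β k).2) (Γ.label (t k) (t l)) (v l, (β l).2) := by
    intro k l hk hl hkl
    have h1 := hst k l hk hl
    have hskl : s k ≠ s l := fun h => hkl (edge_eq_none.1 (h1.eq_none_iff.1 (edge_eq_none.2 h)))
    rw [edge_of_ne hskl, edge_of_ne hkl] at h1
    have h2 := hΓ (s k) (s i) (s l) (hA k hk).symm hskl (hA l hl)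
    have h2 : TriangleOK G (β k) (Γ.label (s k) (s l)) (β l) := h2.swap.rotate
    have hnotU : some (w (t k)) ∉ U ∧ some (w (t l)) ∉ U :=
      ⟨(hw2 _ (hSmem k hk)).2, (hw2 _ (hSmem l hl)).2⟩
    have hmemU : (Γ.label (t k) (t l)).1 ∈ U := Finset.mem_image.2
      ⟨(t k, t l), Finset.mem_offDiag.2 ⟨hSmem k hk, hSmem l hl, hkl⟩, rfl⟩
    -- Adjacency of a new edge with the edge inside `S` transfers: the cliques correspond, and a
    -- fresh node differs from every label in `U`. In a fixed clique both nodes are unchanged.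
    have hmid : ∀ j, (j = k ∨ j = l) → NodeAdj G (β j).1 (Γ.label (s k) (s l)).1 →
        NodeAdj G (v j) (Γ.label (t k) (t l)).1 := by
      intro j hj h
      have hcl : cliqueOf G (v j) = cliqueOf G (Γ.label (t k) (t l)).1 := by
        rw [hv1, h.cliqueOf_eq, h1.2.1]
      rcases hv3 j with ⟨a, ha, hja⟩ | h3 | h3 | h3
      · rw [hv2 j a ha hja]
        rw [hja] at h
        cases hb : (Γ.label (s k) (s l)).1 with
        | none =>
          rw [hb] at h
          exact h.elim
        | some b =>
          rw [hb] at h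
          have h4 := h.cliqueOf_eq
          have h5 : G.connectedComponentMk a = G.connectedComponentMk b := by
            simpa [cliqueOf] using h4
          rw [h1.2.2 b (h5 ▸ ha) hb]
          exact h
      · exact hG.nodeAdj hcl (.inl h3)
      · refine hG.nodeAdj hcl (.inr fun h4 => ?_)
        rw [h3] at h4
        rcases hj with rfl | rfl
        · exact hnotU.1 (h4 ▸ hmemU)
        · exact hnotU.2 (h4 ▸ hmemU)
      · rcases hj with rfl | rfl
        · exact (hk h3).elim
        · exact (hl h3).elim
    rw [triangleOK_iff] at h2 ⊢
    intro h3 h4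
    rcases h2 (h3.trans h1.1.symm) (h1.1.trans h4) with h5 | h5 | h5
    · exact .inl (hmid k (.inl rfl) h5)
    · refine .inr (.inl ?_)
      have hcl : cliqueOf G (v k) = cliqueOf G (v l) := by rw [hv1, hv1, h5.cliqueOf_eq]
      show NodeAdj G (v k) (v l)
      have hEE : ∀ a, G.connectedComponentMk a ∈ E → ((β k).1 = some a ∨ (β l).1 = some a) →
          NodeAdj G (v k) (v l) := by
        intro a ha h6
        cases hbk : (β k).1 with
        | none =>
          cases hbl : (β l).1 with
          | none => simp [hbk, hbl] at h6
          | some d =>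
            rw [hbk, hbl] at h5
            exact h5.elim
        | some c =>
          cases hbl : (β l).1 with
          | none =>
            rw [hbk, hbl] at h5
            exact h5.elim
          | some d =>
            rw [hbk, hbl] at h5 h6
            have h7 : G.connectedComponentMk c = G.connectedComponentMk d := by
              simpa [cliqueOf] using h5.cliqueOf_eq
            have h8 : G.connectedComponentMk c ∈ E ∧ G.connectedComponentMk d ∈ E := by
              rcases h6 with h6 | h6
              · rw [← h7, Option.some_injective _ h6]
                exact ⟨ha, ha⟩
              · rw [h7, Option.some_injective _ h6]
                exact ⟨ha, ha⟩
            rw [hv2 k c h8.1 hbk, hv2 l d h8.2 hbl]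
            exact h5
      rcases hv3 k with ⟨a, ha, hka⟩ | h6 | h6 | h6
      · exact hEE a ha (.inl hka)
      · exact hG.nodeAdj hcl (.inl h6)
      · rcases hv3 l with ⟨a, ha, hla⟩ | h7 | h7 | h7
        · exact hEE a ha (.inr hla)
        · exact (hG.nodeAdj hcl.symm (.inl h7)).symm
        -- Two fresh nodes in one clique are adjacent because `w` is injective on `S`.
        · refine hG.nodeAdj hcl (.inr fun h8 => hkl ?_)
          rw [h6, h7] at h8
          exact hw1 (hSmem k hk) (hSmem l hl) (Option.some_injective _ h8)
        · exact (hl h7).elim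
      · exact (hk h6).elim
    · exact .inr (.inr (hmid l (.inr rfl) h5.symm).symm)
  obtain ⟨x, hxS, hx⟩ := hext.exists_label hΓ S hSn b (by
    intro y hy z hz hyz
    obtain ⟨k, hk, rfl⟩ := Finset.mem_image.1 hy
    obtain ⟨l, hl, rfl⟩ := Finset.mem_image.1 hz
    have hk : k ≠ i := by simpa using hk
    have hl : l ≠ i := by simpa using hl
    have := htri _ _ (hr k hk).1 (hr l hl).1 (by rwa [(hr k hk).2, (hr l hl).2])
    rwa [(hr k hk).2, (hr l hl).2] at this)
  have hxt : ∀ k, k ≠ i → x ≠ t k ∧ Γ.edge x (t k) = some (v (r (t k)), (β (r (t k))).2) := by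
    intro k hk
    have h1 : x ≠ t k := fun h => hxS (h ▸ hSmem k hk)
    exact ⟨h1, by rw [edge_of_ne h1, hx _ (hSmem k hk)]⟩
  have hsim : ∀ k, k ≠ i → EdgeSim G E π (Γ.edge (s i) (s k)) (Γ.edge x (t k)) := by
    intro k hk
    rw [edge_of_ne (hA k hk), (hxt k hk).2]
    have h1 := hβr k hk
    refine ⟨?_, ?_, ?_⟩
    · show (β k).2 = _
      rw [h1]
    · show π (cliqueOf G (β k).1) = _
      rw [hv1, h1]
    · intro a ha h2
      exact hv2 _ a ha (by rw [h1]; exact h2)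
  refine ⟨Function.update t i x, ?_, π, hπ, fun k hk => Function.update_of_ne hk _ _,
    fun k l => ?_⟩
  · rcases hD with rfl | rfl
    · have hne : ∀ k, k ≠ i → ∀ c, Γ.edge x (t k) ≠ some (none, c) := fun k hk c h => by
        rw [(hxt k hk).2] at h
        have h1 : v (r (t k)) = none := congrArg Prod.fst (Option.some_injective _ h)
        apply hD' rfl (r (t k))
        rw [← hv1, h1]
        rfl
      refine mem_W_iff.2 fun k l c => ?_
      by_cases hk : k = i <;> by_cases hl : l = i
      · simp [hk, hl, edge_self]
      · subst hk
        rw [Function.update_self, Function.update_of_ne hl]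
        exact hne l hl c
      · subst hl
        rw [Function.update_self, Function.update_of_ne hk, edge_comm]
        exact hne k hk c
      · rw [Function.update_of_ne hk, Function.update_of_ne hl]
        exact mem_W_iff.1 ht k l c
    · trivial
  · by_cases hk : k = i <;> by_cases hl : l = i
    · rw [hk, hl, edge_self, edge_self]
      trivial
    · subst hk
      rw [Function.update_self, Function.update_of_ne hl]
      exact hsim l hl
    · subst hl
      rw [Function.update_self, Function.update_of_ne hk, edge_comm, edge_comm (t k)]
      exact hsim k hk
    · rw [Function.update_of_ne hk, Function.update_of_ne hl]
      exact hst k l hk hl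

end LabelledGraph

/-! ## The algebra of definable relations is representable -/

namespace Fml

variable {V : Type u} {n : ℕ}

/-- Replace the atomic formulas with a label `(ρ, i)` by falsity. -/
def eraseRho : Fml V n → Fml V n
  | .fls => .fls
  | .eq i j => .eq i j
  | .rel (none, _) _ _ => .fls
  | .rel (some a, c) i j => .rel (some a, c) i j
  | .or φ ψ => .or φ.eraseRho ψ.eraseRho
  | .not φ => .not φ.eraseRho
  | .ex i φ => .ex i φ.eraseRho

/-- The cliques of the nodes which occur in a formula. -/
def cliques (G : SimpleGraph V) : Fml V n → Set G.ConnectedComponent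
  | .fls => ∅
  | .eq _ _ => ∅
  | .rel (none, _) _ _ => ∅
  | .rel (some a, _) _ _ => {G.connectedComponentMk a}
  | .or φ ψ => φ.cliques G ∪ ψ.cliques G
  | .not φ => φ.cliques G
  | .ex _ φ => φ.cliques G

theorem finite_cliques (G : SimpleGraph V) (φ : Fml V n) : (φ.cliques G).Finite := by
  induction φ with
  | fls => exact Set.finite_empty
  | eq i j => exact Set.finite_empty
  | rel l i j =>
    obtain ⟨_ | a, c⟩ := l
    · exact Set.finite_empty
    · exact Set.finite_singleton _
  | or φ ψ ih1 ih2 => exact ih1.union ih2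
  | not φ ih => exact ih
  | ex i φ ih => exact ih

end Fml

namespace LabelledGraph

variable {V : Type u} {n N : ℕ} {M : Type u} {Γ : LabelledGraph V n M} {G : SimpleGraph V}

/-- No tuple of `W` has a `ρ`-edge, so the erased atoms were false there anyway. In the square
interpretation the erasure does matter. -/
theorem sem_eraseRho (φ : Fml V n) : Γ.sem Γ.W φ.eraseRho = Γ.sem Γ.W φ := by
  induction φ with
  | fls => rfl
  | eq i j => rfl
  | rel l i j =>
    obtain ⟨_ | a, c⟩ := l
    · refine Set.ext fun s => ⟨fun h => h.elim, fun h => ?_⟩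
      exact (mem_W_iff.1 s.2 i j c (edge_eq_some.2 h)).elim
    · rfl
  | or φ ψ ih1 ih2 => simp only [Fml.eraseRho, sem, ih1, ih2]
  | not φ ih => simp only [Fml.eraseRho, sem, ih]
  | ex i φ ih => simp only [Fml.eraseRho, sem, ih]

/-- Tuples with similar edges satisfy the same formulas. -/
theorem mem_sem_of_sim [Nonempty M] (hΓ : Γ.Admissible G) (hext : Γ.ExtensionProperty G)
    (hG : IsUnionOfCliques G N) (hN : n * (n - 1) / 2 ≤ N) {E : Set G.ConnectedComponent}
    (hE : E.Finite) (φ : Fml V n) (hφ : φ.cliques G ⊆ E) {D D' : Set (Fin n → M)}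
    (hD : D = Γ.W ∨ D = Set.univ) (hD' : D' = Γ.W ∨ D' = Set.univ)
    {π : Equiv.Perm (Option G.ConnectedComponent)} (hπ : ∀ c ∈ E, π (some c) = some c)
    {s : D} {t : D'}
    (hst : ∀ k l, EdgeSim G E π (Γ.edge (s.1 k) (s.1 l)) (Γ.edge (t.1 k) (t.1 l)))
    (hs : s ∈ Γ.sem D φ.eraseRho) : t ∈ Γ.sem D' φ.eraseRho := by
  induction φ generalizing D D' π with
  | fls => exact hs
  | eq i j => exact edge_eq_none.1 ((hst i j).eq_none_iff.1 (edge_eq_none.2 hs))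
  | rel l i j =>
    obtain ⟨_ | a, c⟩ := l
    · exact hs
    · exact edge_eq_some.1 ((hst i j).eq_some (hφ rfl) (edge_eq_some.2 hs))
  | or φ ψ ih1 ih2 =>
    exact hs.imp (ih1 (Set.subset_union_left.trans hφ) hD hD' hπ hst)
      (ih2 (Set.subset_union_right.trans hφ) hD hD' hπ hst)
  | not φ ih =>
    -- Negation exchanges the two tuples, their units and the direction of `π`. This is why both
    -- units are allowed on either side.
    refine fun ht => hs (ih hφ hD' hD (π := π.symm) (fun c hc => ?_)
      (fun k l => (hst k l).symm hπ) ht)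
    rw [Equiv.symm_apply_eq, hπ c hc]
  | ex i φ ih =>
    obtain ⟨s', hs', hss'⟩ := hs
    obtain ⟨t', ht', π', hπ', htt', hst'⟩ := exists_sim hΓ hext hG hN hE hπ hD' i (s := s'.1)
      t.2 fun k l hk hl => by
        rw [hss' k hk, hss' l hl]
        exact hst k l
    exact ⟨⟨t', ht'⟩, ih hφ hD hD' hπ' hst' hs', htt'⟩

/-- Start from a constant tuple, which lies in `W`, and bring in the coordinates of `s` one at a
time by `exists_sim`. -/
theorem exists_sim_mem_W [Nonempty M] (hΓ : Γ.Admissible G) (hext : Γ.ExtensionProperty G)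
    (hG : IsUnionOfCliques G N) (hN : n * (n - 1) / 2 ≤ N) {E : Set G.ConnectedComponent}
    (hE : E.Finite) (s : Fin n → M) :
    ∃ t ∈ Γ.W, ∃ π : Equiv.Perm (Option G.ConnectedComponent), (∀ c ∈ E, π (some c) = some c) ∧
      ∀ k l, EdgeSim G E π (Γ.edge (s k) (s l)) (Γ.edge (t k) (t l)) := by
  classical
  let x₀ : M := Classical.arbitrary M
  suffices h : ∀ I : Finset (Fin n), ∃ t ∈ Γ.W, ∃ π : Equiv.Perm (Option G.ConnectedComponent),
      (∀ c ∈ E, π (some c) = some c) ∧ ∀ k l,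
        EdgeSim G E π (Γ.edge (if k ∈ I then s k else x₀) (if l ∈ I then s l else x₀))
          (Γ.edge (t k) (t l)) by
    simpa using h Finset.univ
  intro I
  induction I using Finset.induction_on with
  | empty =>
    refine ⟨fun _ => x₀, mem_W_iff.2 fun k l c => by simp [edge_self], 1, fun _ _ => rfl,
      fun k l => ?_⟩
    simp only [Finset.notMem_empty, if_false, edge_self]
    trivial
  | insert i I hi ih =>
    obtain ⟨t, ht, π, hπ, hst⟩ := ih
    obtain ⟨t', ht', π', hπ', -, h⟩ := exists_sim hΓ hext hG hN hE hπ (.inl rfl) i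
      (s := fun k => if k ∈ insert i I then s k else x₀) ht fun k l hk hl => by
        simpa only [Finset.mem_insert, hk, hl, false_or] using hst k l
    exact ⟨t', ht', π', hπ', h⟩

/-- Each tuple of either unit has a similar one in the other, relative to the cliques of both
formulas. A tuple separating the formulas in one semantics thus yields one in the other. -/
theorem sem_univ_eq_iff [Nonempty M] (hΓ : Γ.Admissible G) (hext : Γ.ExtensionProperty G)
    (hG : IsUnionOfCliques G N) (hN : n * (n - 1) / 2 ≤ N) (φ ψ : Fml V n) :
    Γ.sem Set.univ φ.eraseRho = Γ.sem Set.univ ψ.eraseRho ↔ Γ.sem Γ.W φ = Γ.sem Γ.W ψ := by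
  rw [← sem_eraseRho φ, ← sem_eraseRho ψ]
  let E := φ.cliques G ∪ ψ.cliques G
  have hE : E.Finite := (φ.finite_cliques G).union (ψ.finite_cliques G)
  have key : ∀ {D D' : Set (Fin n → M)}, (D = Γ.W ∨ D = Set.univ) → (D' = Γ.W ∨ D' = Set.univ) →
      (∀ t ∈ D', ∃ s ∈ D, ∃ π : Equiv.Perm (Option G.ConnectedComponent),
        (∀ c ∈ E, π (some c) = some c) ∧
        ∀ k l, EdgeSim G E π (Γ.edge (t k) (t l)) (Γ.edge (s k) (s l))) →
      Γ.sem D φ.eraseRho = Γ.sem D ψ.eraseRho → Γ.sem D' φ.eraseRho = Γ.sem D' ψ.eraseRho := by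
    intro D D' hD hD' h heq
    ext t
    obtain ⟨s, hs, π, hπ, hts⟩ := h t.1 t.2
    have hπ' : ∀ c ∈ E, π.symm (some c) = some c := fun c hc => by
      rw [Equiv.symm_apply_eq, hπ c hc]
    have h1 : ∀ χ : Fml V n, χ.cliques G ⊆ E →
        (t ∈ Γ.sem D' χ.eraseRho ↔ (⟨s, hs⟩ : D) ∈ Γ.sem D χ.eraseRho) := fun χ hχ =>
      ⟨mem_sem_of_sim hΓ hext hG hN hE χ hχ hD' hD hπ hts,
        mem_sem_of_sim hΓ hext hG hN hE χ hχ hD hD' hπ' fun k l => (hts k l).symm hπ⟩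
    rw [h1 φ Set.subset_union_left, h1 ψ Set.subset_union_right, heq]
  constructor
  · refine key (.inr rfl) (.inl rfl) fun t _ => ⟨t, trivial, 1, fun _ _ => rfl, fun k l => ?_⟩
    cases Γ.edge (t k) (t l) with
    | none => trivial
    | some p => exact ⟨rfl, rfl, fun _ _ h => h⟩
  · exact key (.inl rfl) (.inr rfl) fun t _ => exists_sim_mem_W hΓ hext hG hN hE t

/-- A single square with base `M` suffices. The formula chosen for an element is immaterial by
`sem_univ_eq_iff`, and the same equivalence gives injectivity. -/
theorem representable_setAlg [Nonempty M] (hΓ : Γ.Admissible G) (hext : Γ.ExtensionProperty G)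
    (hG : IsUnionOfCliques G N) (hN : n * (n - 1) / 2 ≤ N) :
    (Γ.setAlg Γ.W).Representable := by
  have key := fun φ ψ => sem_univ_eq_iff hΓ hext hG hN φ ψ
  let F : (Γ.setAlg Γ.W).carrier → Fml V n := fun a => a.2.choose
  have hF : ∀ a, Γ.sem Γ.W (F a) = pts a := fun a => a.2.choose_spec
  refine ⟨PUnit, fun _ => M, fun _ => inferInstance,
    fun a _ => Γ.sem Set.univ (F a).eraseRho, ⟨?_, ?_, ?_, ?_⟩, ?_⟩
  · intro a b
    refine funext fun _ => (key _ (.or (F a) (F b))).2 ?_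
    simp only [hF, sem]
    rfl
  · intro a
    refine funext fun _ => (key _ (.not (F a))).2 ?_
    simp only [hF, sem]
    rfl
  · intro i a
    refine funext fun _ => (key _ (.ex i (F a))).2 ?_
    simp only [hF, sem]
    rfl
  · intro i j
    refine funext fun _ => (key _ (.eq i j)).2 ?_
    simp only [hF, sem]
    rfl
  · intro a b hab
    have h1 := (key _ _).1 (congrFun hab PUnit.unit)
    rw [hF, hF] at h1
    exact pts_injective h1

end LabelledGraph

/-! ## The relation algebra -/

section LocallyFinite

variable {V : Type u} {G : SimpleGraph V} {N : ℕ}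

theorem IsUnionOfCliques.finite_adj (hG : IsUnionOfCliques G N) (hN : 0 < N) (a : V) :
    {c | G.Adj c a}.Finite := by
  have hfin : (G.connectedComponentMk a).supp.Finite :=
    Set.finite_of_ncard_pos (by rw [(hG.2 _).2]; exact hN)
  exact hfin.subset fun c hc => SimpleGraph.ConnectedComponent.sound (SimpleGraph.Adj.reachable hc)

theorem IsUnionOfCliques.exists_adj (hG : IsUnionOfCliques G N) (hN : 1 < N) (a : V) :
    ∃ c, G.Adj a c := by
  obtain ⟨c, hc, hca⟩ := hG.exists_mem_supp (G.connectedComponentMk a) {some a} (by simpa using hN)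
  exact ⟨c, hG.adj (by simpa [eq_comm] using hca) hc.symm⟩

theorem IsUnionOfCliques.infinite (hG : IsUnionOfCliques G N) : Infinite V := by
  have := hG.1
  exact Infinite.of_surjective G.connectedComponentMk fun c => c.exists_rep

/-- The nodes that form a good triangle with some elements of `A` and `B`. -/
def goodNodes (G : SimpleGraph V) (A B : Set V) : Set V :=
  {c | ∃ a ∈ A, ∃ b ∈ B, G.Adj c a ∨ G.Adj c b ∨ G.Adj a b}

theorem goodNodes_comm (A B : Set V) : goodNodes G A B = goodNodes G B A := by
  ext c
  constructor
  all_goals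
    rintro ⟨a, ha, b, hb, h | h | h⟩
    · exact ⟨b, hb, a, ha, .inr (.inl h)⟩
    · exact ⟨b, hb, a, ha, .inl h⟩
    · exact ⟨b, hb, a, ha, .inr (.inr h.symm)⟩

/-- Every node has a neighbour because `N > 1`. A node that is not good has its neighbour in the
finite set `Aᶜ`, and each node has only finitely many neighbours. -/
theorem IsUnionOfCliques.compl_goodNodes_finite (hG : IsUnionOfCliques G N) (hN : 1 < N)
    {A B : Set V} (hA : Aᶜ.Finite) (hB : B.Nonempty) : (goodNodes G A B)ᶜ.Finite := by
  obtain ⟨b, hb⟩ := hB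
  refine (hA.biUnion fun a _ => hG.finite_adj (by omega) a).subset fun c hc => ?_
  obtain ⟨a, ha⟩ := hG.exists_adj hN c
  exact Set.mem_biUnion (show a ∈ Aᶜ from fun h => hc ⟨a, h, b, hb, .inl ha⟩) ha

theorem IsUnionOfCliques.goodNodes_finite (hG : IsUnionOfCliques G N) (hN : 1 < N)
    {A B : Set V} (hA : A.Finite) (hB : B.Finite) (h : ∀ a ∈ A, ∀ b ∈ B, ¬ G.Adj a b) :
    (goodNodes G A B).Finite := by
  refine ((hA.biUnion fun a _ => hG.finite_adj (by omega) a).union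
    (hB.biUnion fun b _ => hG.finite_adj (by omega) b)).subset ?_
  rintro c ⟨a, ha, b, hb, hc | hc | hc⟩
  · exact .inl (Set.mem_biUnion ha hc)
  · exact .inr (Set.mem_biUnion hb hc)
  · exact (h a ha b hb hc).elim

theorem IsUnionOfCliques.exists_adj_of_cofinite (hG : IsUnionOfCliques G N) (hN : 1 < N)
    {A B : Set V} (hA : Aᶜ.Finite) (hB : Bᶜ.Finite) : ∃ a ∈ A, ∃ b ∈ B, G.Adj a b := by
  have := hG.infinite
  by_contra! h
  refine Set.infinite_univ (α := V) ?_
  rw [← Set.union_compl_self A]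
  refine Set.Finite.union ((hB.biUnion fun a _ => hG.finite_adj (by omega) a).subset
    fun a ha => ?_) hA
  obtain ⟨c, hc⟩ := hG.exists_adj hN a
  exact Set.mem_biUnion (show c ∈ Bᶜ from fun h' => h a ha c h' hc) hc

theorem compl_finite_or_of_union [Infinite V] {A B : Set V} (hA : A.Finite ∨ Aᶜ.Finite)
    (hB : B.Finite ∨ Bᶜ.Finite) (h : (A ∪ B)ᶜ.Finite) : Aᶜ.Finite ∨ Bᶜ.Finite := by
  by_contra! hc
  exact Set.infinite_univ (α := V) (Set.union_compl_self (A ∪ B) ▸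
    ((hA.resolve_right hc.1).union (hB.resolve_right hc.2)).union h)

end LocallyFinite

/-! ### Tame sets of atoms and the limit reading of `ρ` -/

/-- The atoms of the relation algebra: the identity and the labels `(a, i)` with `a ∈ G`. -/
abbrev RAtom (V : Type u) (n : ℕ) : Type u := Option (V × Fin n)

namespace RAtom

variable {V : Type u} {n N : ℕ} {G : SimpleGraph V}

/-- The edge that corresponds to an atom. -/
def toEdge : RAtom V n → Option (EdgeLabel V n) := Option.map fun p => (some p.1, p.2)

theorem toEdge_injective : Function.Injective (toEdge : RAtom V n → _) :=
  Option.map_injective fun p q h => by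
    simp only [Prod.mk.injEq, Option.some.injEq] at h
    exact Prod.ext h.1 h.2

theorem toEdge_none : toEdge (none : RAtom V n) = none := rfl

theorem toEdge_some (a : V) (i : Fin n) : toEdge (some (a, i)) = some (some a, i) := rfl

theorem toEdge_eq_none {p : RAtom V n} : toEdge p = none ↔ p = none := by
  cases p <;> simp [toEdge]

theorem toEdge_ne_rho (p : RAtom V n) (c : Fin n) : toEdge p ≠ some (none, c) := by
  cases p <;> simp [toEdge]

/-- Composition of sets of atoms. -/
def compSet (G : SimpleGraph V) (X Y : Set (RAtom V n)) : Set (RAtom V n) :=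
  {r | ∃ p ∈ X, ∃ q ∈ Y, Consistent G (toEdge r) (toEdge p) (toEdge q)}

/-- The nodes `a` with `(a, i) ∈ X`. -/
def slice (X : Set (RAtom V n)) (i : Fin n) : Set V := {a | some (a, i) ∈ X}

/-- In each colour the set is finite or cofinite. -/
def IsTame (X : Set (RAtom V n)) : Prop := ∀ i, (slice X i).Finite ∨ (slice X i)ᶜ.Finite

theorem consistent_some {c a b : V} {l i j : Fin n} :
    Consistent G (toEdge (some (c, l))) (toEdge (some (a, i))) (toEdge (some (b, j))) ↔
      (l = i → i = j → G.Adj c a ∨ G.Adj c b ∨ G.Adj a b) :=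
  triangleOK_iff G (some c, l) (some a, i) (some b, j)

/-- An atom of colour `l` enters a composition through an identity factor, through a triangle that
is not monochromatic (then the whole colour enters), or through a monochromatic triangle with an
adjacency. Tameness can be checked on these sources separately. -/
theorem mem_slice_compSet {X Y : Set (RAtom V n)} {l : Fin n} {c : V} :
    c ∈ slice (compSet G X Y) l ↔ (none ∈ X ∧ c ∈ slice Y l) ∨ (none ∈ Y ∧ c ∈ slice X l) ∨
      (∃ i j, ¬ (l = i ∧ i = j) ∧ (slice X i).Nonempty ∧ (slice Y j).Nonempty) ∨
      c ∈ goodNodes G (slice X l) (slice Y l) := by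
  constructor
  · rintro ⟨_ | ⟨a, i⟩, hp, _ | ⟨b, j⟩, hq, h⟩
    · simp [toEdge, Consistent] at h
    · rw [toEdge_none, consistent_none_mid] at h
      exact .inl ⟨hp, show some (c, l) ∈ Y from toEdge_injective h ▸ hq⟩
    · rw [toEdge_none, consistent_none_right] at h
      exact .inr (.inl ⟨hq, show some (c, l) ∈ X from toEdge_injective h ▸ hp⟩)
    · by_cases hc : l = i ∧ i = j
      · obtain ⟨rfl, rfl⟩ := hc
        exact .inr (.inr (.inr ⟨a, hp, b, hq, consistent_some.1 h rfl rfl⟩))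
      · exact .inr (.inr (.inl ⟨i, j, hc, ⟨a, hp⟩, ⟨b, hq⟩⟩))
  · rintro (⟨h1, h2⟩ | ⟨h1, h2⟩ | ⟨i, j, hc, ⟨a, ha⟩, ⟨b, hb⟩⟩ | ⟨a, ha, b, hb, h⟩)
    · exact ⟨_, h1, _, h2, consistent_none_mid.2 rfl⟩
    · exact ⟨_, h2, _, h1, consistent_none_right.2 rfl⟩
    · exact ⟨_, ha, _, hb, consistent_some.2 fun h1 h2 => (hc ⟨h1, h2⟩).elim⟩
    · exact ⟨_, ha, _, hb, consistent_some.2 fun _ _ => h⟩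

theorem IsTame.goodNodes (hG : IsUnionOfCliques G N) (hN : 1 < N) {X Y : Set (RAtom V n)}
    (hX : IsTame X) (hY : IsTame Y) (l : Fin n) :
    (goodNodes G (slice X l) (slice Y l)).Finite ∨
      (goodNodes G (slice X l) (slice Y l))ᶜ.Finite := by
  by_cases hX0 : (slice X l).Nonempty
  · by_cases hY0 : (slice Y l).Nonempty
    · rcases hX l with h1 | h1
      · rcases hY l with h2 | h2
        · by_cases hadj : ∀ a ∈ slice X l, ∀ b ∈ slice Y l, ¬ G.Adj a b
          · exact .inl (hG.goodNodes_finite hN h1 h2 hadj)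
          · push Not at hadj
            obtain ⟨a, ha, b, hb, h⟩ := hadj
            refine .inr (Set.finite_empty.subset fun c hc => (hc ⟨a, ha, b, hb, ?_⟩).elim)
            exact .inr (.inr h)
        · rw [goodNodes_comm]
          exact .inr (hG.compl_goodNodes_finite hN h2 hX0)
      · exact .inr (hG.compl_goodNodes_finite hN h1 hY0)
    · exact .inl (Set.finite_empty.subset fun c ⟨_, _, b, hb, _⟩ => (hY0 ⟨b, hb⟩).elim)
  · exact .inl (Set.finite_empty.subset fun c ⟨a, ha, _⟩ => (hX0 ⟨a, ha⟩).elim)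

theorem finite_or_union {A B : Set V} (hA : A.Finite ∨ Aᶜ.Finite) (hB : B.Finite ∨ Bᶜ.Finite) :
    (A ∪ B).Finite ∨ (A ∪ B)ᶜ.Finite := by
  rcases hA with hA | hA
  · rcases hB with hB | hB
    · exact .inl (hA.union hB)
    · exact .inr (hB.subset (Set.compl_subset_compl.2 Set.subset_union_right))
  · exact .inr (hA.subset (Set.compl_subset_compl.2 Set.subset_union_left))

theorem finite_or_and {A : Set V} (hA : A.Finite ∨ Aᶜ.Finite) (P : Prop) :
    {c | P ∧ c ∈ A}.Finite ∨ {c | P ∧ c ∈ A}ᶜ.Finite := by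
  by_cases hP : P <;> simp [hP, hA]

theorem IsTame.compSet (hG : IsUnionOfCliques G N) (hN : 1 < N) {X Y : Set (RAtom V n)}
    (hX : IsTame X) (hY : IsTame Y) : IsTame (compSet G X Y) := by
  intro l
  have : slice (RAtom.compSet G X Y) l = {c | none ∈ X ∧ c ∈ slice Y l} ∪
      ({c | none ∈ Y ∧ c ∈ slice X l} ∪ ({_c : V | ∃ i j : Fin n, ¬ (l = i ∧ i = j) ∧
        (slice X i).Nonempty ∧ (slice Y j).Nonempty} ∪
        _root_.goodNodes G (slice X l) (slice Y l))) :=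
    Set.ext fun c => mem_slice_compSet
  rw [this]
  refine finite_or_union (finite_or_and (hY l) _) (finite_or_union (finite_or_and (hX l) _)
    (finite_or_union ?_ (hX.goodNodes hG hN hY l)))
  by_cases h : ∃ i j : Fin n, ¬ (l = i ∧ i = j) ∧ (slice X i).Nonempty ∧ (slice Y j).Nonempty
  · exact .inr (Set.finite_empty.subset fun c hc => (hc h).elim)
  · exact .inl (Set.finite_empty.subset fun c hc => (h hc).elim)

theorem IsTame.union {X Y : Set (RAtom V n)} (hX : IsTame X) (hY : IsTame Y) :
    IsTame (X ∪ Y) := fun l => finite_or_union (hX l) (hY l)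

theorem IsTame.compl {X : Set (RAtom V n)} (hX : IsTame X) : IsTame Xᶜ := fun l => by
  have : slice Xᶜ l = (slice X l)ᶜ := rfl
  rw [this, compl_compl]
  exact (hX l).symm

theorem isTame_singleton (p : RAtom V n) : IsTame {p} := fun l => by
  refine .inl (Set.Subsingleton.finite fun a ha b hb => ?_)
  have h : (some (a, l) : RAtom V n) = some (b, l) :=
    (Set.mem_singleton_iff.1 ha).trans (Set.mem_singleton_iff.1 hb).symm
  simpa using h

/-- The Boolean algebra of tame sets of atoms. -/
def tame (V : Type u) (n : ℕ) : BooleanSubalgebra (Set (RAtom V n)) where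
  carrier := {X | IsTame X}
  supClosed' _ hX _ hY := hX.union hY
  infClosed' X hX Y hY := by
    have := (hX.compl.union hY.compl).compl
    rwa [Set.compl_union, compl_compl, compl_compl] at this
  compl_mem' hX := hX.compl
  bot_mem' _ := .inl Set.finite_empty

/-- The edges between points of the homogeneous graph that are assigned to a set of atoms:
an edge labelled by `ρ` counts as a limit of the edges of its colour. -/
def star (X : Set (RAtom V n)) : Option (EdgeLabel V n) → Prop
  | none => none ∈ X
  | some (some a, i) => some (a, i) ∈ X
  | some (none, i) => (slice X i)ᶜ.Finite

theorem star_toEdge {X : Set (RAtom V n)} {p : RAtom V n} : star X (toEdge p) ↔ p ∈ X := by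
  rcases p with _ | ⟨a, i⟩ <;> rfl

theorem exists_toEdge_or (e : Option (EdgeLabel V n)) :
    (∃ p, e = toEdge p) ∨ ∃ i, e = some (none, i) := by
  rcases e with _ | ⟨_ | a, i⟩
  · exact .inl ⟨none, rfl⟩
  · exact .inr ⟨i, rfl⟩
  · exact .inl ⟨some (a, i), rfl⟩

/-- Among finite or cofinite subsets of an infinite set, the cofinite ones form an ultrafilter. A
`ρ`-edge is the limit along it. -/
theorem star_union [Infinite V] {X Y : Set (RAtom V n)} (hX : IsTame X) (hY : IsTame Y)
    (e : Option (EdgeLabel V n)) : star (X ∪ Y) e ↔ star X e ∨ star Y e := by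
  rcases exists_toEdge_or e with ⟨p, rfl⟩ | ⟨i, rfl⟩
  · simp only [star_toEdge, Set.mem_union]
  · refine ⟨compl_finite_or_of_union (hX i) (hY i), ?_⟩
    rintro (h | h)
    · exact h.subset (Set.compl_subset_compl.2 fun _ => Or.inl)
    · exact h.subset (Set.compl_subset_compl.2 fun _ => Or.inr)

theorem star_compl [Infinite V] {X : Set (RAtom V n)} (hX : IsTame X)
    (e : Option (EdgeLabel V n)) : star Xᶜ e ↔ ¬ star X e := by
  rcases exists_toEdge_or e with ⟨p, rfl⟩ | ⟨i, rfl⟩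
  · simp only [star_toEdge, Set.mem_compl_iff]
  · show (slice X i)ᶜᶜ.Finite ↔ ¬ (slice X i)ᶜ.Finite
    rw [compl_compl]
    refine ⟨fun h h' => ?_, (hX i).resolve_right⟩
    exact Set.infinite_univ (α := V) (Set.union_compl_self (slice X i) ▸ h.union h')

theorem nonempty_of_compl_finite [Infinite V] {A : Set V} (h : Aᶜ.Finite) : A.Nonempty := by
  rw [Set.nonempty_iff_ne_empty]
  rintro rfl
  exact Set.infinite_univ (α := V) (by simpa using h)

/-- For a `ρ`-edge, suppose no pair of legs fits. Then every source of atoms of this colour in the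
composition is finite, while the slice is cofinite, contradicting that `V` is infinite. -/
theorem exists_of_star_compSet (hG : IsUnionOfCliques G N) (hN : 1 < N) {X Y : Set (RAtom V n)}
    (hX : IsTame X) (hY : IsTame Y) {e : Option (EdgeLabel V n)}
    (he : star (compSet G X Y) e) : ∃ q r, star X q ∧ star Y r ∧ Consistent G e q r := by
  have := hG.infinite
  rcases exists_toEdge_or e with ⟨p, rfl⟩ | ⟨l, rfl⟩
  · obtain ⟨q, hq, r, hr, h⟩ := star_toEdge.1 he
    exact ⟨_, _, star_toEdge.2 hq, star_toEdge.2 hr, h⟩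
  have he : (slice (compSet G X Y) l)ᶜ.Finite := he
  by_contra! hno
  refine Set.infinite_univ (α := V) ?_
  rw [← Set.union_compl_self (slice (compSet G X Y) l)]
  refine Set.Finite.union ?_ he
  have hYl : none ∈ X → (slice Y l).Finite := fun h => (hY l).resolve_right fun h' =>
    hno none (some (none, l)) h h' (consistent_none_mid.2 rfl)
  have hXl : none ∈ Y → (slice X l).Finite := fun h => (hX l).resolve_right fun h' =>
    hno (some (none, l)) none h' h (consistent_none_right.2 rfl)
  have hgood : (goodNodes G (slice X l) (slice Y l)).Finite := by
    by_cases hX0 : (slice X l).Nonempty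
    · by_cases hY0 : (slice Y l).Nonempty
      · obtain ⟨a, ha⟩ := hX0
        obtain ⟨b, hb⟩ := hY0
        refine hG.goodNodes_finite hN ((hX l).resolve_right fun h' => ?_)
          ((hY l).resolve_right fun h' => ?_) fun a ha b hb hab => ?_
        · refine hno (some (none, l)) (some (some b, l)) h' hb ?_
          exact (triangleOK_iff _ _ _ _).2 fun _ _ => .inl trivial
        · refine hno (some (some a, l)) (some (none, l)) ha h' ?_
          exact (triangleOK_iff _ _ _ _).2 fun _ _ => .inr (.inl trivial)
        · refine hno (some (some a, l)) (some (some b, l)) ha hb ?_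
          exact (triangleOK_iff _ _ _ _).2 fun _ _ => .inr (.inr hab)
      · exact Set.finite_empty.subset fun c ⟨_, _, b, hb, _⟩ => (hY0 ⟨b, hb⟩).elim
    · exact Set.finite_empty.subset fun c ⟨a, ha, _⟩ => (hX0 ⟨a, ha⟩).elim
  have h1 : {c | none ∈ X ∧ c ∈ slice Y l}.Finite := by
    by_cases h : none ∈ X
    · exact (hYl h).subset fun c hc => hc.2
    · exact Set.finite_empty.subset fun c hc => (h hc.1).elim
  have h2 : {c | none ∈ Y ∧ c ∈ slice X l}.Finite := by
    by_cases h : none ∈ Y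
    · exact (hXl h).subset fun c hc => hc.2
    · exact Set.finite_empty.subset fun c hc => (h hc.1).elim
  refine ((h1.union h2).union hgood).subset fun c hc => ?_
  rcases mem_slice_compSet.1 hc with h | h | ⟨i, j, h, ⟨a, ha⟩, ⟨b, hb⟩⟩ | h
  · exact .inl (.inl h)
  · exact .inl (.inr h)
  · refine (hno (some (some a, i)) (some (some b, j)) ha hb ?_).elim
    exact (triangleOK_iff _ _ _ _).2 fun h1 h2 => (h ⟨h1, h2⟩).elim
  · exact .inr h

/-- A leg carrying `ρ` can be realized by cofinitely many nodes, and cofinite sets are rich enough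
to supply the adjacency that `ρ` stood for. The cases are sorted by which of the three edges carry
`ρ`. -/
theorem star_compSet_of_exists (hG : IsUnionOfCliques G N) (hN : 1 < N) {X Y : Set (RAtom V n)}
    {e q r : Option (EdgeLabel V n)} (hq : star X q) (hr : star Y r) (h : Consistent G e q r) :
    star (compSet G X Y) e := by
  have := hG.infinite
  rcases exists_toEdge_or q with ⟨q, rfl⟩ | ⟨i, rfl⟩ <;>
    rcases exists_toEdge_or r with ⟨r, rfl⟩ | ⟨j, rfl⟩ <;>
    rcases exists_toEdge_or e with ⟨e, rfl⟩ | ⟨l, rfl⟩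
  · exact star_toEdge.2 ⟨q, star_toEdge.1 hq, r, star_toEdge.1 hr, h⟩
  · rw [star_toEdge] at hq hr
    have huniv : ∀ c, c ∈ slice (compSet G X Y) l := fun c => by
      rcases q with _ | ⟨a, i⟩
      · exact (toEdge_ne_rho _ _ (consistent_none_mid.1 h).symm).elim
      rcases r with _ | ⟨b, j⟩
      · exact (toEdge_ne_rho _ _ (consistent_none_right.1 h).symm).elim
      by_cases hc : l = i ∧ i = j
      · obtain ⟨rfl, rfl⟩ := hc
        rcases (triangleOK_iff _ _ _ _).1 h rfl rfl with h | h | h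
        · exact h.elim
        · exact h.elim
        · exact mem_slice_compSet.2 (.inr (.inr (.inr ⟨a, hq, b, hr, .inr (.inr h)⟩)))
      · exact mem_slice_compSet.2 (.inr (.inr (.inl ⟨i, j, hc, ⟨a, hq⟩, ⟨b, hr⟩⟩)))
    exact Set.finite_empty.subset fun c hc => (hc (huniv c)).elim
  · rw [star_toEdge] at hq ⊢
    rcases q with _ | ⟨a, i⟩
    · exact (toEdge_ne_rho _ _ (consistent_none_mid.1 h)).elim
    obtain ⟨b, hb⟩ := nonempty_of_compl_finite hr
    rcases e with _ | ⟨c, l⟩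
    · exact (toEdge_ne_rho _ _ h).elim
    refine ⟨_, hq, _, hb, consistent_some.2 fun h1 h2 => ?_⟩
    rcases (triangleOK_iff _ _ _ _).1 h h1 h2 with h | h | h
    · exact .inl h
    · exact h.elim
    · exact h.elim
  · rw [star_toEdge] at hq
    rcases q with _ | ⟨a, i⟩
    · obtain rfl : l = j := by simpa using consistent_none_mid.1 h
      exact Set.Finite.subset hr (Set.compl_subset_compl.2 fun c hc =>
        mem_slice_compSet.2 (.inl ⟨hq, hc⟩))
    by_cases hc : l = i ∧ i = j
    · obtain ⟨rfl, rfl⟩ := hc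
      have hfin := hG.compl_goodNodes_finite hN (A := slice Y _) (B := slice X _) hr ⟨a, hq⟩
      refine hfin.subset (Set.compl_subset_compl.2 fun c hc =>
        mem_slice_compSet.2 (.inr (.inr (.inr ?_))))
      rwa [goodNodes_comm]
    · exact Set.finite_empty.subset fun c hc' => (hc' (mem_slice_compSet.2
        (.inr (.inr (.inl ⟨i, j, hc, ⟨a, hq⟩, nonempty_of_compl_finite hr⟩))))).elim
  · rw [star_toEdge] at hr ⊢
    rcases r with _ | ⟨b, j⟩
    · exact (toEdge_ne_rho _ _ (consistent_none_right.1 h)).elim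
    obtain ⟨a, ha⟩ := nonempty_of_compl_finite hq
    rcases e with _ | ⟨c, l⟩
    · exact (toEdge_ne_rho _ _ (Eq.symm h)).elim
    refine ⟨_, ha, _, hr, consistent_some.2 fun h1 h2 => ?_⟩
    rcases (triangleOK_iff _ _ _ _).1 h h1 h2 with h | h | h
    · exact h.elim
    · exact .inr (.inl h)
    · exact h.elim
  · rw [star_toEdge] at hr
    rcases r with _ | ⟨b, j⟩
    · obtain rfl : l = i := by simpa using consistent_none_right.1 h
      exact Set.Finite.subset hq (Set.compl_subset_compl.2 fun c hc =>
        mem_slice_compSet.2 (.inr (.inl ⟨hr, hc⟩)))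
    by_cases hc : l = i ∧ i = j
    · obtain ⟨rfl, rfl⟩ := hc
      exact (hG.compl_goodNodes_finite hN hq ⟨b, hr⟩).subset
        (Set.compl_subset_compl.2 fun c hc => mem_slice_compSet.2 (.inr (.inr (.inr hc))))
    · exact Set.finite_empty.subset fun c hc' => (hc' (mem_slice_compSet.2
        (.inr (.inr (.inl ⟨i, j, hc, nonempty_of_compl_finite hq, ⟨b, hr⟩⟩))))).elim
  · rw [star_toEdge]
    rcases e with _ | ⟨c, l⟩
    · obtain rfl : i = j := by simpa using (show some (none, i) = some (none, j) from h)
      obtain ⟨a, ha⟩ := nonempty_of_compl_finite (A := slice X i ∩ slice Y i) (by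
        rw [Set.compl_inter]
        exact Set.Finite.union hq hr)
      exact ⟨some (a, i), ha.1, some (a, i), ha.2, rfl⟩
    -- The adjacency of `ρ` to itself is imitated by an edge of `G` between two cofinite sets.
    · obtain ⟨a, ha, b, hb, hab⟩ := hG.exists_adj_of_cofinite hN hq hr
      exact ⟨_, ha, _, hb, consistent_some.2 fun _ _ => .inr (.inr hab)⟩
  · by_cases hc : l = i ∧ i = j
    · obtain ⟨rfl, rfl⟩ := hc
      exact (hG.compl_goodNodes_finite hN hq (nonempty_of_compl_finite hr)).subset
        (Set.compl_subset_compl.2 fun c hc => mem_slice_compSet.2 (.inr (.inr (.inr hc))))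
    · exact Set.finite_empty.subset fun c hc' => (hc' (mem_slice_compSet.2 (.inr (.inr (.inl
        ⟨i, j, hc, nonempty_of_compl_finite hq, nonempty_of_compl_finite hr⟩))))).elim

end RAtom

open RAtom in
/-- The relation algebra of tame sets of atoms. -/
def tameAlg {V : Type u} {G : SimpleGraph V} {N : ℕ} (n : ℕ) (hG : IsUnionOfCliques G N)
    (hN : 1 < N) : RelAlg.{u} where
  carrier := tame V n
  comp X Y := ⟨compSet G X.1 Y.1, IsTame.compSet hG hN X.2 Y.2⟩
  conv X := X
  ident := ⟨{none}, isTame_singleton none⟩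

namespace LabelledGraph

open RAtom

variable {V : Type u} {n N : ℕ} {M : Type u} {Γ : LabelledGraph V n M} {G : SimpleGraph V}

theorem ExtensionProperty.exists_edge_eq [Nonempty M] (hΓ : Γ.Admissible G)
    (hext : Γ.ExtensionProperty G) (hn : 3 ≤ n) (e : Option (EdgeLabel V n)) (x : M) :
    ∃ y, Γ.edge x y = e := by
  obtain ⟨z, hz, -⟩ := hext.exists_triangle hΓ hn (x := x) (y := x) (q := e) (r := e) (by
    rw [edge_self, consistent_none_left])
  exact ⟨z, hz⟩

/-- A pair of points of `M` belongs to `X` when its edge satisfies `star X`. Every consistent pair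
of legs over an edge is realized by a point of `M`, which turns the two facts about `star` and
`compSet` into composition of relations. -/
theorem representable_tameAlg [Nonempty M] (hΓ : Γ.Admissible G) (hext : Γ.ExtensionProperty G)
    (hn : 3 ≤ n) (hG : IsUnionOfCliques G N) (hN : 1 < N) : (tameAlg n hG hN).Representable := by
  have := hG.infinite
  let f : tame V n → PUnit → Set (M × M) := fun X _ => {p | star X.1 (Γ.edge p.1 p.2)}
  refine ⟨PUnit, fun _ => M, fun _ => inferInstance, f, ⟨?_, ?_, ?_, ?_, ?_⟩, ?_⟩
  · exact fun X Y => funext fun _ => Set.ext fun p => star_union X.2 Y.2 _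
  · exact fun X => funext fun _ => Set.ext fun p => star_compl X.2 _
  · intro X Y
    refine funext fun _ => Set.ext (α := M × M) fun p => ⟨fun h => ?_, ?_⟩
    · obtain ⟨q, r, hq, hr, hc⟩ := exists_of_star_compSet hG hN X.2 Y.2 h
      obtain ⟨z, rfl, rfl⟩ := hext.exists_triangle hΓ hn hc
      exact ⟨z, hq, hr⟩
    · rintro ⟨z, hq, hr⟩
      exact star_compSet_of_exists hG hN hq hr (hΓ.consistent _ _ _)
  · intro X
    refine funext fun _ => Set.ext (α := M × M) fun p => ?_
    show star X.1 (Γ.edge p.1 p.2) ↔ star X.1 (Γ.edge p.2 p.1)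
    rw [edge_comm]
  · refine funext fun _ => Set.ext (α := M × M) fun p => ?_
    show star {none} (Γ.edge p.1 p.2) ↔ p.1 = p.2
    rw [← edge_eq_none (Γ := Γ)]
    rcases exists_toEdge_or (Γ.edge p.1 p.2) with ⟨q, hq⟩ | ⟨i, hi⟩
    · rw [hq, star_toEdge, toEdge_eq_none]
      rfl
    · rw [hi]
      refine iff_of_false (fun h => ?_) (by simp)
      have h : (slice ({none} : Set (RAtom V n)) i)ᶜ.Finite := h
      obtain ⟨a, ha⟩ := nonempty_of_compl_finite h
      simp [slice] at ha
  · intro X Y hXY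
    refine Subtype.ext (Set.ext fun p => ?_)
    obtain ⟨y, hy⟩ := hext.exists_edge_eq hΓ hn (toEdge p) (Classical.arbitrary M)
    have h : (Classical.arbitrary M, y) ∈ f X PUnit.unit ↔
        (Classical.arbitrary M, y) ∈ f Y PUnit.unit := by rw [show f X = f Y from hXY]
    have h : star X.1 (Γ.edge (Classical.arbitrary M) y) ↔
        star Y.1 (Γ.edge (Classical.arbitrary M) y) := h
    rwa [hy, star_toEdge, star_toEdge] at h

end LabelledGraph

/-! ## Atoms and basic matrices of the relation algebra -/

section TameAlg

open RAtom

variable {V : Type u} {n N : ℕ} {G : SimpleGraph V} {hG : IsUnionOfCliques G N} {hN : 1 < N}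

/-- The element of the relation algebra that consists of one atom. -/
def tameAtom (hG : IsUnionOfCliques G N) (hN : 1 < N) (p : RAtom V n) :
    (tameAlg n hG hN).carrier :=
  (⟨{p}, isTame_singleton p⟩ : tame V n)

/-- The set of atoms of an element of the relation algebra. -/
def tameSet (X : (tameAlg n hG hN).carrier) : Set (RAtom V n) := X.1

theorem tameSet_le {X Y : (tameAlg n hG hN).carrier} : X ≤ Y ↔ tameSet X ⊆ tameSet Y := Iff.rfl

theorem tameSet_injective : Function.Injective (tameSet (n := n) (hG := hG) (hN := hN)) :=
  fun _ _ h => Subtype.ext h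

theorem tameAtom_injective : Function.Injective (tameAtom (n := n) hG hN) := fun _ _ h =>
  Set.singleton_injective (congrArg tameSet h)

theorem tameAtom_le {p : RAtom V n} {X : (tameAlg n hG hN).carrier} :
    tameAtom hG hN p ≤ X ↔ p ∈ tameSet X :=
  tameSet_le.trans Set.singleton_subset_iff

theorem isAtom_tameAtom (p : RAtom V n) : IsAtom (tameAtom hG hN p) := by
  refine ⟨fun h => ?_, fun X hX => ?_⟩
  · exact Set.singleton_ne_empty p (congrArg tameSet h)
  · rcases Set.subset_singleton_iff_eq.1 (tameSet_le.1 hX.le) with h | h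
    · exact tameSet_injective h
    · exact (hX.ne (tameSet_injective h)).elim

theorem exists_tameAtom_le {X : (tameAlg n hG hN).carrier} (hX : X ≠ ⊥) :
    ∃ p, tameAtom hG hN p ≤ X := by
  obtain ⟨p, hp⟩ := Set.nonempty_iff_ne_empty.2 (tameSet_injective.ne hX)
  exact ⟨p, tameAtom_le.2 hp⟩

theorem exists_eq_tameAtom {X : (tameAlg n hG hN).carrier} (hX : IsAtom X) :
    ∃ p, X = tameAtom hG hN p := by
  obtain ⟨p, hp⟩ := exists_tameAtom_le hX.1
  exact ⟨p, ((hX.le_iff_eq (isAtom_tameAtom p).1).1 hp).symm⟩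

instance isAtomic_tameAlg : IsAtomic (tameAlg n hG hN).carrier := by
  refine ⟨fun X => or_iff_not_imp_left.2 fun hX => ?_⟩
  obtain ⟨p, hp⟩ := exists_tameAtom_le hX
  exact ⟨_, isAtom_tameAtom p, hp⟩

theorem tameAtom_le_comp {r : RAtom V n} {X Y : (tameAlg n hG hN).carrier} :
    tameAtom hG hN r ≤ (tameAlg n hG hN).comp X Y ↔
      ∃ p ∈ tameSet X, ∃ q ∈ tameSet Y, Consistent G (toEdge r) (toEdge p) (toEdge q) :=
  tameAtom_le

theorem tameAtom_le_comp_tameAtom {p q r : RAtom V n} :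
    tameAtom hG hN r ≤ (tameAlg n hG hN).comp (tameAtom hG hN p) (tameAtom hG hN q) ↔
      Consistent G (toEdge r) (toEdge p) (toEdge q) := by
  refine tameAtom_le_comp.trans ⟨?_, fun h => ⟨p, rfl, q, rfl, h⟩⟩
  rintro ⟨_, rfl, _, rfl, h⟩
  exact h

theorem tameAtom_le_ident {p : RAtom V n} :
    tameAtom hG hN p ≤ (tameAlg n hG hN).ident ↔ p = none :=
  tameAtom_le

theorem isCompletion_tameAlg :
    (tameAlg n hG hN).IsCompletion (tameAlg n hG hN).complexAlg := by
  refine RelAlg.isCompletion_complexAlg _ ?_ ?_ (fun _ _ h => h)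
    (fun x a ha h => ⟨a, ha, h, le_rfl⟩)
  · rintro X X' Y Y' hX hY r ⟨p, hp, q, hq, h⟩
    exact ⟨p, hX hp, q, hY hq, h⟩
  · intro X Y a ha hle
    obtain ⟨r, rfl⟩ := exists_eq_tameAtom ha
    obtain ⟨p, hp, q, hq, h⟩ := tameAtom_le_comp.1 hle
    exact ⟨_, _, isAtom_tameAtom p, isAtom_tameAtom q, tameAtom_le.2 hp, tameAtom_le.2 hq,
      tameAtom_le_comp_tameAtom.2 h⟩

theorem isBasicMatrix_iff {τ : Fin n → Fin n → RAtom V n} :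
    (tameAlg n hG hN).IsBasicMatrix (fun k l => tameAtom hG hN (τ k l)) ↔
      IsNetwork G fun k l => toEdge (τ k l) := by
  constructor
  · intro h
    refine ⟨fun i => ?_, fun i j => ?_, fun i j k => tameAtom_le_comp_tameAtom.1 (h.tri i j k)⟩
    · rw [tameAtom_le_ident.1 (h.refl i), toEdge_none]
    · rw [tameAtom_injective (h.conv i j)]
  · intro h
    refine ⟨fun i j => isAtom_tameAtom _, fun i => ?_, fun i j => ?_,
      fun i j k => tameAtom_le_comp_tameAtom.2 (h.tri i j k)⟩
    · exact tameAtom_le_ident.2 (toEdge_eq_none.1 (h.refl i))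
    · exact congrArg (tameAtom hG hN) (toEdge_injective (h.symm i j))

variable (n hG hN) in
/-- The basic matrices of the relation algebra. -/
abbrev TameMatrix : Type u :=
  {m : Fin n → Fin n → (tameAlg n hG hN).carrier // (tameAlg n hG hN).IsBasicMatrix m}

/-- The atoms that are the entries of a basic matrix. -/
noncomputable def TameMatrix.entry (m : TameMatrix n hG hN) (k l : Fin n) : RAtom V n :=
  (exists_eq_tameAtom (m.2.atom k l)).choose

theorem TameMatrix.eq_entry (m : TameMatrix n hG hN) (k l : Fin n) :
    m.1 k l = tameAtom hG hN (m.entry k l) :=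
  (exists_eq_tameAtom (m.2.atom k l)).choose_spec

theorem TameMatrix.entry_eq_entry {m m' : TameMatrix n hG hN} {k l k' l' : Fin n} :
    m.entry k l = m'.entry k' l' ↔ m.1 k l = m'.1 k' l' := by
  rw [eq_entry, eq_entry, tameAtom_injective.eq_iff]

theorem TameMatrix.ext_entry {m m' : TameMatrix n hG hN}
    (h : ∀ k l, m.entry k l = m'.entry k l) : m = m' :=
  Subtype.ext (funext fun k => funext fun l => entry_eq_entry.1 (h k l))

theorem TameMatrix.isNetwork (m : TameMatrix n hG hN) :
    IsNetwork G fun k l => toEdge (m.entry k l) := by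
  rw [← isBasicMatrix_iff (hG := hG) (hN := hN)]
  have h := m.2
  rwa [show m.1 = fun k l => tameAtom hG hN (m.entry k l) from
    funext fun k => funext fun l => m.eq_entry k l] at h

/-- The basic matrix with given entries. -/
def TameMatrix.mk (τ : Fin n → Fin n → RAtom V n) (h : IsNetwork G fun k l => toEdge (τ k l)) :
    TameMatrix n hG hN :=
  ⟨fun k l => tameAtom hG hN (τ k l), isBasicMatrix_iff.2 h⟩

theorem TameMatrix.entry_mk {τ : Fin n → Fin n → RAtom V n}
    (h : IsNetwork G fun k l => toEdge (τ k l)) (k l : Fin n) :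
    (TameMatrix.mk τ h : TameMatrix n hG hN).entry k l = τ k l :=
  (tameAtom_injective (hG := hG) (hN := hN)
    ((TameMatrix.mk τ h : TameMatrix n hG hN).eq_entry k l)).symm

end TameAlg

section Network

variable {V : Type u} {n : ℕ} {G : SimpleGraph V} {ι : Type v}

/-- Replacing the row and the column `i` of a matrix by `b`. -/
def updateRow [DecidableEq ι] {α : Type u} (τ : ι → ι → Option α) (i : ι) (b : ι → Option α)
    (k l : ι) : Option α :=
  if k = i then if l = i then none else b l else if l = i then b k else τ k l

theorem map_updateRow [DecidableEq ι] {α β : Type u} (f : α → β) (τ : ι → ι → Option α) (i : ι)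
    (b : ι → Option α) (k l : ι) : (updateRow τ i b k l).map f =
      updateRow (fun k l => (τ k l).map f) i (fun k => (b k).map f) k l := by
  unfold updateRow
  split_ifs <;> rfl

/-- Only triangles through `i` are new; those with a repeated index reduce to trivial ones. -/
theorem IsNetwork.updateRow [DecidableEq ι] {τ : ι → ι → Option (EdgeLabel V n)}
    (hτ : IsNetwork G τ) {i : ι} {b : ι → Option (EdgeLabel V n)}
    (hb : ∀ k l, k ≠ i → l ≠ i → Consistent G (τ k l) (b k) (b l)) :
    IsNetwork G (updateRow τ i b) := by
  have h0 : ∀ p : Option (EdgeLabel V n), Consistent G p p none := fun p =>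
    consistent_none_right.2 rfl
  refine ⟨fun k => ?_, fun k l => ?_, fun k l m => ?_⟩
  · by_cases hk : k = i <;> simp [_root_.updateRow, hk, hτ.refl]
  · by_cases hk : k = i <;> by_cases hl : l = i <;> simp [_root_.updateRow, hk, hl, hτ.symm k l]
  · by_cases hk : k = i <;> by_cases hl : l = i <;> by_cases hm : m = i <;>
      simp only [_root_.updateRow, hk, hl, hm, if_true, if_false]
    · exact h0 none
    · exact (h0 _).rotate.rotate
    · exact (h0 _).swap'
    · have := hb m l hm hl
      exact this.rotate.rotate.swap'
    · exact h0 _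
    · exact (hb k m hk hm).swap
    · exact hb k l hk hl
    · exact hτ.tri k l m

end Network

/-! ## The cylindric basis of basic matrices and the set algebra of definable relations -/

namespace LabelledGraph

open RAtom

variable {V : Type u} {n N : ℕ} {M : Type u} {Γ : LabelledGraph V n M} {G : SimpleGraph V}
  {hG : IsUnionOfCliques G N} {hN : 1 < N}

theorem exists_entry_eq_edge (hΓ : Γ.Admissible G) (s : Γ.W) : ∃ m : TameMatrix n hG hN,
    ∀ k l, toEdge (m.entry k l) = Γ.edge (s.1 k) (s.1 l) := by
  have h : ∀ k l, ∃ p, Γ.edge (s.1 k) (s.1 l) = toEdge p := fun k l =>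
    (exists_toEdge_or _).resolve_right fun ⟨c, hc⟩ => mem_W_iff.1 s.2 k l c hc
  choose τ hτ using h
  have hnet := hΓ.isNetwork s.1
  simp only [hτ] at hnet
  refine ⟨TameMatrix.mk τ hnet, fun k l => ?_⟩
  rw [TameMatrix.entry_mk, hτ]

/-- The basic matrix of the edges between the points of a tuple. -/
noncomputable def tupleMatrix (hG : IsUnionOfCliques G N) (hN : 1 < N) (hΓ : Γ.Admissible G)
    (s : Γ.W) : TameMatrix n hG hN :=
  (exists_entry_eq_edge hΓ s).choose

theorem toEdge_tupleMatrix (hΓ : Γ.Admissible G) (s : Γ.W) (k l : Fin n) :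
    toEdge ((tupleMatrix hG hN hΓ s).entry k l) = Γ.edge (s.1 k) (s.1 l) :=
  (exists_entry_eq_edge hΓ s).choose_spec k l

theorem tupleMatrix_apply_eq (hΓ : Γ.Admissible G) {s : Γ.W} {k l : Fin n} {p : RAtom V n}
    (h : Γ.edge (s.1 k) (s.1 l) = toEdge p) :
    (tupleMatrix hG hN hΓ s).1 k l = tameAtom hG hN p := by
  rw [TameMatrix.eq_entry, toEdge_injective ((toEdge_tupleMatrix hΓ s k l).trans h)]

theorem tupleMatrix_eq_iff (hΓ : Γ.Admissible G) {s : Γ.W} {m : TameMatrix n hG hN} :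
    tupleMatrix hG hN hΓ s = m ↔ ∀ k l, Γ.edge (s.1 k) (s.1 l) = toEdge (m.entry k l) := by
  constructor
  · rintro rfl k l
    exact (toEdge_tupleMatrix hΓ s k l).symm
  · exact fun h => TameMatrix.ext_entry fun k l =>
      toEdge_injective ((toEdge_tupleMatrix hΓ s k l).trans (h k l))

theorem mem_W_of_entry {s : Fin n → M} {m : TameMatrix n hG hN}
    (h : ∀ k l, Γ.edge (s k) (s l) = toEdge (m.entry k l)) : s ∈ Γ.W :=
  mem_W_iff.2 fun k l c => by
    rw [h]
    exact toEdge_ne_rho _ _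

/-- A basic matrix is a network on `n` indices, realized by the extension property. Its entries
avoid `ρ`, so the realization lies in `W`. -/
theorem tupleMatrix_surjective [Nonempty M] (hΓ : Γ.Admissible G) (hext : Γ.ExtensionProperty G) :
    Function.Surjective (tupleMatrix hG hN hΓ) := fun m => by
  obtain ⟨t, ht⟩ := hext.exists_realization hΓ m.isNetwork
  exact ⟨⟨t, mem_W_of_entry ht⟩, (tupleMatrix_eq_iff hΓ).2 ht⟩

theorem exists_matrix_triangle [Nonempty M] (hΓ : Γ.Admissible G) (hext : Γ.ExtensionProperty G)
    (hn : 3 ≤ n) {p q r : RAtom V n} (h : Consistent G (toEdge p) (toEdge q) (toEdge r)) :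
    ∃ m : TameMatrix n hG hN, m.1 ⟨0, by omega⟩ ⟨1, by omega⟩ = tameAtom hG hN p ∧
      m.1 ⟨0, by omega⟩ ⟨2, by omega⟩ = tameAtom hG hN q ∧
      m.1 ⟨2, by omega⟩ ⟨1, by omega⟩ = tameAtom hG hN r := by
  obtain ⟨y, hxy⟩ := hext.exists_edge_eq hΓ hn (toEdge p) (Classical.arbitrary M)
  generalize Classical.arbitrary M = x at hxy
  rw [← hxy] at h
  obtain ⟨z, hxz, hzy⟩ := hext.exists_triangle hΓ hn h
  have hyx : Γ.edge y x = toEdge p := by rw [edge_comm, hxy]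
  have hzx : Γ.edge z x = toEdge q := by rw [edge_comm, hxz]
  -- Coordinates beyond the third will repeat `z`, so the matrix has no further distinct points.
  have hyz : Γ.edge y z = toEdge r := by rw [edge_comm, hzy]
  let s : Fin n → M := fun k => if k.1 = 0 then x else if k.1 = 1 then y else z
  have hs : ∀ k, s k = x ∨ s k = y ∨ s k = z := fun k => by
    dsimp only [s]
    split_ifs <;> simp
  have hW : s ∈ Γ.W := mem_W_iff.2 fun k l c => by
    have h0 : ∀ w, Γ.edge w w ≠ some (none, c) := fun w => by simp [edge_self]
    rcases hs k with hk | hk | hk <;> rcases hs l with hl | hl | hl <;>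
      simp only [hk, hl, h0, hxy, hxz, hyx, hyz, hzx, hzy, ne_eq, toEdge_ne_rho, not_false_eq_true]
  exact ⟨tupleMatrix hG hN hΓ ⟨s, hW⟩, tupleMatrix_apply_eq hΓ hxy, tupleMatrix_apply_eq hΓ hxz,
    tupleMatrix_apply_eq hΓ hzy⟩

end LabelledGraph

section Amalgamation

open RAtom

variable {V : Type u} {n N : ℕ} {G : SimpleGraph V} {hG : IsUnionOfCliques G N} {hN : 1 < N}

/-- The entry at `(i, j)` takes part in only `n - 2` triangles. A degenerate leg forces it.
Otherwise one of the `n` colours is not used by the legs `m'.entry i k`, and no triangle with an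
entry of this colour is monochromatic. -/
theorem exists_consistent_entry [Nonempty V] (m m' : TameMatrix n hG hN) {i j : Fin n} (hij : i ≠ j)
    (h : ∀ k l, k ≠ i → k ≠ j → l ≠ i → l ≠ j → m.entry k l = m'.entry k l) :
    ∃ e : RAtom V n, ∀ k, k ≠ i → k ≠ j →
      Consistent G (toEdge e) (toEdge (m'.entry i k)) (toEdge (m.entry k j)) := by
  classical
  by_cases h1 : ∃ k, k ≠ i ∧ k ≠ j ∧ m'.entry i k = none
  · obtain ⟨k, hki, hkj, hk⟩ := h1
    refine ⟨m.entry k j, fun l hli hlj => ?_⟩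
    have h2 := m'.isNetwork.tri i l k
    rw [hk, toEdge_none, consistent_none_mid, ← h k l hki hkj hli hlj] at h2
    rw [h2]
    exact m.isNetwork.tri k j l
  by_cases h1' : ∃ k, k ≠ i ∧ k ≠ j ∧ m.entry k j = none
  · obtain ⟨k, hki, hkj, hk⟩ := h1'
    refine ⟨m'.entry i k, fun l hli hlj => ?_⟩
    have h2 := m.isNetwork.tri l j k
    rw [hk, toEdge_none, consistent_none_right, h l k hli hlj hki hkj] at h2
    rw [h2]
    exact m'.isNetwork.tri i k l
  push Not at h1 h1'
  let col : RAtom V n → Fin n := fun p => p.elim i Prod.snd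
  obtain ⟨c, hc⟩ : ∃ c, c ∉ ((Finset.univ.erase i).erase j).image fun k => col (m'.entry i k) := by
    by_contra! hall
    have h2 := Finset.card_le_card fun c (_ : c ∈ Finset.univ) => hall c
    have h3 := h2.trans Finset.card_image_le
    rw [Finset.card_erase_of_mem (by simp [hij.symm]), Finset.card_erase_of_mem (by simp)] at h3
    have := i.pos
    simp at h3
    omega
  refine ⟨some (Classical.arbitrary V, c), fun k hki hkj => ?_⟩
  obtain ⟨⟨a, d⟩, ha⟩ := Option.ne_none_iff_exists'.1 (h1 k hki hkj)
  obtain ⟨⟨b, d'⟩, hb⟩ := Option.ne_none_iff_exists'.1 (h1' k hki hkj)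
  rw [ha, hb]
  refine consistent_some.2 fun hcd => ?_
  refine (hc (Finset.mem_image.2 ⟨k, by simp [hki, hkj], ?_⟩)).elim
  rw [ha, hcd]
  rfl

theorem exists_amalgam [Nonempty V] (m m' : TameMatrix n hG hN) {i j : Fin n} (hij : i ≠ j)
    (h : ∀ k l, k ≠ i → k ≠ j → l ≠ i → l ≠ j → m.1 k l = m'.1 k l) :
    ∃ p : TameMatrix n hG hN, (∀ k l, k ≠ i → l ≠ i → m.1 k l = p.1 k l) ∧
      (∀ k l, k ≠ j → l ≠ j → p.1 k l = m'.1 k l) := by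
  simp only [← TameMatrix.entry_eq_entry] at h ⊢
  obtain ⟨e, he⟩ := exists_consistent_entry m m' hij h
  let b : Fin n → RAtom V n := fun k => if k = j then e else m'.entry i k
  have hb : ∀ k l, k ≠ i → l ≠ i →
      Consistent G (toEdge (m.entry k l)) (toEdge (b k)) (toEdge (b l)) := by
    intro k l hki hli
    by_cases hk : k = j <;> by_cases hl : l = j <;> simp only [b, hk, hl, if_true, if_false]
    · rw [m.isNetwork.refl, consistent_none_left]
    · exact m.isNetwork.symm l j ▸ (he l hli hl).rotate.rotate
    · exact (he k hki hk).rotate.rotate.swap'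
    · rw [h k l hki hk hli hl, m'.isNetwork.symm i k]
      exact m'.isNetwork.tri k l i
  have hnet : IsNetwork G fun k l => toEdge (updateRow m.entry i b k l) := by
    have h1 := m.isNetwork.updateRow hb
    have h2 : updateRow (fun k l => toEdge (m.entry k l)) i (fun k => toEdge (b k)) =
        fun k l => toEdge (updateRow m.entry i b k l) :=
      funext fun k => funext fun l => (map_updateRow _ m.entry i b k l).symm
    exact h2 ▸ h1
  refine ⟨TameMatrix.mk _ hnet, fun k l hk hl => ?_, fun k l hk hl => ?_⟩
  · simp [TameMatrix.entry_mk, updateRow, hk, hl]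
  · rw [TameMatrix.entry_mk]
    by_cases hki : k = i <;> by_cases hli : l = i <;>
      simp only [updateRow, hki, hli, if_true, if_false]
    · exact (toEdge_eq_none.1 (m'.isNetwork.refl i)).symm
    · simp [b, hl]
    · rw [toEdge_injective (m'.isNetwork.symm k i)]
      simp [b, hk]
    · exact h k l hki hk hli hl

end Amalgamation

/-! ### Basic matrices as types of tuples in `W` -/

namespace LabelledGraph

open RAtom

variable {V : Type u} {n N : ℕ} {M : Type u} {Γ : LabelledGraph V n M} {G : SimpleGraph V}
  {hG : IsUnionOfCliques G N} {hN : 1 < N}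

theorem isCylindricBasis_tameAlg [Nonempty M] (hΓ : Γ.Admissible G) (hext : Γ.ExtensionProperty G)
    (hn : 3 ≤ n) :
    (tameAlg n hG hN).IsCylindricBasis hn {m | (tameAlg n hG hN).IsBasicMatrix m} := by
  have := hG.infinite
  refine ⟨fun _ h => h, ?_, ?_⟩
  · intro a b c ha hb hc h
    obtain ⟨p, rfl⟩ := exists_eq_tameAtom ha
    obtain ⟨q, rfl⟩ := exists_eq_tameAtom hb
    obtain ⟨r, rfl⟩ := exists_eq_tameAtom hc
    obtain ⟨m, hm⟩ := exists_matrix_triangle (hG := hG) (hN := hN) hΓ hext hn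
      (tameAtom_le_comp_tameAtom.1 h)
    exact ⟨m.1, m.2, hm⟩
  · intro m hm m' hm' i j hij h
    obtain ⟨p, hp⟩ := exists_amalgam ⟨m, hm⟩ ⟨m', hm'⟩ hij h
    exact ⟨p.1, p.2, hp⟩

/-- The tuples whose matrix is in a given set of matrices. -/
def matTuples (hG : IsUnionOfCliques G N) (hN : 1 < N) (hΓ : Γ.Admissible G)
    (X : ((tameAlg n hG hN).matComplex n).carrier) : (CylAlg.relSetAlg Γ.W).carrier :=
  tupleMatrix hG hN hΓ ⁻¹' (show Set (TameMatrix n hG hN) from X)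

/-- For cylindrifications, a tuple whose matrix agrees with `m` off `i` can be changed in the
coordinate `i` alone to realize `m`; this is a one-point extension. -/
theorem isHom_matTuples [Nonempty M] (hΓ : Γ.Admissible G) (hext : Γ.ExtensionProperty G) :
    CylAlg.IsHom ((tameAlg n hG hN).matComplex n) (CylAlg.relSetAlg Γ.W)
      (matTuples hG hN hΓ) := by
  refine ⟨fun _ _ => rfl, fun _ => rfl, fun i X => ?_, fun i j => ?_⟩
  · refine Set.ext (α := Γ.W) fun s => ⟨?_, ?_⟩
    · rintro ⟨m, hm, hsm⟩
      obtain ⟨t, hts, ht⟩ := hext.exists_update hΓ (TameMatrix.isNetwork m) i s.1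
        fun k l hk hl => by
        rw [← toEdge_tupleMatrix (hG := hG) (hN := hN) hΓ,
          TameMatrix.entry_eq_entry.2 (hsm k l hk hl)]
      refine ⟨⟨t, mem_W_of_entry ht⟩, ?_, hts⟩
      have h := (tupleMatrix_eq_iff (s := ⟨t, mem_W_of_entry ht⟩) hΓ).2 ht
      refine Set.mem_preimage.2 ?_
      rw [h]
      exact hm
    · rintro ⟨t, ht, hts⟩
      refine ⟨tupleMatrix hG hN hΓ t, ht, fun k l hk hl => ?_⟩
      rw [← TameMatrix.entry_eq_entry]
      apply toEdge_injective
      rw [toEdge_tupleMatrix, toEdge_tupleMatrix, hts k hk, hts l hl]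
  · refine Set.ext (α := Γ.W) fun s => ?_
    show (tupleMatrix hG hN hΓ s).1 i j ≤ _ ↔ s.1 i = s.1 j
    rw [TameMatrix.eq_entry, tameAtom_le_ident, ← toEdge_eq_none, toEdge_tupleMatrix, edge_eq_none]

theorem matTuples_injective [Nonempty M] (hΓ : Γ.Admissible G) (hext : Γ.ExtensionProperty G) :
    Function.Injective (matTuples hG hN hΓ) :=
  Set.preimage_injective.2 (tupleMatrix_surjective hΓ hext)

theorem matTuples_singleton (hΓ : Γ.Admissible G) (m : TameMatrix n hG hN) :
    matTuples hG hN hΓ ({m} : Set (TameMatrix n hG hN)) =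
      {t : Γ.W | ∀ k l, Γ.edge (t.1 k) (t.1 l) = toEdge (m.entry k l)} :=
  Set.ext (α := Γ.W) fun _ => tupleMatrix_eq_iff hΓ

variable (n hG hN) in
/-- The singletons of basic matrices. -/
abbrev matSingletons : Set (Set (TameMatrix n hG hN)) :=
  Set.range fun m : TameMatrix n hG hN => ({m} : Set (TameMatrix n hG hN))

theorem matTuples_mem_range_sem [Nonempty M] (hΓ : Γ.Admissible G) (hext : Γ.ExtensionProperty G)
    {X : ((tameAlg n hG hN).matComplex n).carrier}
    (hX : ((tameAlg n hG hN).matComplex n).Generated (matSingletons n hG hN) X) :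
    matTuples hG hN hΓ X ∈ Set.range (Γ.sem Γ.W) := by
  have hhom := isHom_matTuples (hG := hG) (hN := hN) hΓ hext
  have hsub := Γ.isSubuniverse_range_sem Γ.W
  induction hX with
  | of X h =>
    obtain ⟨m, rfl⟩ := h
    exact matTuples_singleton hΓ m ▸ exists_sem_type _
  | bot => exact hsub.bot_mem
  | sup X Y _ _ h1 h2 => exact hsub.sup_mem _ h1 _ h2
  | compl X _ h => exact hsub.compl_mem _ h
  | cyl i X _ h =>
    rw [hhom.map_cyl]
    exact hsub.cyl_mem i _ h
  | diag i j =>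
    rw [hhom.map_diag]
    exact hsub.diag_mem i j

/-- If all coordinates except `j` equal `x_i`, the type is determined by the edge from `x_i` to
`x_j`, so it is a single matrix. Cylindrifying it over the coordinates other than `i` and `j` gives
the relation. -/
theorem exists_generated_rel [Nonempty M] (hΓ : Γ.Admissible G) (hext : Γ.ExtensionProperty G)
    (hn : 3 ≤ n) (l : EdgeLabel V n) (i j : Fin n) :
    ∃ X, ((tameAlg n hG hN).matComplex n).Generated (matSingletons n hG hN) X ∧
      matTuples hG hN hΓ X = {s : Γ.W | Γ.Rel l (s.1 i) (s.1 j)} := by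
  classical
  have hhom := isHom_matTuples (hG := hG) (hN := hN) hΓ hext
  have hempty : (∀ s : Γ.W, ¬ Γ.Rel l (s.1 i) (s.1 j)) →
      ∃ X, ((tameAlg n hG hN).matComplex n).Generated (matSingletons n hG hN) X ∧
        matTuples hG hN hΓ X = {s : Γ.W | Γ.Rel l (s.1 i) (s.1 j)} := fun h =>
    ⟨⊥, .bot, hhom.map_bot.trans (Set.eq_empty_iff_forall_notMem.2 h).symm⟩
  by_cases hij : i = j
  · exact hempty fun s h => h.1 (by rw [hij])
  rcases l with ⟨_ | a, c⟩
  · exact hempty fun s h => mem_W_iff.1 s.2 i j c (edge_eq_some.2 h)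
  -- `K` collects the coordinates released so far from the equation with `x_i`.
  have key : ∀ K : Finset (Fin n), ∃ X,
      ((tameAlg n hG hN).matComplex n).Generated (matSingletons n hG hN) X ∧
      matTuples hG hN hΓ X = {s : Γ.W | Γ.Rel (some a, c) (s.1 i) (s.1 j) ∧
        ∀ k, k ∉ K → k ≠ j → s.1 k = s.1 i} := by
    intro K
    induction K using Finset.induction_on with
    | empty =>
      obtain ⟨y, hy⟩ := hext.exists_edge_eq hΓ hn (toEdge (some (a, c))) (Classical.arbitrary M)
      generalize Classical.arbitrary M = x at hy
      let s : Fin n → M := fun k => if k = j then y else x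
      have hsi : s i = x := if_neg hij
      have hsj : s j = y := if_pos rfl
      have hsx : ∀ k, k ≠ j → s k = x := fun k hk => if_neg hk
      have hW : s ∈ Γ.W := mem_W_iff.2 fun k l d => by
        by_cases hk : k = j <;> by_cases hl : l = j
        · simp [hk, hl, edge_self]
        · rw [hk, hsj, hsx l hl, edge_comm, hy]
          exact toEdge_ne_rho _ _
        · rw [hl, hsj, hsx k hk, hy]
          exact toEdge_ne_rho _ _
        · simp [hsx k hk, hsx l hl, edge_self]
      refine ⟨({tupleMatrix hG hN hΓ ⟨s, hW⟩} : Set (TameMatrix n hG hN)), .of _ ⟨_, rfl⟩, ?_⟩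
      rw [matTuples_singleton]
      refine Set.ext fun t => ?_
      simp only [toEdge_tupleMatrix, Set.mem_ofPred_eq, Finset.notMem_empty, not_false_eq_true,
        true_implies]
      constructor
      · intro h
        refine ⟨edge_eq_some.1 ?_, fun k hk => edge_eq_none (Γ := Γ).1 ?_⟩
        · rw [h, hsi, hsj, hy, toEdge_some]
        · rw [h, hsi, hsx k hk, edge_self]
      · rintro ⟨h1, h2⟩ k l
        have h1 : Γ.edge (t.1 i) (t.1 j) = Γ.edge x y := by
          rw [hy]
          exact edge_eq_some.2 h1
        by_cases hk : k = j <;> by_cases hl : l = j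
        · rw [hk, hl, edge_self, edge_self]
        · rw [hk, hsj, hsx l hl, h2 l hl, edge_comm, h1, edge_comm]
        · rw [hl, hsj, hsx k hk, h2 k hk, h1]
        · rw [hsx k hk, hsx l hl, h2 k hk, h2 l hl, edge_self, edge_self]
    | insert k K _ ih =>
      obtain ⟨X, hX, hXK⟩ := ih
      by_cases hk : k = i ∨ k = j
      · refine ⟨X, hX, hXK.trans (Set.ext fun s => and_congr_right fun _ => ?_)⟩
        refine forall_congr' fun l => ⟨fun h hl => h fun hlK => hl (Finset.mem_insert_of_mem hlK),
          fun h hl hlj => ?_⟩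
        by_cases hlk : l = k
        · rw [hlk.trans (hk.resolve_right fun h => hlj (hlk.trans h))]
        · exact h (by simp [hlk, hl]) hlj
      · push Not at hk
        refine ⟨_, .cyl k X hX, ?_⟩
        rw [hhom.map_cyl, hXK]
        refine Set.ext (α := Γ.W) fun s => ⟨?_, ?_⟩
        · rintro ⟨t, ⟨h1, h2⟩, hts⟩
          rw [hts i hk.1.symm, hts j hk.2.symm] at h1
          refine ⟨h1, fun l hl hlj => ?_⟩
          rw [Finset.mem_insert, not_or] at hl
          rw [← hts l hl.1, ← hts i hk.1.symm, h2 l hl.2 hlj]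
        · rintro ⟨h1, h2⟩
          -- The witness for the cylindrification moves the coordinate `k` onto the coordinate `i`,
          -- which cannot leave `W`.
          have hu : ∀ l, l ≠ k → (s.1 ∘ Function.update id k i) l = s.1 l := fun l hl => by
            simp [hl]
          refine ⟨⟨s.1 ∘ Function.update id k i, mem_W_comp s.2 _⟩, ⟨?_, fun l hl hlj => ?_⟩, hu⟩
          · dsimp only
            rwa [hu i hk.1.symm, hu j hk.2.symm]
          · dsimp only
            rw [hu i hk.1.symm]
            by_cases hlk : l = k
            · simp [hlk]
            · rw [hu l hlk]
              exact h2 l (by simp [hlk, hl]) hlj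
  obtain ⟨X, hX, h⟩ := key Finset.univ
  exact ⟨X, hX, h.trans (Set.ext fun s => by simp)⟩

theorem exists_generated_sem [Nonempty M] (hΓ : Γ.Admissible G) (hext : Γ.ExtensionProperty G)
    (hn : 3 ≤ n) (φ : Fml V n) :
    ∃ X, ((tameAlg n hG hN).matComplex n).Generated (matSingletons n hG hN) X ∧
      matTuples hG hN hΓ X = Γ.sem Γ.W φ := by
  have hhom := isHom_matTuples (hG := hG) (hN := hN) hΓ hext
  induction φ with
  | fls => exact ⟨⊥, .bot, hhom.map_bot⟩
  | eq i j => exact ⟨_, .diag i j, hhom.map_diag i j⟩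
  | rel l i j => exact exists_generated_rel hΓ hext hn l i j
  | or φ ψ ih1 ih2 =>
    obtain ⟨X, hX, hXφ⟩ := ih1
    obtain ⟨Y, hY, hYψ⟩ := ih2
    exact ⟨_, .sup X Y hX hY, by rw [hhom.map_sup, hXφ, hYψ]; rfl⟩
  | not φ ih =>
    obtain ⟨X, hX, hXφ⟩ := ih
    exact ⟨_, .compl X hX, by rw [hhom.map_compl, hXφ]; rfl⟩
  | ex i φ ih =>
    obtain ⟨X, hX, hXφ⟩ := ih
    exact ⟨_, .cyl i X hX, by rw [hhom.map_cyl, hXφ]; rfl⟩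

theorem isomorphic_mat [Nonempty M] (hΓ : Γ.Admissible G) (hext : Γ.ExtensionProperty G)
    (hn : 3 ≤ n) : (Γ.setAlg Γ.W).Isomorphic ((tameAlg n hG hN).mat n) := by
  apply CylAlg.Isomorphic.symm
  have hhom := isHom_matTuples (hG := hG) (hN := hN) hΓ hext
  refine ⟨fun X => ⟨matTuples hG hN hΓ X.1, matTuples_mem_range_sem hΓ hext X.2⟩,
    ⟨fun X Y => rfl, fun X => rfl, fun i X => Subtype.ext (hhom.map_cyl i X.1),
      fun i j => Subtype.ext (hhom.map_diag i j)⟩, fun X Y h => ?_, ?_⟩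
  · exact Subtype.ext (matTuples_injective hΓ hext (congrArg Subtype.val h))
  · rintro ⟨_, φ, rfl⟩
    obtain ⟨X, hX, h⟩ := exists_generated_sem (hG := hG) (hN := hN) hΓ hext hn φ
    exact ⟨⟨X, hX⟩, Subtype.ext h⟩

end LabelledGraph

/-! ## Monochromatic triangles and failure of representability -/

open Filter in
-- Ramsey's theorem by a nonprincipal ultrafilter: almost every `y` sees `x` in one colour `κ x`,
-- and `κ` is almost constant. Suitable `x`, `y`, `z` are then picked in turn.
theorem exists_monochromatic_triangle {U : Type u} {C : Type v} [Infinite U] [Finite C]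
    (r : U → U → C → Prop) (hr : ∀ x y, x ≠ y → ∃ c, r x y c) :
    ∃ c x y z, r x y c ∧ r x z c ∧ r y z c := by
  have hne : ∀ x : U, ∀ᶠ y in hyperfilter U, x ≠ y := fun x =>
    mem_of_superset (Set.finite_singleton x).compl_mem_hyperfilter fun y hy h => hy h.symm
  have h1 : ∀ x, ∃ c, ∀ᶠ y in hyperfilter U, r x y c := fun x =>
    Ultrafilter.eventually_exists_iff.1 ((hne x).mono fun y hy => hr x y hy)
  choose κ hκ using h1
  obtain ⟨c, hc⟩ : ∃ c, ∀ᶠ x in hyperfilter U, κ x = c :=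
    Ultrafilter.eventually_exists_iff.1 (Eventually.of_forall fun x => ⟨κ x, rfl⟩)
  obtain ⟨x, hx⟩ := hc.exists
  obtain ⟨y, hy, hxy⟩ := (hc.and (hκ x)).exists
  obtain ⟨z, hxz, hyz⟩ := ((hκ x).and (hκ y)).exists
  exact ⟨c, x, y, z, hx ▸ hxy, hx ▸ hxz, hy ▸ hyz⟩

theorem IsUnionOfCliques.exists_coloring {V : Type u} {G : SimpleGraph V} {N : ℕ}
    (hG : IsUnionOfCliques G N) (hN : 0 < N) :
    ∃ f : V → Fin N, ∀ a b, G.Adj a b → f a ≠ f b := by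
  have h : ∀ c : G.ConnectedComponent, ∃ f : V → Fin N, Set.InjOn f c.supp := fun c => by
    have hfin : c.supp.Finite := Set.finite_of_ncard_pos (by rw [(hG.2 c).2]; exact hN)
    have : Nonempty (Fin N) := ⟨⟨0, hN⟩⟩
    obtain ⟨f, -, hf⟩ := hfin.exists_injOn_of_encard_le (t := (Set.univ : Set (Fin N))) (by
      rw [← hfin.cast_ncard_eq, (hG.2 c).2]
      simp)
    exact ⟨f, hf⟩
  choose f hf using h
  refine ⟨fun a => f (G.connectedComponentMk a) a, fun a b hab heq => ?_⟩
  have hc : G.connectedComponentMk a = G.connectedComponentMk b :=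
    SimpleGraph.ConnectedComponent.sound hab.reachable
  beta_reduce at heq
  rw [← hc] at heq
  exact hab.ne (hf _ rfl hc.symm heq)

section NotRepresentable

open RAtom

variable {V : Type u} {n N : ℕ} {G : SimpleGraph V} {hG : IsUnionOfCliques G N} {hN : 1 < N}

/-- There is no assignment of relations to all the sets of atoms that respects the Boolean
structure and the consistent triangles. -/
theorem false_of_atom_relations (hG : IsUnionOfCliques G N) (hN : 1 < N) [NeZero n]
    {U : Type u} [Nonempty U] (E : Set (RAtom V n) → U → U → Prop) (htop : ∀ x y, E Set.univ x y)
    (hunion : ∀ S T x y, E (S ∪ T) x y → E S x y ∨ E T x y)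
    (hdisj : ∀ S T x y, Disjoint S T → E S x y → ¬ E T x y)
    (hnone : ∀ x y, E {none} x y → x = y)
    (hex : ∀ p x, ∃ y, E {some p} x y)
    (htri : ∀ S x y z, E S x y → E S x z → E S y z →
      ∃ p ∈ S, ∃ q ∈ S, ∃ r ∈ S, Consistent G (toEdge p) (toEdge q) (toEdge r)) : False := by
  classical
  have := hG.infinite
  obtain ⟨f, hf⟩ := hG.exists_coloring (by omega)
  -- The infinitely many atoms `(a, 0)` have pairwise distinct successors of one point.
  have hinf : Infinite U := by
    choose v hv using fun a : V => hex (a, 0) (Classical.arbitrary U)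
    refine Infinite.of_injective v fun a b hab => by_contra fun hne => ?_
    refine hdisj {some (a, 0)} {some (b, 0)} _ (v a) (by simpa using hne) (hv a) ?_
    rw [hab]
    exact hv b
  -- Finitely many sets covering the non-identity atoms. Each has one node per clique in its colour,
  -- so it is not tame: it exists only in the complex algebra.
  let red : Fin n × Fin N → Set (RAtom V n) := fun c => {p | ∃ a, p = some (a, c.1) ∧ f a = c.2}
  have hred : ∀ x y, x ≠ y → ∃ c, E (red c) x y := by
    intro x y hxy
    have key : ∀ I : Finset (Fin n × Fin N), E (⋃ c ∈ I, red c) x y → ∃ c, E (red c) x y := by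
      intro I
      induction I using Finset.induction_on with
      | empty =>
        intro h
        simp only [Finset.notMem_empty, Set.iUnion_of_empty, Set.iUnion_empty] at h
        exact (hdisj ∅ ∅ _ _ disjoint_bot_left h h).elim
      | insert c I _ ih =>
        intro h
        rw [Finset.set_biUnion_insert] at h
        exact (hunion _ _ _ _ h).elim (fun h => ⟨c, h⟩) ih
    refine key Finset.univ ((hunion {none} _ _ _ ?_).resolve_left fun h => hxy (hnone _ _ h))
    convert htop x y
    refine Set.eq_univ_of_forall fun p => ?_
    rcases p with _ | ⟨a, i⟩
    · exact .inl rfl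
    · exact .inr (Set.mem_biUnion (x := (i, f a)) (Finset.mem_univ _) ⟨a, rfl, rfl⟩)
  obtain ⟨c, x, y, z, h1, h2, h3⟩ := exists_monochromatic_triangle (fun x y c => E (red c) x y) hred
  obtain ⟨_, ⟨a, rfl, ha⟩, _, ⟨b, rfl, hb⟩, _, ⟨d, rfl, hd⟩, h⟩ := htri _ _ _ _ h1 h2 h3
  rcases consistent_some.1 h rfl rfl with h | h | h
  · exact hf _ _ h (ha.trans hb.symm)
  · exact hf _ _ h (ha.trans hd.symm)
  · exact hf _ _ h (hb.trans hd.symm)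

/-! ### The complex algebra of the relation algebra -/

/-- The algebra of all sets of atoms. -/
def atomSetAlg (n : ℕ) (G : SimpleGraph V) : RelAlg.{u} where
  carrier := Set (RAtom V n)
  comp X Y := compSet G X Y
  conv X := X
  ident := {none}

theorem isHom_atomSetAlg : RelAlg.IsHom (atomSetAlg n G) (tameAlg n hG hN).complexAlg
    fun S => {a | ∃ p ∈ (show Set (RAtom V n) from S), a.1 = tameAtom hG hN p} := by
  have hmem : ∀ (S : Set (RAtom V n)) (p : RAtom V n),
      (∃ q ∈ S, tameAtom hG hN p = tameAtom hG hN q) ↔ p ∈ S := fun S p =>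
    ⟨fun ⟨q, hq, h⟩ => tameAtom_injective h ▸ hq, fun h => ⟨p, h, rfl⟩⟩
  have hext : ∀ X Y : Set {a : (tameAlg n hG hN).carrier // IsAtom a},
      (∀ p, ⟨tameAtom hG hN p, isAtom_tameAtom p⟩ ∈ X ↔
        ⟨tameAtom hG hN p, isAtom_tameAtom p⟩ ∈ Y) → X = Y := by
    refine fun X Y h => Set.ext ?_
    rintro ⟨a, ha⟩
    obtain ⟨p, rfl⟩ := exists_eq_tameAtom ha
    exact h p
  constructor
  · intro X Y
    refine hext _ _ fun p => ?_
    exact (hmem (X ∪ Y) p).trans (or_congr (hmem X p).symm (hmem Y p).symm)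
  · intro X
    refine hext _ _ fun p => ?_
    exact (hmem Xᶜ p).trans (not_congr (hmem X p).symm)
  · intro X Y
    refine hext _ _ fun r => (hmem (compSet G X Y) r).trans ⟨?_, ?_⟩
    · rintro ⟨p, hp, q, hq, h⟩
      exact ⟨⟨_, isAtom_tameAtom p⟩, ⟨p, hp, rfl⟩, ⟨_, isAtom_tameAtom q⟩, ⟨q, hq, rfl⟩,
        tameAtom_le_comp_tameAtom.2 h⟩
    · rintro ⟨⟨_, _⟩, ⟨p, hp, rfl⟩, ⟨_, _⟩, ⟨q, hq, rfl⟩, h⟩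
      exact ⟨p, hp, q, hq, tameAtom_le_comp_tameAtom.1 h⟩
  · intro X
    refine hext _ _ fun p => (hmem X p).trans ⟨fun h => ?_, ?_⟩
    · exact ⟨⟨_, isAtom_tameAtom p⟩, ⟨p, h, rfl⟩, le_rfl⟩
    · rintro ⟨⟨_, _⟩, ⟨q, hq, rfl⟩, h⟩
      rwa [show p = q from tameAtom_le.1 h]
  · exact hext _ _ fun p => (hmem {none} p).trans tameAtom_le_ident.symm

theorem not_isHom_full_atomSetAlg (hG : IsUnionOfCliques G N) (hN : 1 < N) [NeZero n] {U : Type u}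
    [Nonempty U] (F : Set (RAtom V n) → Set (U × U)) :
    ¬ RelAlg.IsHom (atomSetAlg n G) (RelAlg.full U) F := by
  intro hF
  have htop : F Set.univ = (Set.univ : Set (U × U)) := hF.map_top
  have hid : F {none} = {p : U × U | p.1 = p.2} := hF.map_ident
  have hbot : F (∅ : Set (RAtom V n)) = (∅ : Set (U × U)) := hF.map_bot
  have hinf : ∀ S T : Set (RAtom V n), F (S ∩ T) = (F S ∩ F T) := hF.map_inf
  have hsup : ∀ S T : Set (RAtom V n), F (S ∪ T) = (F S ∪ F T) := hF.map_sup
  have hcomp : ∀ S T : Set (RAtom V n), F (compSet G S T) =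
      {p : U × U | ∃ z, (p.1, z) ∈ (F S) ∧ (z, p.2) ∈ (F T)} :=
    hF.map_comp
  have hconv : ∀ S : Set (RAtom V n), F S = {p : U × U | (p.2, p.1) ∈ (F S)} :=
    hF.map_conv
  refine false_of_atom_relations hG hN (fun S x y => (x, y) ∈ (F S)) (fun x y => ?_)
    (fun S T x y h => ?_) (fun S T x y hST h h' => ?_) (fun x y h => ?_) (fun p x => ?_)
    (fun S x y z hxy hxz hyz => ?_)
  · rw [htop]
    trivial
  · rwa [hsup] at h
  · have h2 : (x, y) ∈ (F (S ∩ T)) := by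
      rw [hinf]
      exact ⟨h, h'⟩
    rw [hST.inter_eq, hbot] at h2
    exact h2
  · rwa [hid] at h
  -- The composition of an atom with itself contains the identity, so the atom has a successor at
  -- every point.
  · have h1 : (x, x) ∈ (F (compSet G {some p} {some p})) := by
      have h2 : compSet G {some p} {some p} =
          (compSet G {some p} {some p} ∪ {none} : Set (RAtom V n)) := by
        rw [Set.union_eq_left.2]
        rintro _ rfl
        exact ⟨_, rfl, _, rfl, rfl⟩
      rw [h2, hsup]
      refine .inr ?_
      rw [hid]
      rfl
    rw [hcomp] at h1
    obtain ⟨y, hy, -⟩ := h1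
    exact ⟨y, hy⟩
  · have h1 : (x, z) ∈ (F (S ∩ compSet G S S)) := by
      rw [hinf, hcomp]
      exact ⟨hxz, y, hxy, hyz⟩
    by_contra! hno
    have h2 : S ∩ compSet G S S = ∅ := by
      refine Set.eq_empty_of_forall_notMem ?_
      rintro p ⟨hp, q, hq, r, hr, h⟩
      exact hno p hp q hq r hr h
    rw [h2, hbot] at h1
    exact h1

theorem not_representable_complexAlg_tameAlg [NeZero n] :
    ¬ (tameAlg n hG hN).complexAlg.Representable := by
  rintro ⟨I, U, hU, f, hf, hinj⟩
  rcases isEmpty_or_nonempty I with hI | ⟨⟨α⟩⟩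
  -- An empty product is trivial, which injectivity excludes. Otherwise one factor alone, with
  -- injectivity forgotten, already gives the contradiction.
  · have h : (∅ : Set {a : (tameAlg n hG hN).carrier // IsAtom a}) = Set.univ :=
      hinj (funext fun α => hI.elim α)
    exact h.symm.subset (Set.mem_univ ⟨_, isAtom_tameAtom none⟩)
  · have := hU α
    have h := hf.trans (isHom_atomSetAlg (hG := hG) (hN := hN))
    refine not_isHom_full_atomSetAlg hG hN _
      (⟨fun X Y => ?_, fun X => ?_, fun X Y => ?_, fun X => ?_, ?_⟩ :
        RelAlg.IsHom (atomSetAlg n G) (RelAlg.full (U α)) fun S =>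
          f {a | ∃ p ∈ (show Set (RAtom V n) from S), a.1 = tameAtom hG hN p} α)
    · exact congrFun (h.map_sup X Y) α
    · exact congrFun (h.map_compl X) α
    · exact congrFun (h.map_comp X Y) α
    · exact congrFun (h.map_conv X) α
    · exact congrFun h.map_ident α

theorem not_completelyRepresentable_tameAlg [NeZero n] :
    ¬ (tameAlg n hG hN).CompletelyRepresentable := fun h =>
  not_representable_complexAlg_tameAlg h.complexAlg

end NotRepresentable

/-! ## Failure of representability for the cylindric algebras -/

section MatComplex

open RAtom

variable {V : Type u} {n N : ℕ} {G : SimpleGraph V} {hG : IsUnionOfCliques G N} {hN : 1 < N}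

variable (hG hN) in
/-- The basic matrices with the entry `(k, l)` in a given set. -/
def entrySet (k l : Fin n) (S : Set (RAtom V n)) : Set (TameMatrix n hG hN) :=
  {m | m.entry k l ∈ S}

theorem cyl_entrySet_of_ne {i k l : Fin n} (hk : k ≠ i) (hl : l ≠ i) (S : Set (RAtom V n)) :
    ((tameAlg n hG hN).matComplex n).cyl i (entrySet hG hN k l S) = entrySet hG hN k l S := by
  refine Set.ext (α := TameMatrix n hG hN) fun m => ⟨?_, fun hm => ⟨m, hm, fun _ _ _ _ => rfl⟩⟩
  rintro ⟨m', hm', h⟩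
  show TameMatrix.entry m k l ∈ S
  rw [TameMatrix.entry_eq_entry.2 (h k l hk hl)]
  exact hm'

theorem TameMatrix.mem_diag {m : TameMatrix n hG hN} {k l : Fin n} :
    m ∈ (show Set (TameMatrix n hG hN) from ((tameAlg n hG hN).matComplex n).diag k l) ↔
      m.entry k l = none := by
  show m.1 k l ≤ _ ↔ _
  rw [TameMatrix.eq_entry, tameAtom_le_ident]

theorem TameMatrix.entry_comm (m : TameMatrix n hG hN) (k l : Fin n) : m.entry k l = m.entry l k :=
  toEdge_injective (m.isNetwork.symm k l)

theorem TameMatrix.entry_eq_of_entry_eq_none (m : TameMatrix n hG hN) {i k : Fin n} (l : Fin n)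
    (h : m.entry i k = none) : m.entry i l = m.entry k l := by
  have h1 := m.isNetwork.tri i l k
  rw [h, toEdge_none, consistent_none_mid] at h1
  exact toEdge_injective h1

/-- Moving an index of an entry by substitution. -/
theorem cyl_diag_inf_entrySet {i k l : Fin n} (hik : i ≠ k) (hil : i ≠ l) (S : Set (RAtom V n)) :
    ((tameAlg n hG hN).matComplex n).cyl i
      (((tameAlg n hG hN).matComplex n).diag i k ⊓ entrySet hG hN i l S) =
        entrySet hG hN k l S := by
  refine Set.ext (α := TameMatrix n hG hN) fun m => ⟨?_, fun hm => ?_⟩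
  · rintro ⟨m', ⟨h1, h2⟩, h⟩
    show TameMatrix.entry m k l ∈ S
    rw [TameMatrix.entry_eq_entry.2 (h k l hik.symm hil.symm),
      ← TameMatrix.entry_eq_of_entry_eq_none m' l (TameMatrix.mem_diag.1 h1)]
    exact h2
  · let f : Fin n → Fin n := Function.update id i k
    have hfi : f i = k := Function.update_self _ _ _
    have hf : ∀ l, l ≠ i → f l = l := fun l hl => Function.update_of_ne hl _ _
    let m' : TameMatrix n hG hN := TameMatrix.mk (fun k l => m.entry (f k) (f l))
      ((TameMatrix.isNetwork m).comp f)
    have hm' : ∀ k l, m'.entry k l = m.entry (f k) (f l) := fun k l => TameMatrix.entry_mk _ k l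
    refine ⟨m', ⟨TameMatrix.mem_diag.2 ?_, ?_⟩, fun k l hk hl => ?_⟩
    · rw [hm', hfi, hf k hik.symm, ← toEdge_eq_none]
      exact (TameMatrix.isNetwork m).refl k
    · show m'.entry i l ∈ S
      rw [hm', hfi, hf l hil.symm]
      exact hm
    · refine (TameMatrix.entry_eq_entry (m := m) (m' := m')).1 ?_
      rw [hm', hf k hk, hf l hl]

/-- A matrix with one point extends at the index `j` by a second point at any prescribed edge. In a
representation this supplies a successor for every atom. -/
theorem mem_cyl_entrySet_of_constant {m : TameMatrix n hG hN} (hm : ∀ k l, m.entry k l = none)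
    {i j : Fin n} (hij : i ≠ j) (p : RAtom V n) :
    m ∈ (show Set (TameMatrix n hG hN) from
      ((tameAlg n hG hN).matComplex n).cyl j (entrySet hG hN i j {p})) := by
  have hnet : IsNetwork G fun k l => toEdge (updateRow m.entry j (fun _ => p) k l) := by
    have h1 := m.isNetwork.updateRow (i := j) (b := fun _ => toEdge p) fun k l _ _ => by
      rw [hm, toEdge_none, consistent_none_left]
    have h2 : updateRow (fun k l => toEdge (m.entry k l)) j (fun _ => toEdge p) =
        fun k l => toEdge (updateRow m.entry j (fun _ => p) k l) :=
      funext fun k => funext fun l => (map_updateRow _ m.entry j (fun _ => p) k l).symm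
    exact h2 ▸ h1
  refine ⟨TameMatrix.mk _ hnet, ?_, fun k l hk hl => ?_⟩
  · show TameMatrix.entry _ i j = p
    rw [TameMatrix.entry_mk]
    simp [updateRow, hij]
  · refine (TameMatrix.entry_eq_entry (m := m)).1 ?_
    rw [TameMatrix.entry_mk]
    simp [updateRow, hk, hl]

/-- The entry at `(0,1)` gives a binary relation on the base for every set of atoms.
Cylindrifications show that it depends on two coordinates only, and substitutions through the third
index show that `(0,2)` and `(1,2)` give the same relation. Consistency of matrices then supplies
the triangle condition of `false_of_atom_relations`. -/
theorem not_isHom_full_matComplex (hn : 3 ≤ n) {U : Type u} [Nonempty U]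
    (F : Set (TameMatrix n hG hN) → Set (Set.univ : Set (Fin n → U))) :
    ¬ CylAlg.IsHom ((tameAlg n hG hN).matComplex n) (CylAlg.full n U) F := by
  classical
  intro hF
  have : NeZero n := ⟨by omega⟩
  let i0 : Fin n := ⟨0, by omega⟩
  let i1 : Fin n := ⟨1, by omega⟩
  let i2 : Fin n := ⟨2, by omega⟩
  have h01 : i0 ≠ i1 := by simp [i0, i1]
  have h02 : i0 ≠ i2 := by simp [i0, i2]
  have h12 : i1 ≠ i2 := by simp [i1, i2]
  let H : Set (TameMatrix n hG hN) → (Fin n → U) → Prop := fun X s =>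
    (⟨s, trivial⟩ : (Set.univ : Set (Fin n → U))) ∈ F X
  have htop : ∀ s, H Set.univ s := fun s => by
    have h : F Set.univ = Set.univ := hF.map_top
    exact h.symm.subset (Set.mem_univ _)
  have hbot : ∀ s, ¬ H ∅ s := fun s hs => by
    have h : F ∅ = ∅ := hF.map_bot
    exact (h.subset hs).elim
  have hinf : ∀ X Y s, H (X ∩ Y) s ↔ H X s ∧ H Y s := fun X Y s => by
    have h : F (X ∩ Y) = F X ∩ F Y := hF.map_inf X Y
    exact Set.ext_iff.1 h _
  have hsup : ∀ X Y s, H (X ∪ Y) s ↔ H X s ∨ H Y s := fun X Y s => by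
    have h : F (X ∪ Y) = F X ∪ F Y := hF.map_sup X Y
    exact Set.ext_iff.1 h _
  have hmono : ∀ X Y s, X ⊆ Y → H X s → H Y s := fun X Y s hXY => by
    have h : F X ⊆ F Y := hF.mono hXY
    exact fun hs => h hs
  have hcyl : ∀ i X s, H (((tameAlg n hG hN).matComplex n).cyl i X) s ↔
      ∃ t, H X t ∧ ∀ j, j ≠ i → t j = s j := fun i X s => by
    have h : F (((tameAlg n hG hN).matComplex n).cyl i X) =
        {s | ∃ t ∈ F X, ∀ j, j ≠ i → t.1 j = s.1 j} := hF.map_cyl i X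
    refine (Set.ext_iff.1 h _).trans ⟨?_, ?_⟩
    · rintro ⟨t, ht, hts⟩
      exact ⟨t.1, ht, hts⟩
    · rintro ⟨t, ht, hts⟩
      exact ⟨⟨t, trivial⟩, ht, hts⟩
  have hdiag : ∀ i j s, H (((tameAlg n hG hN).matComplex n).diag i j) s ↔
      s i = s j := fun i j s => by
    have h : F (((tameAlg n hG hN).matComplex n).diag i j) = {s | s.1 i = s.1 j} := hF.map_diag i j
    exact Set.ext_iff.1 h _
  -- The other coordinates are replaced one at a time; cylindrifying over such a coordinate does not
  -- change the set of matrices.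
  have hcongr : ∀ S s t, s i0 = t i0 → s i1 = t i1 → H (entrySet hG hN i0 i1 S) s →
      H (entrySet hG hN i0 i1 S) t := by
    intro S s t h0 h1 hs
    have key : ∀ K : Finset (Fin n), H (entrySet hG hN i0 i1 S)
        (fun k => if k ∈ K then t k else s k) := by
      intro K
      induction K using Finset.induction_on with
      | empty => simpa using hs
      | insert k K hk ih =>
        by_cases hk' : k = i0 ∨ k = i1
        · convert ih using 2 with l
          by_cases hl : l = k
          · have : s k = t k := by rcases hk' with rfl | rfl <;> assumption
            simp [hl, hk, this]
          · simp [hl]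
        · push Not at hk'
          refine hmono _ _ _ (Eq.subset (α := Set (TameMatrix n hG hN))
            (cyl_entrySet_of_ne (i := k) hk'.1.symm hk'.2.symm S))
            ((hcyl k (entrySet hG hN i0 i1 S) _).2 ⟨_, ih, fun l hl => ?_⟩)
          simp [hl]
    simpa using key Finset.univ
  let E : Set (RAtom V n) → U → U → Prop := fun S x y =>
    H (entrySet hG hN i0 i1 S) fun k => if k = i0 then x else y
  have hE01 : ∀ S s, H (entrySet hG hN i0 i1 S) s ↔ E S (s i0) (s i1) := fun S s =>
    ⟨hcongr S _ _ (by simp) (by simp [h01.symm]), hcongr S _ _ (by simp) (by simp [h01.symm])⟩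
  -- The term `c_i (d_ik · x)` acts as substitution on both sides of the homomorphism.
  have hsubst : ∀ (i k l : Fin n), i ≠ k → i ≠ l → ∀ S s,
      H (entrySet hG hN k l S) s ↔ H (entrySet hG hN i l S) (Function.update s i (s k)) := by
    intro i k l hik hil S s
    have h := cyl_diag_inf_entrySet (hG := hG) (hN := hN) hik hil S
    rw [← h, hcyl]
    constructor
    · rintro ⟨t, ht, hts⟩
      obtain ⟨h1, h2⟩ := (hinf _ _ _).1 ht
      rw [hdiag] at h1
      convert h2 using 1
      funext l
      by_cases hl : l = i
      · rw [hl, Function.update_self, h1, hts k hik.symm]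
      · rw [Function.update_of_ne hl, hts l hl]
    · refine fun h => ⟨_, (hinf _ _ _).2 ⟨(hdiag _ _ _).2 ?_, h⟩, fun l hl =>
        Function.update_of_ne hl _ _⟩
      rw [Function.update_self, Function.update_of_ne hik.symm]
  have hcomm : ∀ (k l : Fin n) S, entrySet hG hN k l S = entrySet hG hN l k S := fun k l S =>
    Set.ext fun m => by rw [entrySet, entrySet, Set.mem_ofPred_eq, Set.mem_ofPred_eq, m.entry_comm]
  have hE02 : ∀ S s, H (entrySet hG hN i0 i2 S) s ↔ E S (s i0) (s i2) := fun S s => by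
    rw [hcomm, hsubst i1 i2 i0 h12 h01.symm, hcomm, hE01, Function.update_self,
      Function.update_of_ne h01]
  have hE12 : ∀ S s, H (entrySet hG hN i1 i2 S) s ↔ E S (s i1) (s i2) := fun S s => by
    rw [hsubst i0 i1 i2 h01 h02, hE02, Function.update_self, Function.update_of_ne h02.symm]
  refine false_of_atom_relations hG hN E (fun x y => htop _) (fun S T x y => (hsup _ _ _).1)
    (fun S T x y hST h h' => ?_) (fun x y h => ?_) (fun p x => ?_) (fun S x y z hxy hxz hyz => ?_)
  · have h1 := (hinf _ _ _).2 ⟨h, h'⟩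
    have h2 : entrySet hG hN i0 i1 S ∩ entrySet hG hN i0 i1 T = ∅ :=
      Set.eq_empty_of_forall_notMem fun m hm => Set.disjoint_left.1 hST hm.1 hm.2
    exact hbot _ (h2 ▸ h1)
  · have h1 := hmono _ (((tameAlg n hG hN).matComplex n).diag i0 i1) _
      (fun m hm => TameMatrix.mem_diag.2 hm) h
    simpa [h01.symm] using (hdiag _ _ _).1 h1
  -- A constant tuple satisfies all diagonals, so it lies in the image of the set of matrices with
  -- one point.
  · have h1 : ∀ K : Finset (Fin n), H {m | ∀ k ∈ K, m.entry i0 k = none} fun _ => x := by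
      intro K
      induction K using Finset.induction_on with
      | empty => exact hmono _ _ _ (fun m _ k hk => absurd hk (Finset.notMem_empty k)) (htop _)
      | insert k K _ ih =>
        refine hmono _ _ _ ?_ ((hinf _ _ _).2 ⟨(hdiag i0 k fun _ => x).2 rfl, ih⟩)
        rintro m ⟨h1, h2⟩ l hl
        rcases Finset.mem_insert.1 hl with rfl | hl
        · exact TameMatrix.mem_diag.1 h1
        · exact h2 l hl
    have h2 := hmono _ (((tameAlg n hG hN).matComplex n).cyl i1 (entrySet hG hN i0 i1 {some p})) _
      (fun m hm => mem_cyl_entrySet_of_constant (fun k l => by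
        have hm : ∀ k ∈ Finset.univ, m.entry i0 k = none := hm
        rw [← m.entry_eq_of_entry_eq_none l (hm k (Finset.mem_univ k)), hm l (Finset.mem_univ l)])
        h01 (some p)) (h1 Finset.univ)
    obtain ⟨t, ht, hts⟩ := (hcyl _ _ _).1 h2
    rw [hE01, hts i0 h01] at ht
    exact ⟨_, ht⟩
  · let s : Fin n → U := fun k => if k = i0 then x else if k = i1 then y else z
    have hs0 : s i0 = x := by simp [s]
    have hs1 : s i1 = y := by simp [s, h01.symm]
    have hs2 : s i2 = z := by simp [s, h02.symm, h12.symm]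
    by_contra! hno
    refine hbot s (hmono _ _ _ ?_ ((hinf _ _ _).2 ⟨(hE01 S s).2 ?_, (hinf _ _ _).2
      ⟨(hE02 S s).2 ?_, (hE12 S s).2 ?_⟩⟩))
    · rintro m ⟨h1, h2, h3⟩
      refine hno _ h1 _ h2 _ h3 ?_
      rw [m.entry_comm i1 i2]
      exact m.isNetwork.tri i0 i1 i2
    · rwa [hs0, hs1]
    · rwa [hs0, hs2]
    · rwa [hs1, hs2]

end MatComplex

namespace LabelledGraph

variable {V : Type u} {n N : ℕ} {M : Type u} {Γ : LabelledGraph V n M} {G : SimpleGraph V}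
  {hG : IsUnionOfCliques G N} {hN : 1 < N}

/-- A tuple in an atom of the set algebra. -/
noncomputable def atomPoint (a : {a : (Γ.setAlg Γ.W).carrier // IsAtom a}) : Γ.W :=
  (pts_ne_empty.1 a.2.1).choose

theorem atomPoint_mem (a : {a : (Γ.setAlg Γ.W).carrier // IsAtom a}) :
    atomPoint a ∈ pts a.1 :=
  (pts_ne_empty.1 a.2.1).choose_spec

theorem atom_le_iff (hhom : Γ.StronglyHomogeneous) (a : {a : (Γ.setAlg Γ.W).carrier // IsAtom a})
    (x : (Γ.setAlg Γ.W).carrier) : a.1 ≤ x ↔ atomPoint a ∈ pts x :=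
  ⟨fun h => h (atomPoint_mem a), le_of_mem_pts hhom a.2 (atomPoint_mem a)⟩

theorem tupleMatrix_eq_of_mem (hΓ : Γ.Admissible G) (hhom : Γ.StronglyHomogeneous)
    (a : {a : (Γ.setAlg Γ.W).carrier // IsAtom a}) {t : Γ.W} (ht : t ∈ pts a.1) :
    tupleMatrix hG hN hΓ t = tupleMatrix hG hN hΓ (atomPoint a) := by
  rw [tupleMatrix_eq_iff]
  intro k l
  rw [toEdge_tupleMatrix]
  rw [eq_typeClass_of_isAtom hhom a.2 (atomPoint_mem a)] at ht
  exact ht k l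

theorem mem_matTuples_congr {hΓ : Γ.Admissible G} {s t : Γ.W}
    (h : tupleMatrix hG hN hΓ s = tupleMatrix hG hN hΓ t) (X : Set (TameMatrix n hG hN)) :
    s ∈ (show Set Γ.W from matTuples hG hN hΓ X) ↔
      t ∈ (show Set Γ.W from matTuples hG hN hΓ X) := by
  show tupleMatrix hG hN hΓ s ∈ X ↔ tupleMatrix hG hN hΓ t ∈ X
  rw [h]

/-- Atoms of the set algebra are types, and types are basic matrices. A homomorphism in this
direction is all that is needed to pull a representation back to the matrices. -/
theorem isHom_matComplex_complexAlg [Nonempty M] (hΓ : Γ.Admissible G)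
    (hext : Γ.ExtensionProperty G) (hhom : Γ.StronglyHomogeneous) :
    CylAlg.IsHom ((tameAlg n hG hN).matComplex n) (Γ.setAlg Γ.W).complexAlg
      fun X => {a | atomPoint a ∈ (show Set Γ.W from matTuples hG hN hΓ X)} := by
  have hh := isHom_matTuples (hG := hG) (hN := hN) hΓ hext
  refine ⟨fun _ _ => rfl, fun _ => rfl, fun i X => ?_, fun i j => ?_⟩
  · refine Set.ext (α := {a : (Γ.setAlg Γ.W).carrier // IsAtom a}) fun a => ?_
    have h1 : atomPoint a ∈ (show Set Γ.W from
        matTuples hG hN hΓ (((tameAlg n hG hN).matComplex n).cyl i X)) ↔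
        ∃ t ∈ (show Set Γ.W from matTuples hG hN hΓ X), ∀ j, j ≠ i → t.1 j = (atomPoint a).1 j := by
      rw [hh.map_cyl]
      rfl
    refine h1.trans ⟨?_, ?_⟩
    · rintro ⟨t, ht, hts⟩
      refine ⟨⟨_, isAtom_typeClass hhom t⟩, ?_,
        (atom_le_iff hhom a _).2 ⟨t, self_mem_typeClass t, hts⟩⟩
      exact (mem_matTuples_congr (tupleMatrix_eq_of_mem hΓ hhom ⟨_, isAtom_typeClass hhom t⟩
        (self_mem_typeClass t)) X).1 ht
    · rintro ⟨b, hb, hab⟩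
      obtain ⟨t, ht, hts⟩ := (atom_le_iff hhom a _).1 hab
      exact ⟨t, (mem_matTuples_congr (tupleMatrix_eq_of_mem hΓ hhom b ht) X).2 hb, hts⟩
  · refine Set.ext (α := {a : (Γ.setAlg Γ.W).carrier // IsAtom a}) fun a => ?_
    have h1 : atomPoint a ∈ (show Set Γ.W from
        matTuples hG hN hΓ (((tameAlg n hG hN).matComplex n).diag i j)) ↔
        (atomPoint a).1 i = (atomPoint a).1 j := by
      rw [hh.map_diag]
      rfl
    exact h1.trans (atom_le_iff hhom a ((Γ.setAlg Γ.W).diag i j)).symm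

theorem not_representable_complexAlg_setAlg [Nonempty M] (hn : 3 ≤ n) (hG : IsUnionOfCliques G N)
    (hN : 1 < N) (hΓ : Γ.Admissible G) (hext : Γ.ExtensionProperty G)
    (hhom : Γ.StronglyHomogeneous) : ¬ (Γ.setAlg Γ.W).complexAlg.Representable := by
  rintro ⟨I, U, hU, f, hf, hinj⟩
  rcases isEmpty_or_nonempty I with hI | ⟨⟨α⟩⟩
  · have h : (∅ : Set {a : (Γ.setAlg Γ.W).carrier // IsAtom a}) = Set.univ :=
      hinj (funext fun α => hI.elim α)
    have hW : (fun _ => Classical.arbitrary M) ∈ Γ.W :=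
      mem_W_iff.2 fun _ _ _ => by simp [edge_self]
    exact h.symm.subset (Set.mem_univ ⟨_, isAtom_typeClass hhom ⟨_, hW⟩⟩)
  · have := hU α
    have h := hf.comp (isHom_matComplex_complexAlg (hG := hG) (hN := hN) hΓ hext hhom)
    refine not_isHom_full_matComplex (hG := hG) (hN := hN) hn _
      (⟨fun X Y => ?_, fun X => ?_, fun i X => ?_, fun i j => ?_⟩ :
        CylAlg.IsHom ((tameAlg n hG hN).matComplex n) (CylAlg.full n (U α)) fun X =>
          f {a | atomPoint a ∈ (show Set Γ.W from matTuples hG hN hΓ X)} α)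
    · exact congrFun (h.map_sup X Y) α
    · exact congrFun (h.map_compl X) α
    · exact congrFun (h.map_cyl i X) α
    · exact congrFun (h.map_diag i j) α

theorem not_completelyRepresentable_setAlg [Nonempty M] (hn : 3 ≤ n) (hG : IsUnionOfCliques G N)
    (hN : 1 < N) (hΓ : Γ.Admissible G) (hext : Γ.ExtensionProperty G)
    (hhom : Γ.StronglyHomogeneous) : ¬ (Γ.setAlg Γ.W).CompletelyRepresentable := fun h => by
  have := isAtomic_setAlg hhom
  exact not_representable_complexAlg_setAlg hn hG hN hΓ hext hhom h.complexAlg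

end LabelledGraph

theorem mainTheorem1 {V : Type u} (G : SimpleGraph V) (n N : ℕ) (hn : 3 ≤ n)
    (hN : n * (n - 1) / 2 ≤ N) (hG : IsUnionOfCliques G N) :
    ∃ (M : Type u) (Γ : LabelledGraph V n M),
      Γ.Admissible G ∧ Γ.ExtensionProperty G ∧ Γ.StronglyHomogeneous ∧
      IsAtomic (Γ.setAlg Γ.W).carrier ∧ (Γ.setAlg Γ.W).Representable ∧
      (∃ R : RelAlg.{u}, IsAtomic R.carrier ∧ R.Representable ∧
        R.IsCylindricBasis hn {m | R.IsBasicMatrix m} ∧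
        (Γ.setAlg Γ.W).Isomorphic (R.mat n) ∧
        R.IsCompletion R.complexAlg ∧ ¬ R.complexAlg.Representable ∧
        ¬ R.CompletelyRepresentable) ∧
      (Γ.setAlg Γ.W).IsCompletion (Γ.setAlg Γ.W).complexAlg ∧
      ¬ (Γ.setAlg Γ.W).complexAlg.Representable ∧
      ¬ (Γ.setAlg Γ.W).CompletelyRepresentable := by
  have : NeZero n := ⟨by omega⟩
  -- With `n ≥ 3` the bound gives `N ≥ 3`; only `N > 1`, that is, the existence of neighbours, is
  -- needed for the relation algebra.
  have hN1 : 1 < N := by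
    have h : 3 * 2 ≤ n * (n - 1) := Nat.mul_le_mul hn (by omega)
    omega
  obtain ⟨M, Γ, hM, hΓ, hext, hhom⟩ := LabelledGraph.exists_homogeneous (n := n) G
  exact ⟨M, Γ, hΓ, hext, hhom, LabelledGraph.isAtomic_setAlg hhom,
    LabelledGraph.representable_setAlg hΓ hext hG hN,
    ⟨tameAlg n hG hN1, isAtomic_tameAlg,
      LabelledGraph.representable_tameAlg hΓ hext hn hG hN1,
      LabelledGraph.isCylindricBasis_tameAlg hΓ hext hn,
      LabelledGraph.isomorphic_mat hΓ hext hn, isCompletion_tameAlg,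
      not_representable_complexAlg_tameAlg, not_completelyRepresentable_tameAlg⟩,
    LabelledGraph.isCompletion_setAlg hhom,
    LabelledGraph.not_representable_complexAlg_setAlg hn hG hN1 hΓ hext hhom,
    LabelledGraph.not_completelyRepresentable_setAlg hn hG hN1 hΓ hext hhom⟩
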